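/- Let $G=(V,E)$ be a finite loopless graph (parallel edges allowed). A weighted Holant instance $\Omega$ on $G$ consists of a symmetric function $F_v=[f_0,\dots,f_{d_v}]$ with nonnegative real values at every vertex $v$, where $d_v$ is the degree of $v$ and $f_j$ is the value of $F_v$ on inputs of Hamming weight $j$, and of a real weight $\lambda_e$ for every edge $e$. With $E(v)$ the set of edges incident with $v$, its partition function is $$Z(\Omega)=\sum_{\sigma:E\to\{0,1\}}\ \prod_{e\in E}\lambda_e^{\sigma(e)}\prod_{v\in V}F_v(\sigma|_{E(v)}).$$ For $p>0$ let $\mathcal F_{1.17,+\infty}^{p}$ be the set of all symmetric functions $[f_0,\dots,f_d]$, $d\ge 0$, with nonnegative real values for which there is a real $c\ge 1.17$ (which may differ from function to function) with $f_{i+2}=c f_{i+1}+f_i$ for $0\le i\le d-2$, and $f_{i+1}\ge p f_i$ for $0\le i\le d-1$. Let $\Lambda_{1,+\infty}=[1,\infty)$. The problem $\mathrm{Holant}(\mathcal F_{1.17,+\infty}^{p},\Lambda_{1,+\infty})$ is to compute $Z(\Omega)$ for instances $\Omega$ with all $F_v\in\mathcal F_{1.17,+\infty}^{p}$ and all $\lambda_e\in\Lambda_{1,+\infty}$.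 **Theorem.** For every $p>0$ there is an FPTAS for $\mathrm{Holant}(\mathcal F_{1.17,+\infty}^{p},\Lambda_{1,+\infty})$: there is a deterministic algorithm (depending on $p$ only) that, given an instance $\Omega$ of the problem and $\varepsilon>0$, returns a number $Z'$ with $$(1-\varepsilon)Z(\Omega)<Z'<(1+\varepsilon)Z(\Omega)$$ if $Z(\Omega)\neq 0$, and $Z'=0$ if $Z(\Omega)=0$, in time polynomial in the size of the input and in $1/\varepsilon$. Here the algorithm is a program with rational constants that uses on numbers only the four field operations and comparisons. The same program satisfies the time bound in both of the following senses: for real instances with arithmetic at unit cost, where the size of the input is that of the graph, $|V|+|E|$ up to constant factors; and for rational instances and rational $\varepsilon$ with arithmetic charged by bit length, where the size of the input is its length in bits. -/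

import Mathlib

/-! ## Weighted Holant instances with symmetric vertex functions -/

/-- A symmetric function `[f₀, f₁, …, f_d]` of some arity `d`: `f_j` is its value on the inputs
of Hamming weight `j`. -/
abbrev SymFun (K : Type) : Type := Σ d : ℕ, (Fin (d + 1) → K)

/-- A finite graph on `n` vertices and `m` edges, without loops; parallel edges are allowed. -/
structure FinGraph where
  n : ℕ
  m : ℕ
  src : Fin m → Fin n
  tgt : Fin m → Fin n
  loopless : ∀ e, src e ≠ tgt e

namespace FinGraph

/-- The set `E(v)` of the edges incident with `v`. -/
def edgesAt (G : FinGraph) (v : Fin G.n) : Finset (Fin G.m) :=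
  Finset.univ.filter fun e => G.src e = v ∨ G.tgt e = v

def deg (G : FinGraph) (v : Fin G.n) : ℕ := (G.edgesAt v).card

/-- The Hamming weight of the restriction of the configuration `σ` to `E(v)`. -/
def weightAt (G : FinGraph) (v : Fin G.n) (σ : Fin G.m → Bool) : Fin (G.deg v + 1) :=
  ⟨((G.edgesAt v).filter fun e => σ e = true).card,
    Nat.lt_succ_of_le (Finset.card_filter_le _ _)⟩

end FinGraph

/-- A weighted Holant instance with numbers from `K`: a graph, at every vertex `v` a symmetric
function of arity `deg v`, and for every edge a weight `λ_e = λ_e(1)` (with `λ_e(0) = 1`). -/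
structure HolantInstance (K : Type) where
  G : FinGraph
  sig : (v : Fin G.n) → Fin (G.deg v + 1) → K
  lam : Fin G.m → K

namespace HolantInstance

def map {K L : Type} (φ : K → L) (Ω : HolantInstance K) : HolantInstance L where
  G := Ω.G
  sig v i := φ (Ω.sig v i)
  lam e := φ (Ω.lam e)

/-- The partition function `Z(Ω)`, the sum of the weights of all configurations. -/
def Z {K : Type} [CommSemiring K] (Ω : HolantInstance K) : K :=
  ∑ σ : Fin Ω.G.m → Bool,
    (∏ e, if σ e = true then Ω.lam e else 1) * ∏ v, Ω.sig v (Ω.G.weightAt v σ)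

/-- `Ω` is an input of the problem `Holant(𝓕, Λ)`. -/
def IsInputOf (Ω : HolantInstance ℝ) (𝓕 : Set (SymFun ℝ)) (Λ : Set ℝ) : Prop :=
  (∀ v, (⟨Ω.G.deg v, Ω.sig v⟩ : SymFun ℝ) ∈ 𝓕) ∧ ∀ e, Ω.lam e ∈ Λ

end HolantInstance

/-- `f_{i+2} = c f_{i+1} + f_i` for `0 ≤ i ≤ d - 2`. -/
def IsFibonacci (c : ℝ) (F : SymFun ℝ) : Prop :=
  ∀ i : ℕ, ∀ h : i + 2 ≤ F.1,
    F.2 ⟨i + 2, by omega⟩ = c * F.2 ⟨i + 1, by omega⟩ + F.2 ⟨i, by omega⟩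

/-- The family `𝓕_c^p`: nonnegative Fibonacci functions with parameter `c` and
`f_{i+1} ≥ p f_i` for `0 ≤ i ≤ d - 1`. -/
def fibonacciFamily (c p : ℝ) : Set (SymFun ℝ) :=
  {F | (∀ i, 0 ≤ F.2 i) ∧ IsFibonacci c F ∧
    ∀ i : Fin F.1, p * F.2 i.castSucc ≤ F.2 i.succ}

/-- The family `𝓕_{c₀, +∞}^p`, the union of the `𝓕_c^p` over `c ≥ c₀`. -/
def fibonacciFamilyFrom (c₀ p : ℝ) : Set (SymFun ℝ) :=
  ⋃ c ∈ Set.Ici c₀, fibonacciFamily c p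

/-! ## The model of computation

Programs of a first-order recursive language (a small Lisp) whose data are binary trees with
numbers at the leaves.  The numbers come from an ordered field `K`; a program can only apply the
four field operations to them and compare two of them.  A bit-length function `w : K → ℕ` gives
the price of arithmetic: every evaluation step costs `1`, and an arithmetic operation or a
comparison costs in addition the lengths of its two operands.  Trees are shared and not copied,
so that every step that is not arithmetic has constant cost on a random access machine. -/

/-- Data of programs. -/
inductive Val (K : Type) : Type
  | nil : Val K
  | num (a : K) : Val K
  | pair (a b : Val K) : Val K

inductive ArithOp : Type
  | add | sub | mul | div

/-- Expressions.  Variables are de Bruijn indices; the constants are rational, so no information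
can be hidden in them; `call f a` applies the `f`-th function of the program to `a`. -/
inductive Expr : Type
  | var (i : ℕ) : Expr
  | const (q : ℚ) : Expr
  | nil : Expr
  | pair (a b : Expr) : Expr
  | fst (a : Expr) : Expr
  | snd (a : Expr) : Expr
  | arith (o : ArithOp) (a b : Expr) : Expr
  | letIn (a b : Expr) : Expr
  | ifNil (a b c : Expr) : Expr
  | ifLt (a b c d : Expr) : Expr
  | call (f : ℕ) (a : Expr) : Expr

/-- A program is a finite list of function bodies, each with one argument, the variable `0`.
The functions may call each other; the first one is the main function. -/
abbrev Program : Type := List Expr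

/-- The result of an arithmetic operation; division by `0` has none. -/
def ArithOp.result {K : Type} [Field K] : ArithOp → K → K → K → Prop
  | .add, a, b, r => r = a + b
  | .sub, a, b, r => r = a - b
  | .mul, a, b, r => r = a * b
  | .div, a, b, r => b ≠ 0 ∧ r = a / b

/-- `Eval w P env e v t`: in the program `P` and the environment `env` the expression `e`
evaluates to `v`, at total cost `t`. -/
inductive Eval {K : Type} [Field K] [LinearOrder K] (w : K → ℕ) (P : Program) :
    List (Val K) → Expr → Val K → ℕ → Prop
  | var {env : List (Val K)} {i : ℕ} {v : Val K} (h : env[i]? = some v) :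
      Eval w P env (.var i) v 1
  | const {env : List (Val K)} {q : ℚ} :
      Eval w P env (.const q) (.num (q : K)) 1
  | nil {env : List (Val K)} :
      Eval w P env .nil .nil 1
  | pair {env : List (Val K)} {a b : Expr} {u v : Val K} {s t : ℕ}
      (ha : Eval w P env a u s) (hb : Eval w P env b v t) :
      Eval w P env (.pair a b) (.pair u v) (s + t + 1)
  | fst {env : List (Val K)} {a : Expr} {u v : Val K} {s : ℕ}
      (ha : Eval w P env a (.pair u v) s) :
      Eval w P env (.fst a) u (s + 1)
  | snd {env : List (Val K)} {a : Expr} {u v : Val K} {s : ℕ}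
      (ha : Eval w P env a (.pair u v) s) :
      Eval w P env (.snd a) v (s + 1)
  | arith {env : List (Val K)} {o : ArithOp} {a b : Expr} {x y r : K} {s t : ℕ}
      (ha : Eval w P env a (.num x) s) (hb : Eval w P env b (.num y) t)
      (hr : o.result x y r) :
      Eval w P env (.arith o a b) (.num r) (s + t + w x + w y + 1)
  | letIn {env : List (Val K)} {a b : Expr} {u v : Val K} {s t : ℕ}
      (ha : Eval w P env a u s) (hb : Eval w P (u :: env) b v t) :
      Eval w P env (.letIn a b) v (s + t + 1)
  | ifNil_pos {env : List (Val K)} {a b c : Expr} {v : Val K} {s t : ℕ}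
      (ha : Eval w P env a .nil s) (hb : Eval w P env b v t) :
      Eval w P env (.ifNil a b c) v (s + t + 1)
  | ifNil_neg {env : List (Val K)} {a b c : Expr} {u v : Val K} {s t : ℕ}
      (ha : Eval w P env a u s) (hu : u ≠ .nil) (hc : Eval w P env c v t) :
      Eval w P env (.ifNil a b c) v (s + t + 1)
  | ifLt_pos {env : List (Val K)} {a b c d : Expr} {x y : K} {v : Val K} {s t r : ℕ}
      (ha : Eval w P env a (.num x) s) (hb : Eval w P env b (.num y) t)
      (hxy : x < y) (hc : Eval w P env c v r) :
      Eval w P env (.ifLt a b c d) v (s + t + r + w x + w y + 1)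
  | ifLt_neg {env : List (Val K)} {a b c d : Expr} {x y : K} {v : Val K} {s t r : ℕ}
      (ha : Eval w P env a (.num x) s) (hb : Eval w P env b (.num y) t)
      (hxy : ¬ x < y) (hd : Eval w P env d v r) :
      Eval w P env (.ifLt a b c d) v (s + t + r + w x + w y + 1)
  | call {env : List (Val K)} {f : ℕ} {a body : Expr} {u v : Val K} {s t : ℕ}
      (ha : Eval w P env a u s) (hf : P[f]? = some body) (hb : Eval w P [u] body v t) :
      Eval w P env (.call f a) v (s + t + 1)

/-- Programs are deterministic: the value and the cost of an evaluation are unique. -/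
theorem Eval.deterministic {K : Type} [Field K] [LinearOrder K] {w : K → ℕ} {P : Program}
    {env : List (Val K)} {e : Expr} {v v' : Val K} {t t' : ℕ}
    (h : Eval w P env e v t) (h' : Eval w P env e v' t') : v = v' ∧ t = t' := by
  induction h generalizing v' t' with
  | var h => cases h' with | var h2 => simp_all
  | const => cases h'; simp
  | nil => cases h'; simp
  | pair _ _ iha ihb =>
    cases h' with
    | pair ha hb => obtain ⟨rfl, rfl⟩ := iha ha; obtain ⟨rfl, rfl⟩ := ihb hb; simp
  | fst _ iha =>
    cases h' with
    | fst ha => have := iha ha; simp_all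
  | snd _ iha =>
    cases h' with
    | snd ha => have := iha ha; simp_all
  | @arith _ o _ _ _ _ _ _ _ _ _ hr iha ihb =>
    cases h' with
    | arith ha hb hr2 =>
      have h1 := iha ha
      have h2 := ihb hb
      cases o <;> simp_all [ArithOp.result]
  | letIn _ _ iha ihb =>
    cases h' with
    | letIn ha hb => obtain ⟨rfl, rfl⟩ := iha ha; obtain ⟨rfl, rfl⟩ := ihb hb; simp
  | ifNil_pos _ _ iha ihb =>
    cases h' with
    | ifNil_pos ha hb => have := iha ha; have := ihb hb; simp_all
    | ifNil_neg ha hu _ => have := iha ha; simp_all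
  | ifNil_neg _ hu _ iha ihb =>
    cases h' with
    | ifNil_pos ha _ => have := iha ha; simp_all
    | ifNil_neg ha _ hb => have := iha ha; have := ihb hb; simp_all
  | ifLt_pos _ _ hxy _ iha ihb ihc =>
    cases h' with
    | ifLt_pos ha hb _ hc => have := iha ha; have := ihb hb; have := ihc hc; simp_all
    | ifLt_neg ha hb hn _ =>
      have h1 := iha ha
      have h2 := ihb hb
      simp only [Val.num.injEq] at h1 h2
      rw [h1.1, h2.1] at hxy
      exact absurd hxy hn
  | ifLt_neg _ _ hxy _ iha ihb ihc =>
    cases h' with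
    | ifLt_pos ha hb hn _ =>
      have h1 := iha ha
      have h2 := ihb hb
      simp only [Val.num.injEq] at h1 h2
      rw [h1.1, h2.1] at hxy
      exact absurd hn hxy
    | ifLt_neg ha hb _ hc => have := iha ha; have := ihb hb; have := ihc hc; simp_all
  | call _ hf _ iha ihb =>
    cases h' with
    | call ha hf2 hb =>
      obtain ⟨rfl, rfl⟩ := iha ha
      rw [hf] at hf2
      cases hf2
      obtain ⟨rfl, rfl⟩ := ihb hb
      simp

namespace Val

variable {K : Type}

/-- The size of a datum: the number of its nodes plus the lengths of all its numbers. -/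
def size (w : K → ℕ) : Val K → ℕ
  | nil => 1
  | num a => w a + 1
  | pair a b => a.size w + b.size w + 1

def ofList : List (Val K) → Val K
  | [] => nil
  | a :: l => pair a (ofList l)

end Val

/-- The input of a program: `ε`, the list of the vertex functions (each the list of its values
`f₀, …, f_d`), and the list of the edges (each with its two ends, given by their numbers
`0, …, n - 1`, and its weight). -/
def HolantInstance.encode {K : Type} [Field K] (Ω : HolantInstance K) (ε : K) : Val K :=
  .pair (.num ε) (.pair
    (Val.ofList (List.ofFn fun v => Val.ofList (List.ofFn fun i => .num (Ω.sig v i))))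
    (Val.ofList (List.ofFn fun e =>
      .pair (.num ((Ω.G.src e : ℕ) : K))
        (.pair (.num ((Ω.G.tgt e : ℕ) : K)) (.num (Ω.lam e))))))

/-! ## Fully polynomial-time approximation schemes -/

/-- `z` approximates the value `Z ≥ 0` with relative error less than `ε`
(for `Z = 0`, where the strict inequalities are void, `z` has to be exact). -/
def RelApprox (ε Z z : ℝ) : Prop :=
  (Z = 0 → z = 0) ∧ (Z ≠ 0 → (1 - ε) * Z < z ∧ z < (1 + ε) * Z)

/-- The program `P`, run with numbers from `K ⊆ ℝ` of lengths `w`, is an FPTAS for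
`Holant(𝓕, Λ)` on the instances with numbers from `K`. -/
def IsFPTAS (K : Type) [Field K] [LinearOrder K] [Algebra K ℝ] (w : K → ℕ) (P : Program)
    (𝓕 : Set (SymFun ℝ)) (Λ : Set ℝ) : Prop :=
  ∃ C : ℝ, ∃ k : ℕ, ∀ Ω : HolantInstance K, (Ω.map (algebraMap K ℝ)).IsInputOf 𝓕 Λ →
    ∀ ε : K, 0 < ε → ∃ z : K, ∃ t : ℕ,
      Eval w P [Ω.encode ε] (.call 0 (.var 0)) (.num z) t ∧
      RelApprox (algebraMap K ℝ ε) (Ω.map (algebraMap K ℝ)).Z (algebraMap K ℝ z) ∧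
      (t : ℝ) ≤ C * ((Ω.encode ε).size w + 1 / algebraMap K ℝ ε) ^ k

/-- The length of a rational number: the number of binary digits of numerator and
denominator. -/
def ratLength (q : ℚ) : ℕ := q.num.natAbs.size + q.den.size

/-- There is an FPTAS for `Holant(𝓕, Λ)`: one program that is an FPTAS for real instances, where
arithmetic has unit cost and the size of the input is that of the graph, and also for rational
instances, where arithmetic is charged by bit length and the size of the input is its length in
bits. -/
def HasFPTAS (𝓕 : Set (SymFun ℝ)) (Λ : Set ℝ) : Prop :=
  ∃ P : Program, IsFPTAS ℝ (fun _ => 0) P 𝓕 Λ ∧ IsFPTAS ℚ ratLength P 𝓕 Λ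

/-! A Fibonacci function is determined by `c` and its first two values. Giving an incident edge the
value `0` changes nothing, and giving it `1` shifts the function, so that `s = f₀ / f₁` becomes `1 /
(c + s)`. Hence the partition function, as a function of the number of ones on dangling edges at
`v`, satisfies the recurrence with parameter `c v` (`listZ_shiftAt_shiftAt`). For the marginal ratio
`R = Z(0) / Z(1)` of a dangling edge at `v` this yields a recursion that removes a single edge `vu`
of weight `λ`: `R = (1 + (a/λ) b₀) / (c + a/λ + b₁)`, where `a` is the ratio at `u` after a shift at
`v`, and `b₀`, `b₁` are the ratios at `v` without and with a shift at `u`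
(`listZ_eq_exactRatio_mul`). There are three calls per level whatever the degrees are. The partition
function itself telescopes: removing an edge `xy` splits off the factor `λ + R_x R_y`, and what
finally remains is the product of the last values of the vertex functions (`logClose_approxProd`).
If that product is `0`, some vertex function vanishes identically and `Z = 0`.

The recursion is cut at logarithmic depth. With `θ = 100/117`, the reciprocal of `1.17`, and `P ≥
1/p`, one step contracts logarithmic errors by `1 - 1/(20 P)`, provided that every argument carrying
an error is at most `θ` (`logClose_ratioStep`); arguments without error need only be at most `P`. In
general only the bound `P` is available, because a vertex without edges may have `s = 1/p`. But a
ratio whose recursion is deep is small: each level adds `1/P` to a lower bound for `1/R`, until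
`1.17` is reached (`exactRatio_le_of_isDeep`). This is where `λ ≥ 1` matters, together with the
identity that the law of two dangling edges can be revealed in either order. So `2 P` extra levels
below the cut are explored: a branch that ends there is computed exactly, and a branch that does not
has a true ratio at most `θ`, starts from the default `1/c`, and is clamped at `θ` from then on
(`logClose_approxRatio`).

A depth of order `log (m (1 + 1/ε))`, for fixed `P`, suffices, so running time and bit lengths,
which are exponential in the depth, are polynomial. The recursion uses field operations and
comparisons only; it is run over `ℚ` or `ℝ` by one program and compared with the real partition
function through an order-preserving embedding. -/

/-! ## Instances as edge lists -/

section EdgeList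

variable {V K : Type} [DecidableEq V]

/-- The first edge of the list incident with `v`, as its other end and its weight, together with
the list of the remaining edges. -/
def pickEdge (v : V) : List (V × V × K) → Option ((V × K) × List (V × V × K))
  | [] => none
  | (x, y, l) :: es =>
    if x = v then some ((y, l), es)
    else if y = v then some ((x, l), es)
    else (pickEdge v es).map fun r => (r.1, (x, y, l) :: r.2)

theorem pickEdge_cons (v x y : V) (l : K) (es : List (V × V × K)) :
    pickEdge v ((x, y, l) :: es) =
      if x = v then some ((y, l), es)
      else if y = v then some ((x, l), es)
      else (pickEdge v es).map fun r => (r.1, (x, y, l) :: r.2) := rfl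

theorem length_of_pickEdge {v u : V} {l : K} {es rest : List (V × V × K)}
    (h : pickEdge v es = some ((u, l), rest)) : es.length = rest.length + 1 := by
  induction es generalizing rest with
  | nil => simp [pickEdge] at h
  | cons e es ih =>
    obtain ⟨x, y, l'⟩ := e
    rw [pickEdge_cons] at h
    split_ifs at h
    · simp at h; simp [h.2]
    · simp at h; simp [h.2]
    · simp only [Option.map_eq_some_iff] at h
      obtain ⟨⟨⟨a, b⟩, r⟩, h1, h2⟩ := h
      simp only [Prod.mk.injEq] at h2
      obtain ⟨⟨rfl, rfl⟩, rfl⟩ := h2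
      simp [ih h1]

theorem mem_of_pickEdge {v u : V} {l : K} {es rest : List (V × V × K)}
    (h : pickEdge v es = some ((u, l), rest)) :
    ((v, u, l) ∈ es ∨ (u, v, l) ∈ es) ∧ ∀ e ∈ rest, e ∈ es := by
  induction es generalizing rest with
  | nil => simp [pickEdge] at h
  | cons e es ih =>
    obtain ⟨x, y, l'⟩ := e
    rw [pickEdge_cons] at h
    split_ifs at h with h1 h2
    · simp at h
      obtain ⟨⟨rfl, rfl⟩, rfl⟩ := h
      subst h1
      simp +contextual
    · simp at h
      obtain ⟨⟨rfl, rfl⟩, rfl⟩ := h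
      subst h2
      simp +contextual
    · simp only [Option.map_eq_some_iff] at h
      obtain ⟨⟨⟨a, b⟩, r⟩, h1, h2⟩ := h
      simp only [Prod.mk.injEq] at h2
      obtain ⟨⟨rfl, rfl⟩, rfl⟩ := h2
      obtain ⟨h3, h4⟩ := ih h1
      refine ⟨?_, ?_⟩
      · rcases h3 with h3 | h3
        · exact Or.inl (List.mem_cons_of_mem _ h3)
        · exact Or.inr (List.mem_cons_of_mem _ h3)
      · intro e he
        rcases List.mem_cons.1 he with rfl | he
        · simp
        · exact List.mem_cons_of_mem _ (h4 e he)

/-- Whether the recursion along `pickEdge`, started at the dangling edge of `v`, is deeper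
than `n`. -/
def isDeep : ℕ → List (V × V × K) → V → Bool
  | 0, es, v => (pickEdge v es).isSome
  | n + 1, es, v =>
    match pickEdge v es with
    | none => false
    | some ((u, _), rest) => isDeep n rest u || isDeep n rest v

variable [Field K]

/-- The quotients `f₀ / f₁` of the vertex functions after the value `1` has been given to an
edge at `u`. -/
def pin (c s : V → K) (u : V) : V → K := Function.update s u (1 / (c u + s u))

/-- The recursion step for the marginal ratio of a dangling edge. -/
def ratioStep (l c a b₀ b₁ : K) : K := (1 + a / l * b₀) / (c + (a / l + b₁))

/-- The marginal ratio `Z(0) / Z(1)` of a dangling edge at `v`, by recursion on the edges; `n`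
bounds the depth. -/
def exactRatio (c : V → K) : ℕ → (V → K) → List (V × V × K) → V → K
  | 0, s, _, v => s v
  | n + 1, s, es, v =>
    match pickEdge v es with
    | none => s v
    | some ((u, l), rest) =>
      ratioStep l (c v) (exactRatio c n (pin c s v) rest u) (exactRatio c n s rest v)
        (exactRatio c n (pin c s u) rest v)

theorem exactRatio_none (c : V → K) (n : ℕ) (s : V → K) {es : List (V × V × K)} {v : V}
    (h : pickEdge v es = none) : exactRatio c n s es v = s v := by
  cases n with
  | zero => rfl
  | succ n => simp [exactRatio, h]

theorem exactRatio_some (c : V → K) (n : ℕ) (s : V → K) {es rest : List (V × V × K)} {v u : V}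
    {l : K} (h : pickEdge v es = some ((u, l), rest)) :
    exactRatio c (n + 1) s es v =
      ratioStep l (c v) (exactRatio c n (pin c s v) rest u) (exactRatio c n s rest v)
        (exactRatio c n (pin c s u) rest v) := by
  simp [exactRatio, h]

variable [LinearOrder K]

/-- The truncated recursion.  The list `ls` bounds the depth; its entries tell whether a value
that depends on truncated branches is computed (`true`) or replaced by a default (`false`).
The first component of the result tells whether branches have been truncated. -/
def approxRatio (c : V → K) : List Bool → (V → K) → List (V × V × K) → V → Bool × K
  | [], s, es, v =>
    match pickEdge v es with
    | none => (false, s v)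
    | some _ => (true, 1 / c v)
  | b :: ls, s, es, v =>
    match pickEdge v es with
    | none => (false, s v)
    | some ((u, l), rest) =>
      let a := approxRatio c ls (pin c s v) rest u
      let b₀ := approxRatio c ls s rest v
      let b₁ := approxRatio c ls (pin c s u) rest v
      let x := ratioStep l (c v) a.2 b₀.2 b₁.2
      if a.1 || b₀.1 then (true, if b then min x (100 / 117) else 1 / c v) else (false, x)

theorem approxRatio_none (c : V → K) (ls : List Bool) (s : V → K) {es : List (V × V × K)} {v : V}
    (h : pickEdge v es = none) : approxRatio c ls s es v = (false, s v) := by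
  cases ls <;> simp [approxRatio, h]

theorem approxRatio_some (c : V → K) (b : Bool) (ls : List Bool) (s : V → K)
    {es rest : List (V × V × K)} {v u : V} {l : K} (h : pickEdge v es = some ((u, l), rest)) :
    approxRatio c (b :: ls) s es v =
      if (approxRatio c ls (pin c s v) rest u).1 || (approxRatio c ls s rest v).1 then
        (true, if b then min (ratioStep l (c v) (approxRatio c ls (pin c s v) rest u).2
          (approxRatio c ls s rest v).2 (approxRatio c ls (pin c s u) rest v).2) (100 / 117)
          else 1 / c v)
      else (false, ratioStep l (c v) (approxRatio c ls (pin c s v) rest u).2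
          (approxRatio c ls s rest v).2 (approxRatio c ls (pin c s u) rest v).2) := by
  simp [approxRatio, h]

/-- Truncation depends on the edge list alone, not on the pinned quotients. Therefore the two calls
at `v`, with and without a pin at `u`, are truncated together, and testing the flags of `a` and `b₀`
is enough. -/
theorem approxRatio_fst (c : V → K) (ls : List Bool) (s : V → K) (es : List (V × V × K)) (v : V) :
    (approxRatio c ls s es v).1 = isDeep ls.length es v := by
  induction ls generalizing s es v with
  | nil =>
    cases h : pickEdge v es <;> simp [approxRatio, isDeep, h]
  | cons b ls ih =>
    cases h : pickEdge v es with
    | none => simp [approxRatio, isDeep, h]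
    | some r =>
      obtain ⟨⟨u, l⟩, rest⟩ := r
      rw [approxRatio_some c b ls s h]
      simp only [ih, isDeep, h, List.length_cons]
      cases h1 : isDeep ls.length rest u || isDeep ls.length rest v <;> simp

/-- The approximation to the quotient of the partition function by the weight of the
configuration that is `1` everywhere, but for the vertex functions. -/
def approxProd (c : V → K) (ls : List Bool) : (V → K) → List (V × V × K) → K
  | _, [] => 1
  | s, (x, y, l) :: es =>
    (l + (approxRatio c ls s es x).2 * (approxRatio c ls (pin c s x) es y).2) *
      approxProd c ls (pin c (pin c s x) y) es

end EdgeList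

/-! ## The partition function -/

section Partition

variable {V : Type} [DecidableEq V]

/-- Give the value `1` to an edge at `u`; a vertex function is represented by its first two
values. -/
def shiftAt (c : V → ℝ) (u : V) (F : V → ℝ × ℝ) : V → ℝ × ℝ :=
  Function.update F u ((F u).2, c u * (F u).2 + (F u).1)

theorem shiftAt_comm (c : V → ℝ) (u v : V) (F : V → ℝ × ℝ) :
    shiftAt c u (shiftAt c v F) = shiftAt c v (shiftAt c u F) := by
  by_cases h : u = v
  · rw [h]
  · unfold shiftAt
    rw [Function.update_comm h]
    simp [Function.update_of_ne h, Function.update_of_ne (Ne.symm h)]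

variable [Fintype V]

/-- The partition function of a list of weighted edges. -/
def listZ (c : V → ℝ) : List (V × V × ℝ) → (V → ℝ × ℝ) → ℝ
  | [], F => ∏ v, (F v).1
  | (x, y, l) :: es, F => listZ c es F + l * listZ c es (shiftAt c x (shiftAt c y F))

theorem listZ_cons (c : V → ℝ) (x y : V) (l : ℝ) (es : List (V × V × ℝ)) (F : V → ℝ × ℝ) :
    listZ c ((x, y, l) :: es) F = listZ c es F + l * listZ c es (shiftAt c x (shiftAt c y F)) :=
  rfl

/-- The Fibonacci recurrence is linear and shifts commute, so it passes from the function at `v` to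
the whole sum. This is what keeps the recursion closed: a second dangling edge at `v` can always be
eliminated. -/
theorem listZ_shiftAt_shiftAt (c : V → ℝ) (v : V) (es : List (V × V × ℝ)) (F : V → ℝ × ℝ) :
    listZ c es (shiftAt c v (shiftAt c v F)) =
      c v * listZ c es (shiftAt c v F) + listZ c es F := by
  induction es generalizing F with
  | nil =>
    simp only [listZ]
    rw [← Finset.mul_prod_erase Finset.univ _ (Finset.mem_univ v),
      ← Finset.mul_prod_erase Finset.univ (fun w => (shiftAt c v F w).1) (Finset.mem_univ v),
      ← Finset.mul_prod_erase Finset.univ (fun w => (F w).1) (Finset.mem_univ v)]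
    have h1 : ∏ w ∈ Finset.univ.erase v, (shiftAt c v (shiftAt c v F) w).1 =
        ∏ w ∈ Finset.univ.erase v, (F w).1 :=
      Finset.prod_congr rfl fun w hw => by simp [shiftAt, Finset.ne_of_mem_erase hw]
    have h2 : ∏ w ∈ Finset.univ.erase v, (shiftAt c v F w).1 =
        ∏ w ∈ Finset.univ.erase v, (F w).1 :=
      Finset.prod_congr rfl fun w hw => by simp [shiftAt, Finset.ne_of_mem_erase hw]
    rw [h1, h2]
    simp [shiftAt]
    ring
  | cons e es ih =>
    obtain ⟨x, y, l⟩ := e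
    simp only [listZ_cons]
    have h : ∀ G, shiftAt c x (shiftAt c y (shiftAt c v G)) =
        shiftAt c v (shiftAt c x (shiftAt c y G)) := fun G => by
      rw [shiftAt_comm c y v, shiftAt_comm c x v]
    rw [h, h, ih, ih]
    ring

/-- Since shifts commute, any edge may be expanded first. -/
theorem listZ_of_pickEdge (c : V → ℝ) {v u : V} {l : ℝ} {es rest : List (V × V × ℝ)}
    (h : pickEdge v es = some ((u, l), rest)) (F : V → ℝ × ℝ) :
    listZ c es F = listZ c rest F + l * listZ c rest (shiftAt c v (shiftAt c u F)) := by
  induction es generalizing rest F with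
  | nil => simp [pickEdge] at h
  | cons e es ih =>
    obtain ⟨x, y, l'⟩ := e
    rw [pickEdge_cons] at h
    split_ifs at h with h1 h2
    · simp at h
      obtain ⟨⟨rfl, rfl⟩, rfl⟩ := h
      subst h1
      rfl
    · simp at h
      obtain ⟨⟨rfl, rfl⟩, rfl⟩ := h
      subst h2
      rw [listZ_cons, shiftAt_comm]
    · simp only [Option.map_eq_some_iff] at h
      obtain ⟨⟨⟨a, b⟩, r⟩, h1, h2⟩ := h
      simp only [Prod.mk.injEq] at h2
      obtain ⟨⟨rfl, rfl⟩, rfl⟩ := h2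
      rw [listZ_cons, listZ_cons, listZ_cons, ih h1 F, ih h1]
      have h : shiftAt c x (shiftAt c y (shiftAt c v (shiftAt c a F))) =
          shiftAt c v (shiftAt c a (shiftAt c x (shiftAt c y F))) := by
        rw [shiftAt_comm c y v, shiftAt_comm c y a, shiftAt_comm c x v, shiftAt_comm c x a]
      rw [h]
      ring

/-- No remaining edge touches `v`, so its factor splits off and the ratio of the dangling edge is
`f₀ / f₁`. -/
theorem listZ_of_pickEdge_none (c : V → ℝ) {v : V} {es : List (V × V × ℝ)}
    (h : pickEdge v es = none) (F : V → ℝ × ℝ) :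
    listZ c es F * (F v).2 = (F v).1 * listZ c es (shiftAt c v F) := by
  induction es generalizing F with
  | nil =>
    simp only [listZ]
    rw [← Finset.mul_prod_erase Finset.univ (fun w => (shiftAt c v F w).1) (Finset.mem_univ v),
      ← Finset.mul_prod_erase Finset.univ (fun w => (F w).1) (Finset.mem_univ v)]
    have h2 : ∏ w ∈ Finset.univ.erase v, (shiftAt c v F w).1 =
        ∏ w ∈ Finset.univ.erase v, (F w).1 :=
      Finset.prod_congr rfl fun w hw => by simp [shiftAt, Finset.ne_of_mem_erase hw]
    rw [h2]
    simp [shiftAt]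
    ring
  | cons e es ih =>
    obtain ⟨x, y, l'⟩ := e
    rw [pickEdge_cons] at h
    split_ifs at h with h1 h2
    simp only [Option.map_eq_none_iff] at h
    have h3 := ih h F
    have h4 := ih h (shiftAt c x (shiftAt c y F))
    have h5 : shiftAt c x (shiftAt c y F) v = F v := by
      simp [shiftAt, Function.update_of_ne (Ne.symm h1), Function.update_of_ne (Ne.symm h2)]
    rw [h5] at h4
    have h6 : shiftAt c x (shiftAt c y (shiftAt c v F)) =
        shiftAt c v (shiftAt c x (shiftAt c y F)) := by
      rw [shiftAt_comm c y v, shiftAt_comm c x v]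
    rw [listZ_cons, listZ_cons, h6]
    linear_combination h3 + l' * h4

end Partition

/-! ### The exact marginal ratios and their bounds. -/

section TrueRatio

open Filter Topology

variable {V : Type} [DecidableEq V]

theorem pin_nonneg {c s : V → ℝ} (hc : ∀ v, 0 < c v) (hs : ∀ v, 0 ≤ s v) (u v : V) :
    0 ≤ pin c s u v := by
  unfold pin
  rcases eq_or_ne v u with rfl | h
  · simp only [Function.update_self]
    have := hc v; have := hs v
    positivity
  · simpa [Function.update_of_ne h] using hs v

theorem exactRatio_nonneg {c : V → ℝ} (hc : ∀ v, 0 < c v) (n : ℕ) {s : V → ℝ}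
    (hs : ∀ v, 0 ≤ s v) {es : List (V × V × ℝ)} (hl : ∀ e ∈ es, 0 < e.2.2) (v : V) :
    0 ≤ exactRatio c n s es v := by
  induction n generalizing s es v with
  | zero => exact hs v
  | succ n ih =>
    cases h : pickEdge v es with
    | none => rw [exactRatio_none c _ s h]; exact hs v
    | some r =>
      obtain ⟨⟨u, l⟩, rest⟩ := r
      obtain ⟨h1, h2⟩ := mem_of_pickEdge h
      have hl0 : 0 < l := by rcases h1 with h1 | h1 <;> exact hl _ h1
      have hr : ∀ e ∈ rest, 0 < e.2.2 := fun e he => hl e (h2 e he)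
      rw [exactRatio_some c n s h, ratioStep]
      have h3 := ih (pin_nonneg hc hs v) hr u
      have h4 := ih hs hr v
      have h5 := ih (pin_nonneg hc hs u) hr v
      have := hc v
      positivity

/-- From `f₁ / (c f₁ + f₀) = 1 / (c + f₀ / f₁)`: the recursion for ratios needs only the quotients,
not the two values. -/
theorem shiftAt_ratio (c : V → ℝ) (u : V) {F : V → ℝ × ℝ} (hF : ∀ v, 0 < (F v).2) :
    (fun v => (shiftAt c u F v).1 / (shiftAt c u F v).2) =
      pin c (fun v => (F v).1 / (F v).2) u := by
  funext v
  unfold shiftAt pin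
  rcases eq_or_ne v u with rfl | h
  · simp only [Function.update_self]
    have := (hF v).ne'
    rw [div_eq_div_iff_comm]
    field_simp
  · simp [Function.update_of_ne h]

theorem shiftAt_admissible {c : V → ℝ} (hc : ∀ v, 0 < c v) {F : V → ℝ × ℝ}
    (hF : ∀ v, 0 ≤ (F v).1 ∧ 0 < (F v).2) (u v : V) :
    0 ≤ (shiftAt c u F v).1 ∧ 0 < (shiftAt c u F v).2 := by
  unfold shiftAt
  rcases eq_or_ne v u with rfl | h
  · simp only [Function.update_self]
    have h1 := hc v
    obtain ⟨h2, h3⟩ := hF v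
    constructor <;> positivity
  · simpa [Function.update_of_ne h] using hF v

/-- The product form is deliberate: other vertices may have `f₀ = 0`, both partition functions may
then vanish, and the quotient would be meaningless while the recursion still has a value. -/
theorem listZ_eq_exactRatio_mul [Fintype V] {c : V → ℝ} (hc : ∀ v, 0 < c v) {n : ℕ}
    {es : List (V × V × ℝ)} (hn : es.length ≤ n) (hl : ∀ e ∈ es, 0 < e.2.2)
    {F : V → ℝ × ℝ} (hF : ∀ v, 0 ≤ (F v).1 ∧ 0 < (F v).2) (v : V) :
    listZ c es F =
      exactRatio c n (fun v => (F v).1 / (F v).2) es v * listZ c es (shiftAt c v F) := by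
  induction n generalizing es F v with
  | zero =>
    have he : pickEdge v es = none := by
      rw [List.length_eq_zero_iff.1 (Nat.le_zero.1 hn)]; rfl
    have h := listZ_of_pickEdge_none c he F
    rw [exactRatio_none c _ _ he]
    have := (hF v).2.ne'
    field_simp
    exact h
  | succ n ih =>
    cases he : pickEdge v es with
    | none =>
      have h := listZ_of_pickEdge_none c he F
      rw [exactRatio_none c _ _ he]
      have := (hF v).2.ne'
      field_simp
      exact h
    | some r =>
      obtain ⟨⟨u, l⟩, rest⟩ := r
      obtain ⟨h1, h2⟩ := mem_of_pickEdge he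
      have hlen := length_of_pickEdge he
      have hl0 : 0 < l := by rcases h1 with h1 | h1 <;> exact hl _ h1
      have hr : ∀ e ∈ rest, 0 < e.2.2 := fun e he => hl e (h2 e he)
      have hn' : rest.length ≤ n := by omega
      have hFp : ∀ v, 0 < (F v).2 := fun v => (hF v).2
      have hs : ∀ v, 0 ≤ (F v).1 / (F v).2 := fun v => div_nonneg (hF v).1 (hF v).2.le
      have ha := ih hn' hr (shiftAt_admissible hc hF v) u
      have hb0 := ih hn' hr hF v
      have hb1 := ih hn' hr (shiftAt_admissible hc hF u) v
      rw [shiftAt_ratio c v hFp, shiftAt_comm c u v] at ha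
      rw [shiftAt_ratio c u hFp] at hb1
      have pa := exactRatio_nonneg hc n (pin_nonneg hc hs v) hr u
      have pb1 := exactRatio_nonneg hc n (pin_nonneg hc hs u) hr v
      -- All four terms become multiples of the partition function shifted at both `u` and `v`;
      -- dividing by `l` times it gives `ratioStep`.
      rw [exactRatio_some c n _ he, listZ_of_pickEdge c he, listZ_of_pickEdge c he (shiftAt c v F),
        shiftAt_comm c u v, listZ_shiftAt_shiftAt, hb0, ha, hb1, ratioStep]
      have h4 : 0 < c v + (exactRatio c n (pin c (fun v => (F v).1 / (F v).2) v) rest u / l +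
          exactRatio c n (pin c (fun v => (F v).1 / (F v).2) u) rest v) := by
        have := hc v
        positivity
      rw [div_mul_eq_mul_div, eq_div_iff h4.ne']
      field_simp
      ring

/-- Needed to cancel partition functions, which is legitimate only when all first values are
positive. -/
theorem listZ_pos [Fintype V] {c : V → ℝ} (hc : ∀ v, 0 < c v) {es : List (V × V × ℝ)}
    (hl : ∀ e ∈ es, 0 < e.2.2) {F : V → ℝ × ℝ} (hF : ∀ v, 0 < (F v).1 ∧ 0 < (F v).2) :
    0 < listZ c es F := by
  induction es generalizing F with
  | nil => exact Finset.prod_pos fun v _ => (hF v).1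
  | cons e es ih =>
    obtain ⟨x, y, l⟩ := e
    rw [listZ_cons]
    have hS : ∀ (G : V → ℝ × ℝ) (u : V), (∀ v, 0 < (G v).1 ∧ 0 < (G v).2) →
        ∀ v, 0 < (shiftAt c u G v).1 ∧ 0 < (shiftAt c u G v).2 := by
      intro G u hG v
      unfold shiftAt
      rcases eq_or_ne v u with rfl | h
      · simp only [Function.update_self]
        have h1 := hc v
        obtain ⟨h2, h3⟩ := hG v
        constructor <;> positivity
      · simpa [Function.update_of_ne h] using hG v
    have h1 : 0 < l := hl (x, y, l) (by simp)
    have hr : ∀ e ∈ es, 0 < e.2.2 := fun e he => hl e (List.mem_cons_of_mem _ he)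
    have h2 := ih hr hF
    have h3 := ih hr (hS _ x (hS _ y hF))
    positivity

/-- Serves to carry identities proved by cancellation from positive quotients to nonnegative ones;
the denominators stay away from `0` because `c` is positive. -/
theorem tendsto_exactRatio {ι : Type*} {f : Filter ι} {c : V → ℝ} (hc : ∀ v, 0 < c v) (n : ℕ)
    {s : V → ℝ} (hs : ∀ v, 0 ≤ s v) {S : ι → V → ℝ} (hS : ∀ v, Tendsto (fun i => S i v) f (𝓝 (s v)))
    {es : List (V × V × ℝ)} (hl : ∀ e ∈ es, 0 < e.2.2) (v : V) :
    Tendsto (fun i => exactRatio c n (S i) es v) f (𝓝 (exactRatio c n s es v)) := by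
  have hpin : ∀ {s : V → ℝ}, (∀ v, 0 ≤ s v) → ∀ {S : ι → V → ℝ},
      (∀ v, Tendsto (fun i => S i v) f (𝓝 (s v))) → ∀ u v,
      Tendsto (fun i => pin c (S i) u v) f (𝓝 (pin c s u v)) := by
    intro s hs S hS u v
    unfold pin
    rcases eq_or_ne v u with rfl | h
    · simp only [Function.update_self]
      refine Tendsto.div tendsto_const_nhds (tendsto_const_nhds.add (hS v)) ?_
      have := hc v; have := hs v
      positivity
    · simpa [Function.update_of_ne h] using hS v
  induction n generalizing s S es v with
  | zero => exact hS v
  | succ n ih =>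
    cases h : pickEdge v es with
    | none => simpa [exactRatio_none c _ _ h] using hS v
    | some r =>
      obtain ⟨⟨u, l⟩, rest⟩ := r
      obtain ⟨h1, h2⟩ := mem_of_pickEdge h
      have hl0 : 0 < l := by rcases h1 with h1 | h1 <;> exact hl _ h1
      have hr : ∀ e ∈ rest, 0 < e.2.2 := fun e he => hl e (h2 e he)
      simp only [exactRatio_some c n _ h, ratioStep]
      have ha := (ih (pin_nonneg hc hs v) (hpin hs hS v) hr u).div_const l
      have hb0 := ih hs hS hr v
      have hb1 := ih (pin_nonneg hc hs u) (hpin hs hS u) hr v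
      refine Tendsto.div (tendsto_const_nhds.add (ha.mul hb0))
        (tendsto_const_nhds.add (ha.add hb1)) ?_
      have pa := exactRatio_nonneg hc n (pin_nonneg hc hs v) hr u
      have pb1 := exactRatio_nonneg hc n (pin_nonneg hc hs u) hr v
      have := hc v
      positivity

/-- The joint law of two dangling edges can be revealed in either order. -/
theorem exactRatio_mul_comm [Fintype V] {c : V → ℝ} (hc : ∀ v, 0 < c v) {n : ℕ}
    {es : List (V × V × ℝ)} (hn : es.length ≤ n) (hl : ∀ e ∈ es, 0 < e.2.2)
    {s : V → ℝ} (hs : ∀ v, 0 ≤ s v) (u v : V) :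
    exactRatio c n s es u * exactRatio c n (pin c s u) es v =
      exactRatio c n s es v * exactRatio c n (pin c s v) es u := by
  -- For positive quotients both products equal `Z` divided by the partition function shifted at
  -- both vertices, which is nonzero. Zero quotients are then reached by letting `η ↓ 0` in `s + η`.
  have key : ∀ s : V → ℝ, (∀ v, 0 < s v) →
      exactRatio c n s es u * exactRatio c n (pin c s u) es v =
        exactRatio c n s es v * exactRatio c n (pin c s v) es u := by
    intro s hs
    set F : V → ℝ × ℝ := fun v => (s v, 1) with hFdef
    have hF : ∀ v, 0 ≤ (F v).1 ∧ 0 < (F v).2 := fun v => ⟨(hs v).le, one_pos⟩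
    have hFp : ∀ v, 0 < (F v).2 := fun v => (hF v).2
    have hr : (fun v => (F v).1 / (F v).2) = s := by funext v; simp [hFdef]
    have h1 := listZ_eq_exactRatio_mul hc hn hl hF u
    have h2 := listZ_eq_exactRatio_mul hc hn hl (shiftAt_admissible hc hF u) v
    have h3 := listZ_eq_exactRatio_mul hc hn hl hF v
    have h4 := listZ_eq_exactRatio_mul hc hn hl (shiftAt_admissible hc hF v) u
    rw [shiftAt_ratio c _ hFp, hr] at h2 h4
    rw [hr] at h1 h3
    have hpos : 0 < listZ c es F := listZ_pos hc hl fun v => ⟨hs v, one_pos⟩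
    rw [shiftAt_comm] at h4
    rw [h2, ← mul_assoc] at h1
    rw [h4, ← mul_assoc] at h3
    have h5 : listZ c es (shiftAt c v (shiftAt c u F)) ≠ 0 := by
      intro h0
      rw [h0, mul_zero] at h1
      exact hpos.ne' h1
    exact mul_right_cancel₀ h5 (h1.symm.trans h3)
  have hS : ∀ v, Tendsto (fun η : ℝ => s v + η) (𝓝[>] 0) (𝓝 (s v)) := fun v => by
    have : Tendsto (fun η : ℝ => s v + η) (𝓝 0) (𝓝 (s v + 0)) :=
      (continuous_const.add continuous_id).tendsto 0
    rw [add_zero] at this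
    exact this.mono_left nhdsWithin_le_nhds
  have hpin : ∀ u v, Tendsto (fun η : ℝ => pin c (fun w => s w + η) u v) (𝓝[>] 0)
      (𝓝 (pin c s u v)) := by
    intro u v
    unfold pin
    rcases eq_or_ne v u with rfl | h
    · simp only [Function.update_self]
      refine Tendsto.div tendsto_const_nhds (tendsto_const_nhds.add (hS v)) ?_
      have := hc v; have := hs v
      positivity
    · simpa [Function.update_of_ne h] using hS v
  have h1 := (tendsto_exactRatio hc n hs hS hl u).mul
    (tendsto_exactRatio hc n (pin_nonneg hc hs u) (hpin u) hl v)
  have h2 := (tendsto_exactRatio hc n hs hS hl v).mul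
    (tendsto_exactRatio hc n (pin_nonneg hc hs v) (hpin v) hl u)
  refine tendsto_nhds_unique_of_eventuallyEq h1 h2 ?_
  filter_upwards [self_mem_nhdsWithin] with η hη
  exact key _ fun v => add_pos_of_nonneg_of_pos (hs v) hη

theorem pin_le {c s : V → ℝ} {P : ℝ} (hP : 1 ≤ P) (hc : ∀ v, 117 / 100 ≤ c v)
    (hs : ∀ v, 0 ≤ s v ∧ s v ≤ P) (u v : V) : 0 ≤ pin c s u v ∧ pin c s u v ≤ P := by
  refine ⟨pin_nonneg (fun v => by linarith [hc v]) (fun v => (hs v).1) u v, ?_⟩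
  unfold pin
  rcases eq_or_ne v u with rfl | h
  · simp only [Function.update_self]
    have := hc v; have := (hs v).1
    rw [div_le_iff₀ (by linarith)]
    nlinarith
  · simpa [Function.update_of_ne h] using (hs v).2

/-- The bound `P` is invariant: with `x = a/l` and `b₀ ≤ P` one has `1 + x b₀ ≤ P (c + x + b₁)`,
because `c` and `P` are at least `1`. -/
theorem exactRatio_le {c : V → ℝ} {P : ℝ} (hP : 1 ≤ P) (hc : ∀ v, 117 / 100 ≤ c v) (n : ℕ)
    {s : V → ℝ} (hs : ∀ v, 0 ≤ s v ∧ s v ≤ P) {es : List (V × V × ℝ)}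
    (hl : ∀ e ∈ es, 1 ≤ e.2.2) (v : V) : exactRatio c n s es v ≤ P := by
  have hc0 : ∀ v, 0 < c v := fun v => by linarith [hc v]
  induction n generalizing s es v with
  | zero => exact (hs v).2
  | succ n ih =>
    cases h : pickEdge v es with
    | none => rw [exactRatio_none c _ s h]; exact (hs v).2
    | some r =>
      obtain ⟨⟨u, l⟩, rest⟩ := r
      obtain ⟨h1, h2⟩ := mem_of_pickEdge h
      have hl0 : 0 < l := by
        rcases h1 with h1 | h1 <;> exact lt_of_lt_of_le one_pos (hl _ h1)
      have hr : ∀ e ∈ rest, 1 ≤ e.2.2 := fun e he => hl e (h2 e he)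
      have hr0 : ∀ e ∈ rest, 0 < e.2.2 := fun e he => lt_of_lt_of_le one_pos (hr e he)
      rw [exactRatio_some c n s h, ratioStep]
      have h3 := exactRatio_nonneg hc0 n (pin_nonneg hc0 (fun v => (hs v).1) v) hr0 u
      have h4 := ih hs hr v
      have h5 := exactRatio_nonneg hc0 n (pin_nonneg hc0 (fun v => (hs v).1) u) hr0 v
      have h6 := hc v
      have h7 : 0 ≤ exactRatio c n (pin c s v) rest u / l := by positivity
      rw [div_le_iff₀ (by linarith)]
      nlinarith [mul_le_mul_of_nonneg_left h4 h7]

/-- At a vertex from which the recursion is deep, the marginal ratio is small. -/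
theorem exactRatio_le_of_isDeep [Fintype V] {c : V → ℝ} {P : ℝ} (hP : 1 ≤ P)
    (hc : ∀ v, 117 / 100 ≤ c v)
    {N : ℕ} (n : ℕ) {s : V → ℝ} (hs : ∀ v, 0 ≤ s v ∧ s v ≤ P) {es : List (V × V × ℝ)}
    (hN : es.length ≤ N) (hl : ∀ e ∈ es, 1 ≤ e.2.2) (v : V) (hd : isDeep n es v = true) :
    exactRatio c N s es v * min (117 / 100) ((n + 1) / P) ≤ 1 := by
  have hc0 : ∀ v, 0 < c v := fun v => by linarith [hc v]
  have hP0 : 0 < P := by linarith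
  induction n generalizing N s es v with
  | zero =>
    have h1 := exactRatio_le hP hc N hs hl v
    have h2 := exactRatio_nonneg hc0 N (fun v => (hs v).1)
      (fun e he => lt_of_lt_of_le one_pos (hl e he)) v
    calc _ ≤ exactRatio c N s es v * (1 / P) := by
          refine mul_le_mul_of_nonneg_left ((min_le_right _ _).trans ?_) h2
          simp
      _ ≤ P * (1 / P) := by gcongr
      _ = 1 := by field_simp
  | succ n ih =>
    cases h : pickEdge v es with
    | none => simp [isDeep, h] at hd
    | some r =>
      obtain ⟨⟨u, l⟩, rest⟩ := r
      obtain ⟨h1, h2⟩ := mem_of_pickEdge h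
      have hlen := length_of_pickEdge h
      obtain ⟨N, rfl⟩ : ∃ M, N = M + 1 := ⟨N - 1, by omega⟩
      have hN' : rest.length ≤ N := by omega
      have hl1 : 1 ≤ l := by rcases h1 with h1 | h1 <;> exact hl _ h1
      have hl0 : 0 < l := by linarith
      have hr : ∀ e ∈ rest, 1 ≤ e.2.2 := fun e he => hl e (h2 e he)
      have hr0 : ∀ e ∈ rest, 0 < e.2.2 := fun e he => lt_of_lt_of_le one_pos (hr e he)
      have hs0 : ∀ v, 0 ≤ s v := fun v => (hs v).1
      have hcomm := exactRatio_mul_comm hc0 hN' hr0 hs0 u v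
      rw [exactRatio_some c N s h, ratioStep]
      have pa0 := exactRatio_nonneg hc0 N hs0 hr0 u
      have pa1 := exactRatio_nonneg hc0 N (pin_nonneg hc0 hs0 v) hr0 u
      have pb0 := exactRatio_nonneg hc0 N hs0 hr0 v
      have pb1 := exactRatio_nonneg hc0 N (pin_nonneg hc0 hs0 u) hr0 v
      have la0 := exactRatio_le hP hc N hs hr u
      have lb0 := exactRatio_le hP hc N hs hr v
      have hdeep : isDeep n rest u = true ∨ isDeep n rest v = true := by
        simpa [isDeep, h] using hd
      have ihu := fun hd => ih hs hN' hr u hd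
      have ihv := fun hd => ih hs hN' hr v hd
      generalize exactRatio c N s rest u = a0 at *
      generalize exactRatio c N (pin c s v) rest u = a1 at *
      generalize exactRatio c N s rest v = b0 at *
      generalize exactRatio c N (pin c s u) rest v = b1 at *
      clear ih
      push_cast
      set ρ : ℝ := min (117 / 100) ((n + 1) / P) with hρ
      have hρ0 : 0 ≤ ρ := le_min (by norm_num) (by positivity)
      -- One more level of depth is worth at most `1 / P` in the bound.
      have hρ' : min (117 / 100) (((n : ℝ) + 1 + 1) / P) ≤ ρ + 1 / P := by
        rw [hρ, ← min_add_add_right]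
        refine min_le_min ?_ (by rw [← add_div])
        have : 0 < 1 / P := by positivity
        linarith
      have hσc : min (117 / 100) (((n : ℝ) + 1 + 1) / P) ≤ c v := (min_le_left _ _).trans (hc v)
      have hσ0 : 0 ≤ min (117 / 100) (((n : ℝ) + 1 + 1) / P) :=
        le_min (by norm_num) (by positivity)
      generalize min (117 / 100) (((n : ℝ) + 1 + 1) / P) = σ at *
      have ka0 : a0 * (1 / P) ≤ 1 := by
        rw [mul_one_div, div_le_one hP0]; exact la0
      have kb0 : b0 * (1 / P) ≤ 1 := by
        rw [mul_one_div, div_le_one hP0]; exact lb0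
      -- Here `a0 b1 = b0 a1` enters. From `b0 β ≤ 1` follows `a1 ≥ a1 b0 β`, and from `a0 α ≤ 1`
      -- follows `b1 ≥ b1 a0 α = a1 b0 α`; so the bounds `α` and `β` at the two ends add up. The
      -- deep end contributes `ρ`, the other one at least `1 / P`.
      have main : ∀ α β : ℝ, ρ + 1 / P ≤ α + β → a0 * α ≤ 1 → b0 * β ≤ 1 →
          σ * (a1 * b0) ≤ a1 + b1 := by
        intro α β hαβ hα hβ
        have e1 : a1 * (b0 * β) ≤ a1 := by
          nlinarith
        have e2 : b1 * (a0 * α) ≤ b1 := by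
          nlinarith
        have e3 : b1 * (a0 * α) = a1 * b0 * α := by linear_combination α * hcomm
        have e4 : 0 ≤ a1 * b0 := by positivity
        nlinarith [mul_le_mul_of_nonneg_left (hρ'.trans hαβ) e4]
      have key : σ * (a1 * b0) ≤ a1 + b1 := by
        rcases hdeep with hd | hd
        · exact main ρ (1 / P) le_rfl (ihu hd) kb0
        · exact main (1 / P) ρ (by rw [add_comm]) ka0 (ihv hd)
      have hcv := hc0 v
      -- The constant terms compare by `σ ≤ c v`. For the rest, `key` is divided by `l`, and `l ≥ 1`
      -- allows `b1 / l` to be replaced by `b1`.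
      rw [div_mul_eq_mul_div, div_le_one (by positivity)]
      have e5 : σ * (a1 * b0) / l ≤ (a1 + b1) / l := by gcongr
      have e6 : b1 / l ≤ b1 := div_le_self pb1 hl1
      have e7 : a1 / l * b0 * σ = σ * (a1 * b0) / l := by ring
      have e8 : (a1 + b1) / l = a1 / l + b1 / l := add_div _ _ _
      linarith [e7, e8, e5, e6]

end TrueRatio

/-! ## Decay of correlations -/

section Decay

open Real

/-- `x` and `y` agree up to a factor between `exp (-E)` and `exp E`. -/
def LogClose (E x y : ℝ) : Prop := ∃ β : ℝ, |β| ≤ E ∧ x = y * exp β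

theorem LogClose.refl {E : ℝ} (hE : 0 ≤ E) (x : ℝ) : LogClose E x x := ⟨0, by simpa, by simp⟩

theorem LogClose.mul {E E' x x' y y' : ℝ} (h : LogClose E x y) (h' : LogClose E' x' y') :
    LogClose (E + E') (x * x') (y * y') := by
  obtain ⟨β, hβ, rfl⟩ := h
  obtain ⟨β', hβ', rfl⟩ := h'
  exact ⟨β + β', (abs_add_le _ _).trans (add_le_add hβ hβ'), by rw [exp_add]; ring⟩

theorem logClose_of_le {E x y : ℝ} (hx : 0 < x) (hy : 0 < y) (h1 : x ≤ y * exp E)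
    (h2 : y ≤ x * exp E) : LogClose E x y := by
  refine ⟨log (x / y), ?_, ?_⟩
  · rw [abs_le]
    constructor
    · rw [neg_le, ← log_inv, inv_div, log_le_iff_le_exp (by positivity), div_le_iff₀ hx]
      linarith
    · rw [log_le_iff_le_exp (by positivity), div_le_iff₀ hy]
      linarith
  · rw [exp_log (by positivity)]
    field_simp

/-- Clamping at an upper bound of the true value never hurts, and it gives the approximation the
same upper bound, which the contraction step requires of both ends of the segment. -/
theorem LogClose.min_right {E x y θ : ℝ} (h : LogClose E x y) (hy : y ≤ θ) (hy0 : 0 ≤ y) :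
    LogClose E (min x θ) y := by
  rcases le_total x θ with hx | hx
  · rwa [min_eq_left hx]
  · rw [min_eq_right hx]
    obtain ⟨β, hβ, rfl⟩ := h
    have hE : 0 ≤ E := (abs_nonneg β).trans hβ
    rcases hy0.eq_or_lt with rfl | hy1
    · rw [zero_mul] at hx
      rw [le_antisymm hx hy]
      exact LogClose.refl hE 0
    · refine logClose_of_le (lt_of_lt_of_le hy1 hy) hy1 ?_ ?_
      · refine hx.trans (mul_le_mul_of_nonneg_left (exp_le_exp.2 ?_) hy1.le)
        exact (le_abs_self β).trans hβ
      · have : 1 ≤ exp E := one_le_exp hE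
        nlinarith

/-- Adding the same positive number to two nonnegative ones does not increase their logarithmic
distance. So the factors `l + R_x R_y` are no worse than the ratios in them. -/
theorem LogClose.add_const {E x y l : ℝ} (hl : 0 < l) (hy : 0 ≤ y) (h : LogClose E x y) :
    LogClose E (l + x) (l + y) := by
  obtain ⟨β, hβ, rfl⟩ := h
  have hE : 0 ≤ E := (abs_nonneg β).trans hβ
  have h1 : 1 ≤ exp E := one_le_exp hE
  have h2 : exp β ≤ exp E := exp_le_exp.2 ((le_abs_self β).trans hβ)
  have h3 : 1 ≤ exp β * exp E := by
    rw [← exp_add]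
    exact one_le_exp (by linarith [neg_abs_le β])
  refine logClose_of_le (by positivity) (by positivity) ?_ ?_
  · nlinarith [mul_le_mul_of_nonneg_left h2 hy]
  · nlinarith [mul_le_mul_of_nonneg_left h3 hy]

/-- A logarithmic segment is monotone, so an upper bound at its two ends holds along it. -/
theorem mul_exp_mul_le {a α t B : ℝ} (ha : 0 ≤ a) (h0 : a ≤ B) (h1 : a * exp α ≤ B)
    (ht : t ∈ Set.Icc (0 : ℝ) 1) : a * exp (t * α) ≤ B := by
  rcases le_total α 0 with h | h
  · refine le_trans (mul_le_of_le_one_right ha (exp_le_one_iff.2 ?_)) h0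
    exact mul_nonpos_of_nonneg_of_nonpos ht.1 h
  · refine le_trans (mul_le_mul_of_nonneg_left (exp_le_exp.2 ?_) ha) h1
    exact mul_le_of_le_one_left h ht.2

/-- A bound for the logarithmic derivative of `(1 + a b₀) / (c + (a + b₁))` along a logarithmic
segment bounds the change of that quantity. -/
theorem logClose_of_deriv_le {c a b₀ b₁ α β₀ β₁ D : ℝ} (hc : 0 < c) (ha : 0 ≤ a) (hb₀ : 0 ≤ b₀)
    (hb₁ : 0 ≤ b₁)
    (hD : ∀ t ∈ Set.Icc (0 : ℝ) 1, ∀ a' b₀' b₁' : ℝ, a' = a * exp (t * α) →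
      b₀' = b₀ * exp (t * β₀) → b₁' = b₁ * exp (t * β₁) →
      |a' * b₀' / (1 + a' * b₀') * (α + β₀) - (a' * α + b₁' * β₁) / (c + (a' + b₁'))| ≤ D) :
    LogClose D ((1 + a * exp α * (b₀ * exp β₀)) / (c + (a * exp α + b₁ * exp β₁)))
      ((1 + a * b₀) / (c + (a + b₁))) := by
  set A : ℝ → ℝ := fun t => a * exp (t * α) with hA
  set B₀ : ℝ → ℝ := fun t => b₀ * exp (t * β₀) with hB₀
  set B₁ : ℝ → ℝ := fun t => b₁ * exp (t * β₁) with hB₁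
  have dexp : ∀ (x y t : ℝ), HasDerivAt (fun t => x * exp (t * y)) (x * exp (t * y) * y) t := by
    intro x y t
    have h := (((hasDerivAt_id t).mul_const y).exp).const_mul x
    simpa [mul_assoc] using h
  have pA : ∀ t, 0 ≤ A t := fun t => by simp only [hA]; positivity
  have pB₀ : ∀ t, 0 ≤ B₀ t := fun t => by simp only [hB₀]; positivity
  have pB₁ : ∀ t, 0 ≤ B₁ t := fun t => by simp only [hB₁]; positivity
  have p1 : ∀ t, 0 < 1 + A t * B₀ t := fun t => by have := pA t; have := pB₀ t; positivity
  have p2 : ∀ t, 0 < c + (A t + B₁ t) := fun t => by have := pA t; have := pB₁ t; positivity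
  set f : ℝ → ℝ := fun t => log (1 + A t * B₀ t) - log (c + (A t + B₁ t)) with hf
  have hder : ∀ t, HasDerivAt f (A t * B₀ t / (1 + A t * B₀ t) * (α + β₀) -
      (A t * α + B₁ t * β₁) / (c + (A t + B₁ t))) t := by
    intro t
    have h1 := (((dexp a α t).mul (dexp b₀ β₀ t)).const_add 1).log (p1 t).ne'
    have h2 := (((dexp a α t).add (dexp b₁ β₁ t)).const_add c).log (p2 t).ne'
    refine (h1.sub h2).congr_deriv ?_
    simp only [hA, hB₀, hB₁, Pi.mul_apply, Pi.add_apply]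
    ring
  have hmv : ‖f 1 - f 0‖ ≤ D := by
    refine norm_image_sub_le_of_norm_deriv_le_segment_01' (f' := fun t =>
      A t * B₀ t / (1 + A t * B₀ t) * (α + β₀) - (A t * α + B₁ t * β₁) / (c + (A t + B₁ t)))
      (fun t _ => (hder t).hasDerivWithinAt) ?_
    intro t ht
    exact hD t ⟨ht.1, ht.2.le⟩ _ _ _ rfl rfl rfl
  have q1 := p1 1
  have q2 := p2 1
  have q3 := p1 0
  have q4 := p2 0
  refine ⟨f 1 - f 0, hmv, ?_⟩
  have e1 : exp (f 1) = (1 + A 1 * B₀ 1) / (c + (A 1 + B₁ 1)) := by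
    simp only [hf]; rw [exp_sub, exp_log q1, exp_log q2]
  have e0 : exp (f 0) = (1 + A 0 * B₀ 0) / (c + (A 0 + B₁ 0)) := by
    simp only [hf]; rw [exp_sub, exp_log q3, exp_log q4]
  have g0 : (1 + a * b₀) / (c + (a + b₁)) = exp (f 0) := by rw [e0]; simp [hA, hB₀, hB₁]
  have g1 : (1 + a * exp α * (b₀ * exp β₀)) / (c + (a * exp α + b₁ * exp β₁)) = exp (f 1) := by
    rw [e1]; simp [hA, hB₀, hB₁]
  rw [g0, g1, ← exp_add]
  congr 1
  ring

/-- The rate of decay. -/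
noncomputable def decayRate (P : ℝ) : ℝ := 1 - 1 / (20 * P)

theorem decayRate_bounds {P : ℝ} (hP : 1 ≤ P) :
    19 / 20 ≤ decayRate P ∧ decayRate P < 1 := by
  unfold decayRate
  have h : 1 / (20 * P) ≤ 1 / 20 := by
    apply one_div_le_one_div_of_le <;> linarith
  have : 0 < 1 / (20 * P) := by positivity
  constructor <;> linarith

/-- The case where only the end `u` carries an error. Both terms are in `[0, 1)`, so their
difference is at most the larger one; the first is `1 - 1/(1 + a b₀)` with `1 + a b₀ ≤ 1 + P ≤ 20
P`. Their sum would not be under control. -/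
theorem decay_root {P a b₀ b₁ c : ℝ} (hP : 1 ≤ P) (hc : 117 / 100 ≤ c) (ha : 0 ≤ a)
    (ha' : a ≤ 100 / 117) (hb₀ : 0 ≤ b₀) (hb₀' : b₀ ≤ P) (hb₁ : 0 ≤ b₁) :
    |a * b₀ / (1 + a * b₀) - a / (c + (a + b₁))| ≤ decayRate P := by
  have hab : 0 ≤ a * b₀ := by positivity
  have hden : 0 < c + (a + b₁) := by linarith
  have x0 : 0 ≤ a * b₀ / (1 + a * b₀) := by positivity
  have y0 : 0 ≤ a / (c + (a + b₁)) := by positivity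
  have x1 : a * b₀ / (1 + a * b₀) ≤ decayRate P := by
    have h1 : a * b₀ ≤ P := by nlinarith
    have : a * b₀ / (1 + a * b₀) = 1 - 1 / (1 + a * b₀) := by field_simp; ring
    rw [this, decayRate]
    have : 1 / (20 * P) ≤ 1 / (1 + a * b₀) := by
      apply one_div_le_one_div_of_le <;> linarith
    linarith
  have y1 : a / (c + (a + b₁)) ≤ 1 / 2 := by
    rw [div_le_iff₀ hden]; linarith
  have := (decayRate_bounds hP).1
  rw [abs_le]
  constructor <;> linarith

/-- The case where only the end `v` carries errors, while `a` may be as large as `P`. Both terms are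
largest for `c = 117/100` and `b₀ = b₁ = 100/117`. The slack that remains behaves like `(117/100 -
100/117) / a` for large `a`; it is positive because `c` exceeds `1`, and this is one source of the
`1 / P` in the rate. -/
theorem decay_rest {P a b₀ b₁ c : ℝ} (hP : 1 ≤ P) (hc : 117 / 100 ≤ c) (ha : 0 ≤ a)
    (ha' : a ≤ P) (hb₀ : 0 ≤ b₀) (hb₀' : b₀ ≤ 100 / 117) (hb₁ : 0 ≤ b₁) (hb₁' : b₁ ≤ 100 / 117) :
    a * b₀ / (1 + a * b₀) + b₁ / (c + (a + b₁)) ≤ decayRate P := by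
  have hab : 0 ≤ a * b₀ := by positivity
  have hden : 0 < c + (a + b₁) := by linarith
  have x1 : a * b₀ / (1 + a * b₀) ≤ 1 - (117 / 100) / (117 / 100 + a) := by
    have : a * b₀ / (1 + a * b₀) = 1 - 1 / (1 + a * b₀) := by field_simp; ring
    rw [this]
    have : (117 / 100) / (117 / 100 + a) ≤ 1 / (1 + a * b₀) := by
      rw [div_le_div_iff₀ (by linarith) (by linarith)]
      nlinarith
    linarith
  have z1 : b₁ / (c + (a + b₁)) ≤ (100 / 117) / (117 / 100 + a + 100 / 117) := by
    rw [div_le_div_iff₀ hden (by linarith)]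
    nlinarith
  have key : 1 / (20 * P) ≤ (117 / 100) / (117 / 100 + a) -
      (100 / 117) / (117 / 100 + a + 100 / 117) := by
    rw [div_sub_div _ _ (by linarith) (by linarith), div_le_div_iff₀ (by linarith) (by positivity)]
    nlinarith [mul_nonneg ha (sub_nonneg.2 ha')]
  unfold decayRate
  linarith

/-- The case where both ends carry errors. If the term in the denominator dominates, the first
product cancels and `(a + b₁) / (c + a + b₁)` remains; otherwise the sum is twice the first product
plus `(b₁ - a) / (c + a + b₁)`, extremal at the bounds for `b₀`, `b₁` and `c`. Either way `19/20`
suffices, whatever `P` is. -/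
theorem decay_all {P a b₀ b₁ c : ℝ} (hP : 1 ≤ P) (hc : 117 / 100 ≤ c) (ha : 0 ≤ a)
    (ha' : a ≤ 100 / 117) (hb₀ : 0 ≤ b₀) (hb₀' : b₀ ≤ 100 / 117) (hb₁ : 0 ≤ b₁)
    (hb₁' : b₁ ≤ 100 / 117) :
    |a * b₀ / (1 + a * b₀) - a / (c + (a + b₁))| + a * b₀ / (1 + a * b₀) +
      b₁ / (c + (a + b₁)) ≤ decayRate P := by
  have hab : 0 ≤ a * b₀ := by positivity
  have hden : 0 < c + (a + b₁) := by linarith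
  have hκ := (decayRate_bounds hP).1
  rcases le_total (a * b₀ / (1 + a * b₀)) (a / (c + (a + b₁))) with h | h
  · rw [abs_of_nonpos (by linarith)]
    have : a / (c + (a + b₁)) + b₁ / (c + (a + b₁)) ≤ 19 / 20 := by
      rw [← add_div, div_le_iff₀ hden]
      linarith
    linarith
  · rw [abs_of_nonneg (by linarith)]
    have x1 : a * b₀ / (1 + a * b₀) ≤ a / (117 / 100 + a) := by
      rw [div_le_div_iff₀ (by linarith) (by linarith)]
      nlinarith
    have z1 : b₁ / (c + (a + b₁)) - a / (c + (a + b₁)) ≤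
        (100 / 117 - a) / (117 / 100 + a + 100 / 117) := by
      rw [← sub_div, div_le_div_iff₀ hden (by linarith)]
      nlinarith
    have key : 2 * (a / (117 / 100 + a)) + (100 / 117 - a) / (117 / 100 + a + 100 / 117) ≤
        19 / 20 := by
      rw [← mul_div_assoc, div_add_div _ _ (by linarith) (by linarith), div_le_iff₀ (by positivity)]
      nlinarith
    linarith

/-- One step of the recursion shrinks the logarithmic error.  `da` and `db` tell whether the
values at the two ends of the edge carry errors. -/
theorem logClose_ratioStep {P E c l : ℝ} (hP : 1 ≤ P) (hE : 0 ≤ E) (hc : 117 / 100 ≤ c)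
    (hl : 1 ≤ l) {da db : Prop} {a b₀ b₁ a' b₀' b₁' : ℝ} (ha : 0 ≤ a) (haP : a ≤ P)
    (hb₀ : 0 ≤ b₀) (hb₀P : b₀ ≤ P) (hb₁ : 0 ≤ b₁)
    (hda : da → a ≤ 100 / 117 ∧ a' ≤ 100 / 117 ∧ LogClose E a' a) (hda' : ¬ da → a' = a)
    (hdb₀ : db → b₀ ≤ 100 / 117 ∧ b₀' ≤ 100 / 117 ∧ LogClose E b₀' b₀) (hdb₀' : ¬ db → b₀' = b₀)
    (hdb₁ : db → b₁ ≤ 100 / 117 ∧ b₁' ≤ 100 / 117 ∧ LogClose E b₁' b₁)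
    (hdb₁' : ¬ db → b₁' = b₁) :
    LogClose (decayRate P * E) (ratioStep l c a' b₀' b₁') (ratioStep l c a b₀ b₁) := by
  have hl0 : 0 < l := by linarith
  have hc0 : 0 < c := by linarith
  -- Division by `l` preserves the logarithmic error, and since `l ≥ 1` also the upper bounds, so `a
  -- / l` takes the place of `a`.
  obtain ⟨α, hα, ea, ba⟩ : ∃ α, |α| ≤ E ∧ a' / l = a / l * exp α ∧
      (da → a / l ≤ 100 / 117 ∧ a / l * exp α ≤ 100 / 117) ∧ (¬ da → α = 0) := by
    by_cases h : da
    · obtain ⟨h1, h2, β, hβ, rfl⟩ := hda h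
      refine ⟨β, hβ, by ring, fun _ => ⟨(div_le_self ha hl).trans h1, ?_⟩, fun h' => absurd h h'⟩
      rw [div_mul_eq_mul_div]
      exact (div_le_self (by positivity) hl).trans h2
    · exact ⟨0, by simpa, by simp [hda' h], fun h' => absurd h' h, fun _ => rfl⟩
  have aux : ∀ {b b' : ℝ}, 0 ≤ b → (db → b ≤ 100 / 117 ∧ b' ≤ 100 / 117 ∧ LogClose E b' b) →
      (¬ db → b' = b) → ∃ β, |β| ≤ E ∧ b' = b * exp β ∧
        (db → b ≤ 100 / 117 ∧ b * exp β ≤ 100 / 117) ∧ (¬ db → β = 0) := by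
    intro b b' hb h1 h2
    by_cases h : db
    · obtain ⟨h3, h4, β, hβ, rfl⟩ := h1 h
      exact ⟨β, hβ, rfl, fun _ => ⟨h3, h4⟩, fun h' => absurd h h'⟩
    · exact ⟨0, by simpa, by simp [h2 h], fun h' => absurd h' h, fun _ => rfl⟩
  obtain ⟨β₀, hβ₀, rfl, bb₀, nb₀⟩ := aux hb₀ hdb₀ hdb₀'
  obtain ⟨β₁, hβ₁, rfl, bb₁, nb₁⟩ := aux hb₁ hdb₁ hdb₁'
  obtain ⟨ba, na⟩ := ba
  have hal : 0 ≤ a / l := by positivity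
  have halP : a / l ≤ P := (div_le_self ha hl).trans haP
  unfold ratioStep
  rw [ea]
  refine logClose_of_deriv_le hc0 hal hb₀ hb₁ ?_
  intro t ht x y₀ y₁ hx hy₀ hy₁
  have px : 0 ≤ x := by rw [hx]; positivity
  have py₀ : 0 ≤ y₀ := by rw [hy₀]; positivity
  have py₁ : 0 ≤ y₁ := by rw [hy₁]; positivity
  have hden : 0 < c + (x + y₁) := by linarith
  have hX : 0 ≤ x * y₀ / (1 + x * y₀) := by positivity
  have hZ : 0 ≤ y₁ / (c + (x + y₁)) := by positivity
  have bx : da → x ≤ 100 / 117 := fun h => by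
    rw [hx]; exact mul_exp_mul_le hal (ba h).1 (ba h).2 ht
  have by₀ : db → y₀ ≤ 100 / 117 := fun h => by
    rw [hy₀]; exact mul_exp_mul_le hb₀ (bb₀ h).1 (bb₀ h).2 ht
  have by₁ : db → y₁ ≤ 100 / 117 := fun h => by
    rw [hy₁]; exact mul_exp_mul_le hb₁ (bb₁ h).1 (bb₁ h).2 ht
  -- The perturbation of `x` acts on numerator and denominator in opposite directions; collecting
  -- its two contributions keeps this cancellation.
  have split : x * y₀ / (1 + x * y₀) * (α + β₀) - (x * α + y₁ * β₁) / (c + (x + y₁)) =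
      (x * y₀ / (1 + x * y₀) - x / (c + (x + y₁))) * α + x * y₀ / (1 + x * y₀) * β₀ -
        y₁ / (c + (x + y₁)) * β₁ := by
    ring
  have T1 : ∀ {u v : ℝ}, |v| ≤ E → |u * v| ≤ |u| * E := fun {u v} h => by
    rw [abs_mul]; exact mul_le_mul_of_nonneg_left h (abs_nonneg u)
  have t1 := T1 (u := x * y₀ / (1 + x * y₀) - x / (c + (x + y₁))) hα
  have t2 := T1 (u := x * y₀ / (1 + x * y₀)) hβ₀
  have t3 := T1 (u := y₁ / (c + (x + y₁))) hβ₁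
  rw [abs_of_nonneg hX] at t2
  rw [abs_of_nonneg hZ] at t3
  have hκ : 0 ≤ decayRate P := by linarith [(decayRate_bounds hP).1]
  rw [split]
  by_cases h1 : da <;> by_cases h2 : db
  · have := decay_all hP hc px (bx h1) py₀ (by₀ h2) py₁ (by₁ h2)
    refine (abs_sub _ _).trans ?_
    refine (add_le_add (abs_add_le _ _) le_rfl).trans ?_
    nlinarith
  · rw [nb₀ h2, nb₁ h2]
    rw [nb₀ h2] at hy₀
    have := decay_root hP hc px (bx h1) py₀ (by rw [hy₀]; simpa using hb₀P) py₁
    simp only [mul_zero, add_zero, sub_zero]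
    nlinarith
  · rw [na h1]
    rw [na h1] at hx
    have := decay_rest hP hc px (by rw [hx]; simpa using halP) py₀ (by₀ h2) py₁ (by₁ h2)
    simp only [mul_zero, zero_add]
    refine (abs_sub _ _).trans ?_
    nlinarith
  · rw [na h1, nb₀ h2, nb₁ h2]
    simp only [mul_zero, add_zero, sub_zero, abs_zero]
    positivity

end Decay

/-! ### The truncated recursion against the exact one. -/

section Approximation

open Real

variable {V : Type} [DecidableEq V]

/-- A branch that ends before the cut is computed without error, so no smallness of its ratio is
needed. -/
theorem approxRatio_eq_exactRatio (c : V → ℝ) {N : ℕ} (ls : List Bool) (s : V → ℝ)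
    {es : List (V × V × ℝ)} (hN : es.length ≤ N) (v : V) (hd : isDeep ls.length es v = false) :
    approxRatio c ls s es v = (false, exactRatio c N s es v) := by
  induction ls generalizing N s es v with
  | nil =>
    cases h : pickEdge v es with
    | none => rw [approxRatio_none c _ s h, exactRatio_none c _ s h]
    | some r => simp [isDeep, h] at hd
  | cons b ls ih =>
    cases h : pickEdge v es with
    | none => rw [approxRatio_none c _ s h, exactRatio_none c _ s h]
    | some r =>
      obtain ⟨⟨u, l⟩, rest⟩ := r
      have hlen := length_of_pickEdge h
      obtain ⟨N, rfl⟩ : ∃ M, N = M + 1 := ⟨N - 1, by omega⟩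
      have hN' : rest.length ≤ N := by omega
      have hd' : isDeep ls.length rest u = false ∧ isDeep ls.length rest v = false := by
        simpa [isDeep, h] using hd
      rw [approxRatio_some c b ls s h, exactRatio_some c N s h, ih _ hN' u hd'.1,
        ih _ hN' v hd'.2, ih _ hN' v hd'.2]
      simp

/-- The lowest levels only decide whether a branch is deep; whatever was computed below is discarded
for the default. -/
theorem approxRatio_low (c : V → ℝ) (n : ℕ) (s : V → ℝ) {es : List (V × V × ℝ)} (v : V)
    (hd : isDeep n es v = true) :
    approxRatio c (List.replicate n false) s es v = (true, 1 / c v) := by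
  cases n with
  | zero =>
    cases h : pickEdge v es with
    | none => simp [isDeep, h] at hd
    | some r => simp [approxRatio, h]
  | succ n =>
    cases h : pickEdge v es with
    | none => simp [isDeep, h] at hd
    | some r =>
      obtain ⟨⟨u, l⟩, rest⟩ := r
      have hd' : (isDeep n rest u || isDeep n rest v) = true := by
        simpa [isDeep, h] using hd
      rw [List.replicate_succ, approxRatio_some c _ _ s h, approxRatio_fst, approxRatio_fst,
        List.length_replicate, if_pos hd']
      simp

/-- The depths of a computation: `h` levels that are evaluated above `2 P` levels that are only
explored. -/
def levelList (P h : ℕ) : List Bool := List.replicate h true ++ List.replicate (2 * P) false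

theorem length_levelList (P h : ℕ) : (levelList P h).length = h + 2 * P := by
  simp [levelList]

theorem levelList_succ (P h : ℕ) : levelList P (h + 1) = true :: levelList P h := rfl

/-- After `2 P` levels the bound for the reciprocal ratio, growing by `1 / P` each time, exceeds `2`
and hence `117/100`. -/
theorem exactRatio_le_of_isDeep_levelList [Fintype V] {c : V → ℝ} {P : ℕ} (hP : 1 ≤ P)
    (hc : ∀ v, 117 / 100 ≤ c v) {N : ℕ} (h : ℕ) {s : V → ℝ} (hs : ∀ v, 0 ≤ s v ∧ s v ≤ P)
    {es : List (V × V × ℝ)} (hN : es.length ≤ N) (hl : ∀ e ∈ es, 1 ≤ e.2.2) (v : V)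
    (hd : isDeep (h + 2 * P) es v = true) : exactRatio c N s es v ≤ 100 / 117 := by
  have hP1 : (1 : ℝ) ≤ P := by exact_mod_cast hP
  have h1 := exactRatio_le_of_isDeep hP1 hc _ hs hN hl v hd
  rw [min_eq_left] at h1
  · linarith
  · rw [le_div_iff₀ (by linarith)]
    push_cast
    have : (0 : ℝ) ≤ h := Nat.cast_nonneg h
    nlinarith

/-- The logarithmic error of the default value. -/
def defaultError (P : ℕ) : ℕ := P ^ 2 + 2 * P

/-- One recursion step suffices: with `x = a/l` and all arguments in `[0, P]`, the two quotients of
`1 / c` and the step are at most `1 + 2 P` and `1 + P ^ 2`, and `1 + E ≤ exp E`. -/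
theorem logClose_default {P c l a b₀ b₁ : ℝ} (hP : 1 ≤ P) (hc : 117 / 100 ≤ c) (hl : 1 ≤ l)
    (ha : 0 ≤ a) (haP : a ≤ P) (hb₀ : 0 ≤ b₀) (hb₀P : b₀ ≤ P) (hb₁ : 0 ≤ b₁) (hb₁P : b₁ ≤ P) :
    LogClose (P ^ 2 + 2 * P) (1 / c) (ratioStep l c a b₀ b₁) := by
  have hc0 : 0 < c := by linarith
  have hl0 : 0 < l := by linarith
  have h1 : 0 ≤ a / l := by positivity
  have h2 : a / l ≤ P := (div_le_self ha hl).trans haP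
  have hexp : 1 + (P ^ 2 + 2 * P) ≤ exp (P ^ 2 + 2 * P) := by
    linarith [add_one_le_exp (P ^ 2 + 2 * P)]
  unfold ratioStep
  generalize a / l = x at *
  have h3 : 0 < c + (x + b₁) := by linarith
  have h4 : 0 ≤ x * b₀ := by positivity
  have h5 : x * b₀ ≤ P ^ 2 := by nlinarith
  refine logClose_of_le (by positivity) (by positivity) ?_ ?_
  · rw [div_mul_eq_mul_div, div_le_div_iff₀ hc0 h3]
    have : (1 : ℝ) ≤ exp (P ^ 2 + 2 * P) := one_le_exp (by positivity)
    nlinarith [mul_nonneg h4 (exp_pos (P ^ 2 + 2 * P)).le]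
  · rw [div_mul_eq_mul_div, one_mul, div_le_div_iff₀ h3 hc0]
    have : (1 : ℝ) ≤ exp (P ^ 2 + 2 * P) := one_le_exp (by positivity)
    nlinarith [mul_nonneg hc0.le (sub_nonneg.2 hexp)]

/-- Each evaluated level contracts the error once. The bound `100/117` for the approximation travels
along in the induction, since the contraction needs it for approximate and exact values alike. -/
theorem logClose_approxRatio [Fintype V] {c : V → ℝ} {P : ℕ} (hP : 1 ≤ P)
    (hc : ∀ v, 117 / 100 ≤ c v) {N : ℕ} (h : ℕ) {s : V → ℝ} (hs : ∀ v, 0 ≤ s v ∧ s v ≤ P)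
    {es : List (V × V × ℝ)} (hN : es.length ≤ N) (hl : ∀ e ∈ es, 1 ≤ e.2.2) (v : V)
    (hd : isDeep (h + 2 * P) es v = true) :
    (approxRatio c (levelList P h) s es v).2 ≤ 100 / 117 ∧
      LogClose (decayRate P ^ h * defaultError P) (approxRatio c (levelList P h) s es v).2
        (exactRatio c N s es v) := by
  have hP1 : (1 : ℝ) ≤ P := by exact_mod_cast hP
  have hc0 : ∀ v, 0 < c v := fun v => by linarith [hc v]
  have hκ := decayRate_bounds hP1
  induction h generalizing N s es v with
  | zero =>
    have e1 : approxRatio c (levelList P 0) s es v = (true, 1 / c v) := by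
      have : levelList P 0 = List.replicate (2 * P) false := by simp [levelList]
      rw [this]
      exact approxRatio_low c _ s v (by simpa using hd)
    rw [e1]
    refine ⟨?_, ?_⟩
    · rw [div_le_div_iff₀ (hc0 v) (by norm_num)]
      linarith [hc v]
    · cases h : pickEdge v es with
      | none =>
        -- As `P ≥ 1`, at least one level lies below; a deep vertex therefore has an edge, and its
        -- exact ratio is a recursion step.
        obtain ⟨k, hk⟩ : ∃ k, 2 * P = k + 1 := ⟨2 * P - 1, by omega⟩
        rw [zero_add, hk] at hd
        simp [isDeep, h] at hd
      | some r =>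
        obtain ⟨⟨u, l⟩, rest⟩ := r
        obtain ⟨h1, h2⟩ := mem_of_pickEdge h
        have hlen := length_of_pickEdge h
        obtain ⟨N, rfl⟩ : ∃ M, N = M + 1 := ⟨N - 1, by omega⟩
        have hl1 : 1 ≤ l := by rcases h1 with h1 | h1 <;> exact hl _ h1
        have hr : ∀ e ∈ rest, 1 ≤ e.2.2 := fun e he => hl e (h2 e he)
        have hr0 : ∀ e ∈ rest, 0 < e.2.2 := fun e he => lt_of_lt_of_le one_pos (hr e he)
        have hpv := pin_le hP1 hc hs v
        have hpu := pin_le hP1 hc hs u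
        rw [exactRatio_some c N s h]
        have := logClose_default hP1 (hc v) hl1
          (exactRatio_nonneg hc0 N (fun v => (hpv v).1) hr0 u) (exactRatio_le hP1 hc N hpv hr u)
          (exactRatio_nonneg hc0 N (fun v => (hs v).1) hr0 v) (exactRatio_le hP1 hc N hs hr v)
          (exactRatio_nonneg hc0 N (fun v => (hpu v).1) hr0 v) (exactRatio_le hP1 hc N hpu hr v)
        simpa [defaultError] using this
  | succ n ih =>
    cases h : pickEdge v es with
    | none =>
      have : n + 1 + 2 * P = (n + 2 * P) + 1 := by omega
      rw [this] at hd
      simp [isDeep, h] at hd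
    | some r =>
      obtain ⟨⟨u, l⟩, rest⟩ := r
      obtain ⟨h1, h2⟩ := mem_of_pickEdge h
      have hlen := length_of_pickEdge h
      obtain ⟨N, rfl⟩ : ∃ M, N = M + 1 := ⟨N - 1, by omega⟩
      have hN' : rest.length ≤ N := by omega
      have hl1 : 1 ≤ l := by rcases h1 with h1 | h1 <;> exact hl _ h1
      have hr : ∀ e ∈ rest, 1 ≤ e.2.2 := fun e he => hl e (h2 e he)
      have hr0 : ∀ e ∈ rest, 0 < e.2.2 := fun e he => lt_of_lt_of_le one_pos (hr e he)
      have hpv := pin_le hP1 hc hs v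
      have hpu := pin_le hP1 hc hs u
      have hd' : (isDeep (n + 2 * P) rest u || isDeep (n + 2 * P) rest v) = true := by
        have e : n + 1 + 2 * P = (n + 2 * P) + 1 := by omega
        rw [e] at hd
        simpa [isDeep, h] using hd
      have hS := exactRatio_le_of_isDeep_levelList hP hc _ hs hN hl v hd
      have hS0 := exactRatio_nonneg hc0 (N + 1) (fun v => (hs v).1)
        (fun e he => lt_of_lt_of_le one_pos (hl e he)) v
      rw [levelList_succ, approxRatio_some c _ _ s h, approxRatio_fst, approxRatio_fst,
        length_levelList, if_pos hd']
      simp only [if_true]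
      refine ⟨min_le_right _ _, LogClose.min_right ?_ hS hS0⟩
      rw [exactRatio_some c N s h, pow_succ', mul_assoc]
      have hE : 0 ≤ decayRate P ^ n * defaultError P :=
        mul_nonneg (pow_nonneg (by linarith) n) (Nat.cast_nonneg _)
      have hdeep : ∀ {s : V → ℝ} (w : V), (∀ v, 0 ≤ s v ∧ s v ≤ P) →
          isDeep (n + 2 * P) rest w = true → exactRatio c N s rest w ≤ 100 / 117 ∧
            (approxRatio c (levelList P n) s rest w).2 ≤ 100 / 117 ∧
            LogClose (decayRate P ^ n * defaultError P)
              (approxRatio c (levelList P n) s rest w).2 (exactRatio c N s rest w) :=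
        fun w hs hw => ⟨exactRatio_le_of_isDeep_levelList hP hc _ hs hN' hr w hw,
          ih hs hN' hr w hw⟩
      have hflat : ∀ (s : V → ℝ) (w : V), ¬ isDeep (n + 2 * P) rest w = true →
          (approxRatio c (levelList P n) s rest w).2 = exactRatio c N s rest w := by
        intro s w hw
        rw [approxRatio_eq_exactRatio c _ s hN' w]
        rw [length_levelList]
        simpa using hw
      -- Depth ignores the pins, so a single flag `db` covers both arguments at `v`.
      exact logClose_ratioStep hP1 hE (hc v) hl1 (da := isDeep (n + 2 * P) rest u = true)
        (db := isDeep (n + 2 * P) rest v = true)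
        (exactRatio_nonneg hc0 N (fun v => (hpv v).1) hr0 u) (exactRatio_le hP1 hc N hpv hr u)
        (exactRatio_nonneg hc0 N (fun v => (hs v).1) hr0 v) (exactRatio_le hP1 hc N hs hr v)
        (exactRatio_nonneg hc0 N (fun v => (hpu v).1) hr0 v)
        (hdeep u hpv) (hflat _ u) (hdeep v hs) (hflat _ v) (hdeep v hpu) (hflat _ v)

theorem logClose_approxRatio_all [Fintype V] {c : V → ℝ} {P : ℕ} (hP : 1 ≤ P)
    (hc : ∀ v, 117 / 100 ≤ c v) {N : ℕ} (h : ℕ) {s : V → ℝ} (hs : ∀ v, 0 ≤ s v ∧ s v ≤ P)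
    {es : List (V × V × ℝ)} (hN : es.length ≤ N) (hl : ∀ e ∈ es, 1 ≤ e.2.2) (v : V) :
    LogClose (decayRate P ^ h * defaultError P) (approxRatio c (levelList P h) s es v).2
      (exactRatio c N s es v) := by
  have hP1 : (1 : ℝ) ≤ P := by exact_mod_cast hP
  cases hd : isDeep (h + 2 * P) es v with
  | true => exact (logClose_approxRatio hP hc h hs hN hl v hd).2
  | false =>
    rw [approxRatio_eq_exactRatio c _ s hN v (by rwa [length_levelList])]
    refine LogClose.refl (mul_nonneg (pow_nonneg ?_ _) (Nat.cast_nonneg _)) _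
    linarith [(decayRate_bounds hP1).1]

/-- The product of the values of the vertex functions when all edges have the value `1`. -/
def topWeight [Fintype V] (c : V → ℝ) : List (V × V × ℝ) → (V → ℝ × ℝ) → ℝ
  | [], F => ∏ v, (F v).1
  | (x, y, _) :: es, F => topWeight c es (shiftAt c y (shiftAt c x F))

/-- The all-ones configuration is the pivot: `Z = (l + R_x R_y) Z'`, where `Z'` has the edge removed
and both ends shifted, and `R_y` is taken after the shift at `x`. Two ratios per edge give twice the
error of one. -/
theorem logClose_approxProd [Fintype V] {c : V → ℝ} {P : ℕ} (hP : 1 ≤ P)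
    (hc : ∀ v, 117 / 100 ≤ c v) (h : ℕ) {es : List (V × V × ℝ)} (hl : ∀ e ∈ es, 1 ≤ e.2.2)
    {F : V → ℝ × ℝ} (hF : ∀ v, 0 ≤ (F v).1 ∧ 0 < (F v).2)
    (hFP : ∀ v, (F v).1 / (F v).2 ≤ P) :
    LogClose (es.length * (2 * (decayRate P ^ h * defaultError P)))
      (topWeight c es F * approxProd c (levelList P h) (fun v => (F v).1 / (F v).2) es)
      (listZ c es F) := by
  have hP1 : (1 : ℝ) ≤ P := by exact_mod_cast hP
  have hc0 : ∀ v, 0 < c v := fun v => by linarith [hc v]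
  induction es generalizing F with
  | nil => simpa [topWeight, approxProd, listZ] using LogClose.refl le_rfl _
  | cons e es ih =>
    obtain ⟨x, y, l⟩ := e
    have hl1 : 1 ≤ l := hl (x, y, l) (by simp)
    have hl0 : 0 < l := by linarith
    have hr : ∀ e ∈ es, 1 ≤ e.2.2 := fun e he => hl e (List.mem_cons_of_mem _ he)
    have hr0 : ∀ e ∈ es, 0 < e.2.2 := fun e he => lt_of_lt_of_le one_pos (hr e he)
    have hFp : ∀ v, 0 < (F v).2 := fun v => (hF v).2
    have hs : ∀ v, 0 ≤ (F v).1 / (F v).2 ∧ (F v).1 / (F v).2 ≤ P :=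
      fun v => ⟨div_nonneg (hF v).1 (hF v).2.le, hFP v⟩
    have hFx := shiftAt_admissible hc0 hF x
    have hFy := shiftAt_admissible hc0 hFx y
    have hpx := pin_le hP1 hc hs x
    have hpy := pin_le hP1 hc hpx y
    have hrx := shiftAt_ratio c x hFp
    have hry := shiftAt_ratio c y (fun v => (hFx v).2)
    rw [hrx] at hry
    have ih' := ih hr hFy (fun v => by rw [congrFun hry v]; exact (hpy v).2)
    rw [hry] at ih'
    have z1 := listZ_eq_exactRatio_mul hc0 le_rfl hr0 hF x
    have z2 := listZ_eq_exactRatio_mul hc0 le_rfl hr0 hFx y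
    rw [hrx] at z2
    have c1 := logClose_approxRatio_all hP hc h hs le_rfl hr x
    have c2 := logClose_approxRatio_all hP hc h hpx le_rfl hr y
    have p1 := exactRatio_nonneg hc0 es.length (fun v => (hs v).1) hr0 x
    have p2 := exactRatio_nonneg hc0 es.length (fun v => (hpx v).1) hr0 y
    have c3 := ((c1.mul c2).add_const hl0 (mul_nonneg p1 p2)).mul ih'
    rw [listZ_cons, shiftAt_comm c x y, z1, z2, topWeight, approxProd]
    convert c3 using 1
    · push_cast [List.length_cons]; ring
    · ring
    · ring

end Approximation

/-! ## Holant instances as edge lists -/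

section Instance

/-- The Fibonacci sequence with parameter `c` and given first two values. -/
def fibSeq (c : ℝ) (f : ℝ × ℝ) : ℕ → ℝ
  | 0 => f.1
  | 1 => f.2
  | n + 2 => c * fibSeq c f (n + 1) + fibSeq c f n

theorem fibSeq_shift (c : ℝ) (f : ℝ × ℝ) (n : ℕ) :
    fibSeq c (f.2, c * f.2 + f.1) n = fibSeq c f (n + 1) := by
  induction n using Nat.strong_induction_on with
  | _ n ih =>
    match n with
    | 0 => rfl
    | 1 => rfl
    | n + 2 =>
      rw [fibSeq, ih (n + 1) (by omega), ih n (by omega)]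
      rfl

variable {V : Type} [DecidableEq V]

theorem fibSeq_shiftAt (c : V → ℝ) (x v : V) (F : V → ℝ × ℝ) (n : ℕ) :
    fibSeq (c v) (shiftAt c x F v) n = fibSeq (c v) (F v) (n + if x = v then 1 else 0) := by
  unfold shiftAt
  rcases eq_or_ne x v with rfl | h
  · simp [fibSeq_shift]
  · simp [h, Function.update_of_ne h.symm]

/-- The number of ends at `v` of edges with the value `1`. -/
def endCount {m : ℕ} (src tgt : Fin m → V) (σ : Fin m → Bool) (v : V) : ℕ :=
  ∑ e, if σ e = true then (if src e = v then 1 else 0) + (if tgt e = v then 1 else 0) else 0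

variable [Fintype V]

theorem listZ_ofFn (c : V → ℝ) {m : ℕ} (src tgt : Fin m → V) (lam : Fin m → ℝ)
    (F : V → ℝ × ℝ) :
    listZ c (List.ofFn fun e => (src e, tgt e, lam e)) F =
      ∑ σ : Fin m → Bool, (∏ e, if σ e = true then lam e else 1) *
        ∏ v, fibSeq (c v) (F v) (endCount src tgt σ v) := by
  induction m generalizing F with
  | zero => simp [listZ, endCount, fibSeq]
  | succ m ih =>
    rw [List.ofFn_succ, listZ_cons, ih, ih, ← (Fin.consEquiv fun _ => Bool).sum_comp,
      Fintype.sum_prod_type, Fintype.sum_bool, add_comm, Finset.mul_sum]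
    congr 1
    · refine Finset.sum_congr rfl fun σ _ => ?_
      simp only [Fin.consEquiv, Equiv.coe_fn_mk, Fin.prod_univ_succ, Fin.cons_zero, Fin.cons_succ,
        if_true, endCount, Fin.sum_univ_succ, fibSeq_shiftAt]
      rw [mul_assoc]
      congr 3
      funext v
      congr 1
      ring
    · refine Finset.sum_congr rfl fun σ _ => ?_
      simp [Fin.consEquiv, Fin.prod_univ_succ, endCount, Fin.sum_univ_succ]

theorem topWeight_ofFn (c : V → ℝ) {m : ℕ} (src tgt : Fin m → V) (lam : Fin m → ℝ)
    (F : V → ℝ × ℝ) :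
    topWeight c (List.ofFn fun e => (src e, tgt e, lam e)) F =
      ∏ v, fibSeq (c v) (F v) (endCount src tgt (fun _ => true) v) := by
  induction m generalizing F with
  | zero => simp [topWeight, endCount, fibSeq]
  | succ m ih =>
    rw [List.ofFn_succ, topWeight, ih]
    refine Finset.prod_congr rfl fun v _ => ?_
    simp only [fibSeq_shiftAt, endCount, Fin.sum_univ_succ, if_true]
    congr 1
    ring

/-- Counting ends agrees with counting edges because there are no loops. -/
theorem endCount_eq_weightAt (G : FinGraph) (σ : Fin G.m → Bool) (v : Fin G.n) :
    endCount G.src G.tgt σ v = (G.weightAt v σ : ℕ) := by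
  unfold endCount FinGraph.weightAt FinGraph.edgesAt
  simp only [Finset.filter_filter, Finset.card_filter]
  refine Finset.sum_congr rfl fun e _ => ?_
  have := G.loopless e
  by_cases h1 : G.src e = v <;> by_cases h2 : G.tgt e = v <;> by_cases h3 : σ e = true <;>
    simp_all

theorem endCount_true_eq_deg (G : FinGraph) (v : Fin G.n) :
    endCount G.src G.tgt (fun _ => true) v = G.deg v := by
  rw [endCount_eq_weightAt]
  simp [FinGraph.weightAt, FinGraph.deg]

/-- The quotient `f₀ / f₁` and the parameter of a Fibonacci function given as a list. -/
def vertexParams {K : Type} [Field K] : List K → K × K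
  | f₀ :: f₁ :: f₂ :: _ => (f₀ / f₁, (f₂ - f₀) / f₁)
  | [f₀, f₁] => (f₀ / f₁, 2)
  | _ => (1, 2)

/-- The first two values of a function given as a list. -/
def firstTwo : List ℝ → ℝ × ℝ
  | f₀ :: f₁ :: _ => (f₀, f₁)
  | [f₀] => (f₀, f₀)
  | [] => (1, 1)

/-- Downwards from the last value, `p f_i ≤ f_{i+1} = 0` forces `f_i = 0`. So a vanishing product of
last values means a vanishing partition function. -/
theorem eq_zero_of_last_eq_zero {p : ℝ} (hp : 0 < p) {d : ℕ} {f : Fin (d + 1) → ℝ}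
    (hf : (⟨d, f⟩ : SymFun ℝ) ∈ fibonacciFamilyFrom 1.17 p) (h0 : f (Fin.last d) = 0) (i) :
    f i = 0 := by
  simp only [fibonacciFamilyFrom, Set.mem_iUnion] at hf
  obtain ⟨c, -, hnn, -, hpf⟩ := hf
  induction i using Fin.reverseInduction with
  | last => exact h0
  | cast i ih =>
    have h1 := hpf i
    have h2 := hnn i.castSucc
    simp only [] at h1 h2
    rw [ih] at h1
    nlinarith

/-- The quotient and the parameter are recovered from three values. For arities `0` and `1` the
parameter is irrelevant and `2` stands in for it. -/
theorem vertexParams_spec {p : ℝ} (hp : 0 < p) {P : ℕ} (hP : 1 ≤ P) (hPp : 1 / p ≤ P) {d : ℕ}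
    {f : Fin (d + 1) → ℝ} (hf : (⟨d, f⟩ : SymFun ℝ) ∈ fibonacciFamilyFrom 1.17 p)
    (h0 : f (Fin.last d) ≠ 0) :
    117 / 100 ≤ (vertexParams (List.ofFn f)).2 ∧
      (0 ≤ (firstTwo (List.ofFn f)).1 ∧ 0 < (firstTwo (List.ofFn f)).2) ∧
      (firstTwo (List.ofFn f)).1 / (firstTwo (List.ofFn f)).2 = (vertexParams (List.ofFn f)).1 ∧
      (vertexParams (List.ofFn f)).1 ≤ P ∧
      ∀ j : Fin (d + 1),
        f j = fibSeq (vertexParams (List.ofFn f)).2 (firstTwo (List.ofFn f)) j := by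
  have hf' := hf
  simp only [fibonacciFamilyFrom, Set.mem_iUnion, Set.mem_Ici] at hf
  obtain ⟨c, hc, hnn, hfib, hpf⟩ := hf
  have hP1 : (1 : ℝ) ≤ P := by exact_mod_cast hP
  match d, f with
  | 0, f =>
    have e : List.ofFn f = [f 0] := by simp
    rw [e]
    have h1 : 0 < f 0 := lt_of_le_of_ne (hnn 0) (Ne.symm h0)
    -- No edge ever meets this vertex, so the second value is a free choice; taking it equal to `f
    -- 0` makes the quotient `1`.
    refine ⟨by norm_num [vertexParams], ⟨h1.le, h1⟩, ?_, hP1, ?_⟩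
    · simp [firstTwo, vertexParams, h1.ne']
    · intro j
      obtain rfl : j = 0 := Fin.ext (by omega)
      simp [fibSeq, firstTwo]
  | 1, f =>
    have e : List.ofFn f = [f 0, f 1] := by simp
    rw [e]
    have h1 : 0 < f 1 := lt_of_le_of_ne (hnn 1) (Ne.symm h0)
    have h2 : p * f 0 ≤ f 1 := hpf 0
    refine ⟨by norm_num [vertexParams], ⟨hnn 0, h1⟩, rfl, ?_, ?_⟩
    · refine le_trans ?_ hPp
      simp only [vertexParams]
      rw [div_le_div_iff₀ h1 hp]
      linarith
    · intro j
      fin_cases j <;> simp [fibSeq, firstTwo]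
  | d + 2, f =>
    have e : List.ofFn f =
        f 0 :: f 1 :: f 2 :: List.ofFn (fun i : Fin d => f i.succ.succ.succ) := by
      simp [List.ofFn_succ]
    have h1 : 0 < f 1 := by
      refine lt_of_le_of_ne (hnn 1) fun h => h0 ?_
      have h2 : p * f 0 ≤ f 1 := hpf 0
      have h3 : 0 ≤ f 0 := hnn 0
      have h4 : f 0 = 0 := by nlinarith
      -- Two consecutive zeros propagate upwards to the last value.
      have : ∀ n : ℕ, ∀ hn : n + 1 ≤ d + 2, f ⟨n, by omega⟩ = 0 ∧ f ⟨n + 1, by omega⟩ = 0 := by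
        intro n
        induction n with
        | zero => exact fun _ => ⟨h4, h.symm⟩
        | succ n ih =>
          intro hn
          obtain ⟨g1, g2⟩ := ih (by omega)
          refine ⟨g2, ?_⟩
          have := hfib n (by simpa using hn)
          simp only [] at this
          rw [g1, g2] at this
          simpa using this
      exact (this (d + 1) le_rfl).2
    have h2 : p * f 0 ≤ f 1 := hpf 0
    have h3 : f 2 = c * f 1 + f 0 := hfib 0 (by simp)
    have hcc : (f 2 - f 0) / f 1 = c := by rw [h3]; field_simp; ring
    rw [e]
    simp only [vertexParams, firstTwo, hcc]
    refine ⟨by norm_num at hc; linarith, ⟨hnn 0, h1⟩, trivial, ?_, ?_⟩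
    · refine le_trans ?_ hPp
      rw [div_le_div_iff₀ h1 hp]
      linarith
    · have : ∀ n : ℕ, ∀ hn : n < d + 3, f ⟨n, hn⟩ = fibSeq c (f 0, f 1) n := by
        intro n
        induction n using Nat.strong_induction_on with
        | _ n ih =>
          match n with
          | 0 => exact fun _ => rfl
          | 1 => exact fun _ => rfl
          | n + 2 =>
            intro hn
            rw [fibSeq, ← ih (n + 1) (by omega) (by omega), ← ih n (by omega) (by omega)]
            exact hfib n (by simp; omega)
      exact fun j => this j j.2

end Instance

namespace HolantInstance

variable {K : Type}

/-- The weighted edges of an instance. -/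
def edgeList (Ω : HolantInstance K) : List (Fin Ω.G.n × Fin Ω.G.n × K) :=
  List.ofFn fun e => (Ω.G.src e, Ω.G.tgt e, Ω.lam e)

variable [Field K]

def quot (Ω : HolantInstance K) (v : Fin Ω.G.n) : K := (vertexParams (List.ofFn (Ω.sig v))).1

def param (Ω : HolantInstance K) (v : Fin Ω.G.n) : K := (vertexParams (List.ofFn (Ω.sig v))).2

/-- The product of the last values of the vertex functions. -/
def topProd (Ω : HolantInstance K) : K := ∏ v, Ω.sig v (Fin.last _)

/-- The approximation to the partition function with `h` evaluated levels. -/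
def approxZ [LinearOrder K] (Ω : HolantInstance K) (P h : ℕ) : K :=
  Ω.topProd * approxProd Ω.param (levelList P h) Ω.quot Ω.edgeList

theorem Z_eq_zero_of_topProd {Ω : HolantInstance ℝ} {p : ℝ} (hp : 0 < p)
    (hΩ : Ω.IsInputOf (fibonacciFamilyFrom 1.17 p) (Set.Ici 1)) (h : Ω.topProd = 0) :
    Ω.Z = 0 := by
  obtain ⟨v, -, hv⟩ := Finset.prod_eq_zero_iff.1 h
  refine Finset.sum_eq_zero fun σ _ => ?_
  refine mul_eq_zero_of_right _ (Finset.prod_eq_zero (Finset.mem_univ v) ?_)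
  exact eq_zero_of_last_eq_zero hp (hΩ.1 v) hv _

theorem Z_nonneg {Ω : HolantInstance ℝ} {p : ℝ}
    (hΩ : Ω.IsInputOf (fibonacciFamilyFrom 1.17 p) (Set.Ici 1)) : 0 ≤ Ω.Z := by
  refine Finset.sum_nonneg fun σ _ => mul_nonneg (Finset.prod_nonneg fun e _ => ?_)
    (Finset.prod_nonneg fun v _ => ?_)
  · have : 1 ≤ Ω.lam e := hΩ.2 e
    split_ifs <;> linarith
  · have := hΩ.1 v
    simp only [fibonacciFamilyFrom, Set.mem_iUnion] at this
    obtain ⟨c, -, h, -⟩ := this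
    exact h _

theorem logClose_approxZ {Ω : HolantInstance ℝ} {p : ℝ} (hp : 0 < p) {P : ℕ} (hP : 1 ≤ P)
    (hPp : 1 / p ≤ P) (hΩ : Ω.IsInputOf (fibonacciFamilyFrom 1.17 p) (Set.Ici 1))
    (h : Ω.topProd ≠ 0) (k : ℕ) :
    LogClose (Ω.G.m * (2 * (decayRate P ^ k * defaultError P))) (Ω.approxZ P k) Ω.Z := by
  have hv : ∀ v, Ω.sig v (Fin.last _) ≠ 0 := fun v =>
    Finset.prod_ne_zero_iff.1 h v (Finset.mem_univ v)
  have H := fun v => vertexParams_spec hp hP hPp (hΩ.1 v) (hv v)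
  set F : Fin Ω.G.n → ℝ × ℝ := fun v => firstTwo (List.ofFn (Ω.sig v)) with hF
  have hZ : listZ Ω.param Ω.edgeList F = Ω.Z := by
    rw [edgeList, listZ_ofFn, Z]
    refine Finset.sum_congr rfl fun σ _ => ?_
    congr 1
    refine Finset.prod_congr rfl fun v _ => ?_
    rw [endCount_eq_weightAt]
    exact ((H v).2.2.2.2 _).symm
  have hT : topWeight Ω.param Ω.edgeList F = Ω.topProd := by
    rw [edgeList, topWeight_ofFn, topProd]
    refine Finset.prod_congr rfl fun v _ => ?_
    rw [endCount_true_eq_deg]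
    exact ((H v).2.2.2.2 (Fin.last _)).symm
  have hq : (fun v => (F v).1 / (F v).2) = Ω.quot := funext fun v => (H v).2.2.1
  have := logClose_approxProd (c := Ω.param) (es := Ω.edgeList) (F := F) hP (fun v => (H v).1) k
    (by
      intro e he
      simp only [edgeList, List.mem_ofFn] at he
      obtain ⟨i, rfl⟩ := he
      exact hΩ.2 i)
    (fun v => (H v).2.1) (fun v => by rw [(H v).2.2.1]; exact (H v).2.2.2.1)
  rw [hZ, hT, hq] at this
  simpa [approxZ, edgeList] using this

end HolantInstance

/-! ## Change of the field -/

section Map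

variable {V K : Type} [DecidableEq V]

theorem pickEdge_map {L : Type} (φ : K → L) (v : V) (es : List (V × V × K)) :
    pickEdge v (es.map (Prod.map id (Prod.map id φ))) =
      (pickEdge v es).map fun r => ((r.1.1, φ r.1.2), r.2.map (Prod.map id (Prod.map id φ))) := by
  induction es with
  | nil => rfl
  | cons e es ih =>
    obtain ⟨x, y, l⟩ := e
    simp only [List.map_cons, Prod.map_apply, id, pickEdge_cons, ih]
    split_ifs
    · rfl
    · rfl
    · simp [Option.map_map, Function.comp_def]

theorem pin_map [Field K] (φ : K →+* ℝ) (c s : V → K) (u : V) :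
    pin (φ ∘ c) (φ ∘ s) u = φ ∘ pin c s u := by
  unfold pin
  rw [Function.comp_update]
  simp

theorem vertexParams_map [Field K] (φ : K →+* ℝ) (l : List K) :
    vertexParams (l.map φ) = Prod.map φ φ (vertexParams l) := by
  match l with
  | [] => simpa [vertexParams] using (map_ofNat φ 2).symm
  | [_] => simpa [vertexParams] using (map_ofNat φ 2).symm
  | [_, _] => simpa [vertexParams] using (map_ofNat φ 2).symm
  | _ :: _ :: _ :: _ => simp [vertexParams]

theorem HolantInstance.topProd_map [Field K] (φ : K →+* ℝ) (Ω : HolantInstance K) :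
    (Ω.map φ).topProd = φ Ω.topProd := by
  rw [HolantInstance.topProd, HolantInstance.topProd, map_prod]
  rfl

theorem HolantInstance.param_map [Field K] (φ : K →+* ℝ) (Ω : HolantInstance K) :
    (Ω.map φ).param = φ ∘ Ω.param := by
  funext v
  have := congrArg Prod.snd (vertexParams_map φ (List.ofFn (Ω.sig v)))
  rw [List.map_ofFn] at this
  exact this

theorem HolantInstance.quot_map [Field K] (φ : K →+* ℝ) (Ω : HolantInstance K) :
    (Ω.map φ).quot = φ ∘ Ω.quot := by
  funext v
  have := congrArg Prod.fst (vertexParams_map φ (List.ofFn (Ω.sig v)))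
  rw [List.map_ofFn] at this
  exact this

variable [Field K] [LinearOrder K]

/-- The truncated recursion consists of field operations and a minimum, and an order embedding of
fields commutes with both. So all error estimates can be made over `ℝ`. -/
theorem approxRatio_map (φ : K →+* ℝ) (hφ : StrictMono φ) (c : V → K) (ls : List Bool)
    (s : V → K) (es : List (V × V × K)) (v : V) :
    approxRatio (φ ∘ c) ls (φ ∘ s) (es.map (Prod.map id (Prod.map id φ))) v =
      Prod.map id φ (approxRatio c ls s es v) := by
  induction ls generalizing s es v with
  | nil =>
    have h := pickEdge_map φ v es
    cases h' : pickEdge v es with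
    | none => rw [h'] at h; simp [approxRatio, h', h]
    | some r => rw [h'] at h; simp [approxRatio, h', h]
  | cons b ls ih =>
    have h := pickEdge_map φ v es
    cases h' : pickEdge v es with
    | none => rw [h'] at h; simp [approxRatio, h', h]
    | some r =>
      obtain ⟨⟨u, l⟩, rest⟩ := r
      rw [h', Option.map_some] at h
      have step : ∀ l c a b₀ b₁ : K,
          ratioStep (φ l) (φ c) (φ a) (φ b₀) (φ b₁) = φ (ratioStep l c a b₀ b₁) := by
        intro l c a b₀ b₁; simp [ratioStep]
      rw [approxRatio_some _ b ls _ h, approxRatio_some _ b ls _ h', pin_map, pin_map, ih, ih, ih]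
      simp only [Prod.map_fst, Prod.map_snd, id, Function.comp_apply, step]
      split_ifs
      · have h1 : φ (100 / 117) = 100 / 117 := by
          rw [map_div₀]; congr 1 <;> exact map_ofNat φ _
        rw [← h1, ← hφ.monotone.map_min]
        rfl
      · simp
      · simp

theorem approxProd_map (φ : K →+* ℝ) (hφ : StrictMono φ) (c : V → K) (ls : List Bool)
    (s : V → K) (es : List (V × V × K)) :
    approxProd (φ ∘ c) ls (φ ∘ s) (es.map (Prod.map id (Prod.map id φ))) =
      φ (approxProd c ls s es) := by
  induction es generalizing s with
  | nil => simp [approxProd]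
  | cons e es ih =>
    obtain ⟨x, y, l⟩ := e
    simp only [List.map_cons, Prod.map_apply, id, approxProd, pin_map, approxRatio_map φ hφ, ih]
    simp

theorem HolantInstance.approxZ_map (φ : K →+* ℝ) (hφ : StrictMono φ) (Ω : HolantInstance K)
    (P h : ℕ) : (Ω.map φ).approxZ P h = φ (Ω.approxZ P h) := by
  have he : (Ω.map φ).edgeList = Ω.edgeList.map (Prod.map id (Prod.map id φ)) := by
    simp only [HolantInstance.edgeList, List.map_ofFn]
    rfl
  unfold HolantInstance.approxZ
  rw [HolantInstance.topProd_map, map_mul, Ω.param_map, Ω.quot_map, he]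
  exact congrArg _ (approxProd_map φ hφ _ _ _ _)

end Map

/-! ## The accuracy of the approximation -/

/-- Only `1 + x ≤ exp x` is used, at `β` and at `-β`. The denominator `1 + ε` makes the upper bound
valid for every `ε > 0`, and the factor `2` makes both inequalities strict. -/
theorem relApprox_of_logClose {ε E Z z : ℝ} (hε : 0 < ε) (hE : E ≤ ε / (2 * (1 + ε)))
    (hZ : 0 ≤ Z) (h : LogClose E z Z) : RelApprox ε Z z := by
  obtain ⟨β, hβ, rfl⟩ := h
  refine ⟨fun h => by rw [h, zero_mul], fun h => ?_⟩
  have hZ' : 0 < Z := lt_of_le_of_ne hZ (Ne.symm h)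
  obtain ⟨h1, h2⟩ := abs_le.1 (hβ.trans hE)
  have h3 : ε / (2 * (1 + ε)) < ε / (1 + ε) := by
    apply div_lt_div_of_pos_left hε <;> linarith
  have h4 : ε / (1 + ε) < ε := div_lt_self hε (by linarith)
  have h5 : Real.exp β < 1 + ε := by
    have e1 := Real.add_one_le_exp (-β)
    have e2 : 1 / (1 + ε) < Real.exp (-β) := by
      have : 1 / (1 + ε) = 1 - ε / (1 + ε) := by field_simp; ring
      linarith
    rw [Real.exp_neg, ← one_div] at e2
    exact lt_of_one_div_lt_one_div (by linarith) e2
  have h6 : 1 - ε < Real.exp β := by linarith [Real.add_one_le_exp β]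
  constructor <;> nlinarith

/-! ## Evaluation with bounded cost -/

section Runs

variable {K : Type} [Field K] [LinearOrder K]

/-- `e` evaluates to `v` at cost at most `T`. -/
def Runs (w : K → ℕ) (P : Program) (env : List (Val K)) (e : Expr) (v : Val K) (T : ℕ) : Prop :=
  ∃ t, t ≤ T ∧ Eval w P env e v t

namespace Runs

variable {w : K → ℕ} {P : Program} {env : List (Val K)} {a b c d : Expr} {u v : Val K}
  {r s t : ℕ} {x y z : K}

theorem mono (h : Runs w P env a v s) (hst : s ≤ t) : Runs w P env a v t := by
  obtain ⟨k, hk, hk'⟩ := h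
  exact ⟨k, hk.trans hst, hk'⟩

theorem var {i : ℕ} (h : env[i]? = some v) : Runs w P env (.var i) v 1 := ⟨1, le_rfl, .var h⟩

theorem const (q : ℚ) (h : (q : K) = x) : Runs w P env (.const q) (.num x) 1 :=
  ⟨1, le_rfl, h ▸ .const⟩

theorem nil : Runs w P env .nil .nil 1 := ⟨1, le_rfl, .nil⟩

theorem pair (ha : Runs w P env a u s) (hb : Runs w P env b v t) :
    Runs w P env (.pair a b) (.pair u v) (s + t + 1) := by
  obtain ⟨s', hs, ha⟩ := ha
  obtain ⟨t', ht, hb⟩ := hb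
  exact ⟨_, by omega, .pair ha hb⟩

theorem fst (ha : Runs w P env a (.pair u v) s) : Runs w P env (.fst a) u (s + 1) := by
  obtain ⟨s', hs, ha⟩ := ha
  exact ⟨_, by omega, .fst ha⟩

theorem snd (ha : Runs w P env a (.pair u v) s) : Runs w P env (.snd a) v (s + 1) := by
  obtain ⟨s', hs, ha⟩ := ha
  exact ⟨_, by omega, .snd ha⟩

theorem arith {o : ArithOp} (ha : Runs w P env a (.num x) s) (hb : Runs w P env b (.num y) t)
    (hr : o.result x y z) : Runs w P env (.arith o a b) (.num z) (s + t + w x + w y + 1) := by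
  obtain ⟨s', hs, ha⟩ := ha
  obtain ⟨t', ht, hb⟩ := hb
  exact ⟨_, by omega, .arith ha hb hr⟩

theorem add (ha : Runs w P env a (.num x) s) (hb : Runs w P env b (.num y) t) :
    Runs w P env (.arith .add a b) (.num (x + y)) (s + t + w x + w y + 1) :=
  ha.arith hb rfl

theorem sub (ha : Runs w P env a (.num x) s) (hb : Runs w P env b (.num y) t) :
    Runs w P env (.arith .sub a b) (.num (x - y)) (s + t + w x + w y + 1) :=
  ha.arith hb rfl

theorem mul (ha : Runs w P env a (.num x) s) (hb : Runs w P env b (.num y) t) :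
    Runs w P env (.arith .mul a b) (.num (x * y)) (s + t + w x + w y + 1) :=
  ha.arith hb rfl

theorem div (ha : Runs w P env a (.num x) s) (hb : Runs w P env b (.num y) t) (hy : y ≠ 0) :
    Runs w P env (.arith .div a b) (.num (x / y)) (s + t + w x + w y + 1) :=
  ha.arith hb ⟨hy, rfl⟩

theorem letIn (ha : Runs w P env a u s) (hb : Runs w P (u :: env) b v t) :
    Runs w P env (.letIn a b) v (s + t + 1) := by
  obtain ⟨s', hs, ha⟩ := ha
  obtain ⟨t', ht, hb⟩ := hb
  exact ⟨_, by omega, .letIn ha hb⟩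

theorem ifNil_pos (ha : Runs w P env a .nil s) (hb : Runs w P env b v t) :
    Runs w P env (.ifNil a b c) v (s + t + 1) := by
  obtain ⟨s', hs, ha⟩ := ha
  obtain ⟨t', ht, hb⟩ := hb
  exact ⟨_, by omega, .ifNil_pos ha hb⟩

theorem ifNil_neg {u' : Val K} (ha : Runs w P env a (.pair u u') s) (hc : Runs w P env c v t) :
    Runs w P env (.ifNil a b c) v (s + t + 1) := by
  obtain ⟨s', hs, ha⟩ := ha
  obtain ⟨t', ht, hc⟩ := hc
  exact ⟨_, by omega, .ifNil_neg ha (by simp) hc⟩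

theorem ifLt_pos (ha : Runs w P env a (.num x) s) (hb : Runs w P env b (.num y) t) (h : x < y)
    (hc : Runs w P env c v r) :
    Runs w P env (.ifLt a b c d) v (s + t + r + w x + w y + 1) := by
  obtain ⟨s', hs, ha⟩ := ha
  obtain ⟨t', ht, hb⟩ := hb
  obtain ⟨r', hr, hc⟩ := hc
  exact ⟨_, by omega, .ifLt_pos ha hb h hc⟩

theorem ifLt_neg (ha : Runs w P env a (.num x) s) (hb : Runs w P env b (.num y) t) (h : ¬ x < y)
    (hd : Runs w P env d v r) :
    Runs w P env (.ifLt a b c d) v (s + t + r + w x + w y + 1) := by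
  obtain ⟨s', hs, ha⟩ := ha
  obtain ⟨t', ht, hb⟩ := hb
  obtain ⟨r', hr, hd⟩ := hd
  exact ⟨_, by omega, .ifLt_neg ha hb h hd⟩

theorem call {f : ℕ} (ha : Runs w P env a u s) (hf : P[f]? = some b) (hb : Runs w P [u] b v t) :
    Runs w P env (.call f a) v (s + t + 1) := by
  obtain ⟨s', hs, ha⟩ := ha
  obtain ⟨t', ht, hb⟩ := hb
  exact ⟨_, by omega, .call ha hf hb⟩

end Runs

/-- Comparison of two numbers for equality. -/
def Expr.ifEq (a b c d : Expr) : Expr := .ifLt a b d (.ifLt b a d c)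

namespace Runs

variable {w : K → ℕ} {P : Program} {env : List (Val K)} {a b c d : Expr} {v : Val K}
  {r s t : ℕ} {x y : K}

theorem ifEq_pos (ha : Runs w P env a (.num x) s) (hb : Runs w P env b (.num y) t) (h : x = y)
    (hc : Runs w P env c v r) :
    Runs w P env (.ifEq a b c d) v (2 * (s + t + w x + w y + 1) + r) :=
  (ifLt_neg ha hb (by simp [h]) (ifLt_neg hb ha (by simp [h]) hc)).mono (by omega)

theorem ifEq_neg (ha : Runs w P env a (.num x) s) (hb : Runs w P env b (.num y) t) (h : x ≠ y)
    (hd : Runs w P env d v r) :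
    Runs w P env (.ifEq a b c d) v (2 * (s + t + w x + w y + 1) + r) := by
  rcases lt_or_gt_of_ne h with h | h
  · exact (ifLt_pos ha hb h hd).mono (by omega)
  · exact (ifLt_neg ha hb (by simp [h.le]) (ifLt_pos hb ha h hd)).mono (by omega)

end Runs

end Runs

/-! ## The program -/

namespace HolantProgram

open Expr

/-- `(v, st) ↦` the pair stored under the key `v` in the association list `st`. -/
def lookupBody : Expr :=
  letIn (fst (snd (var 0)))
    (ifEq (fst (var 0)) (fst (var 1)) (snd (var 0))
      (call 1 (pair (fst (var 1)) (snd (snd (var 1))))))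

/-- `(v, es) ↦ pickEdge v es`. -/
def pickBody : Expr :=
  ifNil (snd (var 0)) nil
    (letIn (fst (snd (var 0)))
      (ifEq (fst (var 0)) (fst (var 1)) (pair (snd (var 0)) (snd (snd (var 1))))
        (ifEq (fst (snd (var 0))) (fst (var 1))
          (pair (pair (fst (var 0)) (snd (snd (var 0)))) (snd (snd (var 1))))
          (letIn (call 2 (pair (fst (var 1)) (snd (snd (var 1)))))
            (ifNil (var 0) nil (pair (fst (var 0)) (pair (var 1) (snd (var 0)))))))))

/-- `(v, st) ↦` the state after the value `1` has been given to an edge at `v`. -/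
def pinBody : Expr :=
  letIn (call 1 (var 0))
    (pair (pair (fst (var 1))
      (pair (arith .div (const 1) (arith .add (snd (var 0)) (fst (var 0)))) (snd (var 0))))
      (snd (var 1)))

/-- The last step of the truncated recursion.  The environment holds the flag, the result of
`ratioStep`, and further on the state of the vertex (6) and the arguments (8). -/
def finishRatio : Expr :=
  ifNil (var 0) (pair nil (var 1))
    (pair (var 0) (ifNil (fst (fst (var 8))) (arith .div (const 1) (snd (var 6)))
      (ifLt (const (100 / 117)) (var 1) (const (100 / 117)) (var 1))))

/-- The recursive calls of the truncated recursion.  The environment holds the state of the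
vertex, the picked edge and the arguments. -/
def recurRatio : Expr :=
  letIn (call 4 (pair (snd (fst (var 2)))
      (pair (call 3 (pair (snd (snd (snd (var 2)))) (fst (snd (var 2)))))
        (pair (snd (var 1)) (fst (fst (var 1)))))))
    (letIn (call 4 (pair (snd (fst (var 3)))
        (pair (fst (snd (var 3))) (pair (snd (var 2)) (snd (snd (snd (var 3))))))))
      (letIn (call 4 (pair (snd (fst (var 4)))
          (pair (call 3 (pair (fst (fst (var 3))) (fst (snd (var 4)))))
            (pair (snd (var 3)) (snd (snd (snd (var 4))))))))
        (letIn (arith .div (snd (var 2)) (snd (fst (var 4))))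
          (letIn (arith .div (arith .add (const 1) (arith .mul (var 0) (snd (var 2))))
              (arith .add (snd (var 4)) (arith .add (var 0) (snd (var 1)))))
            (letIn (ifNil (fst (var 4)) (fst (var 3)) (fst (var 4)))
              finishRatio)))))

/-- `(ls, st, es, v) ↦ approxRatio`. -/
def ratioBody : Expr :=
  letIn (call 2 (pair (snd (snd (snd (var 0)))) (fst (snd (snd (var 0))))))
    (letIn (call 1 (pair (snd (snd (snd (var 1)))) (fst (snd (var 1)))))
      (ifNil (var 1) (pair nil (fst (var 0)))
        (ifNil (fst (var 2)) (pair (pair nil nil) (arith .div (const 1) (snd (var 0))))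
          recurRatio)))

/-- The product of the last entries of a list of lists. -/
def topProdBody : Expr :=
  ifNil (var 0) (const 1) (arith .mul (call 6 (fst (var 0))) (call 5 (snd (var 0))))

/-- The last entry of a list. -/
def lastBody : Expr :=
  ifNil (snd (var 0)) (fst (var 0)) (call 6 (snd (var 0)))

/-- The initial state of the vertices numbered from a given one on. -/
def initBody : Expr :=
  ifNil (snd (var 0)) nil
    (pair (pair (fst (var 0)) (call 8 (fst (snd (var 0)))))
      (call 7 (pair (arith .add (fst (var 0)) (const 1)) (snd (snd (var 0))))))

/-- `vertexParams`. -/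
def paramsBody : Expr :=
  ifNil (snd (var 0)) (pair (const 1) (const 2))
    (pair (arith .div (fst (var 0)) (fst (snd (var 0))))
      (ifNil (snd (snd (var 0))) (const 2)
        (arith .div (arith .sub (fst (snd (snd (var 0)))) (fst (var 0))) (fst (snd (var 0))))))

/-- A list of `n` copies of `nil`. -/
def lowLevels : ℕ → Expr
  | 0 => nil
  | n + 1 => pair nil (lowLevels n)

/-- The list of levels such that the error, initially the argument, gets smaller than `1`. -/
def levelsBody (n : ℕ) (κ : ℚ) : Expr :=
  ifLt (var 0) (const 1) (lowLevels n)
    (pair (pair nil nil) (call 9 (arith .mul (const κ) (var 0))))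

/-- `(t, l) ↦ t * (length l + 1)`. -/
def scaleBody : Expr :=
  ifNil (snd (var 0)) (fst (var 0))
    (arith .add (fst (var 0)) (call 10 (pair (fst (var 0)) (snd (snd (var 0))))))

/-- `(ls, st, es) ↦ approxProd`. -/
def prodBody : Expr :=
  ifNil (snd (snd (var 0))) (const 1)
    (letIn (fst (snd (snd (var 0))))
      (letIn (call 3 (pair (fst (var 0)) (fst (snd (var 1)))))
        (arith .mul
          (arith .add (snd (snd (var 1)))
            (arith .mul
              (snd (call 4 (pair (fst (var 2)) (pair (fst (snd (var 2)))
                (pair (snd (snd (snd (var 2)))) (fst (var 1)))))))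
              (snd (call 4 (pair (fst (var 2)) (pair (var 0)
                (pair (snd (snd (snd (var 2)))) (fst (snd (var 1))))))))))
          (call 11 (pair (fst (var 2)) (pair (call 3 (pair (fst (snd (var 1))) (var 0)))
            (snd (snd (snd (var 2))))))))))

def mainBody (k : ℕ) : Expr :=
  letIn (call 5 (fst (snd (var 0))))
    (ifLt (const 0) (var 0)
      (arith .mul (var 0)
        (call 11 (pair
          (call 9 (call 10 (pair
            (arith .mul (const k) (arith .add (const 1) (arith .div (const 1) (fst (var 1)))))
            (snd (snd (var 1))))))
          (pair (call 7 (pair (const 0) (fst (snd (var 1))))) (snd (snd (var 1)))))))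
      (const 0))

/-- The approximation scheme for functions with `f_i ≤ P f_{i+1}`. -/
def program (P : ℕ) : Program :=
  [mainBody (4 * defaultError P), lookupBody, pickBody, pinBody, ratioBody, topProdBody, lastBody,
    initBody, paramsBody, levelsBody (2 * P) (1 - 1 / (20 * P)), scaleBody, prodBody]

/-- A length function `w` for numbers, comparable to a measure `μ` of their size that is
subadditive, up to a constant, under the arithmetic operations. -/
structure LengthBound {K : Type} [Field K] (w μ : K → ℕ) : Prop where
  w_le : ∀ x, w x ≤ 2 * μ x
  le_w : ∀ x, μ x ≤ w x
  add_le : ∀ x y, μ (x + y) ≤ μ x + μ y + 1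
  sub_le : ∀ x y, μ (x - y) ≤ μ x + μ y + 1
  mul_le : ∀ x y, μ (x * y) ≤ μ x + μ y + 1
  div_le : ∀ x y, μ (x / y) ≤ μ x + μ y + 1

/-! ### Data of the program as trees. -/

section Encoding

variable {V K : Type}

def encEdge (key : V → K) (e : V × V × K) : Val K :=
  .pair (.num (key e.1)) (.pair (.num (key e.2.1)) (.num e.2.2))

def encEdges (key : V → K) (es : List (V × V × K)) : Val K := Val.ofList (es.map (encEdge key))

def encEntry (key : V → K) (e : V × K × K) : Val K :=
  .pair (.num (key e.1)) (.pair (.num e.2.1) (.num e.2.2))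

def encState (key : V → K) (st : List (V × K × K)) : Val K := Val.ofList (st.map (encEntry key))

def encBool (b : Bool) : Val K := if b then .pair .nil .nil else .nil

def encLevels (ls : List Bool) : Val K := Val.ofList (ls.map encBool)

def encResult (r : Bool × K) : Val K := .pair (encBool r.1) (.num r.2)

def encPick (key : V → K) : Option ((V × K) × List (V × V × K)) → Val K
  | none => .nil
  | some ((u, l), rest) => .pair (.pair (.num (key u)) (.num l)) (encEdges key rest)

variable [DecidableEq V]

/-- The entry of the association list `st` under the key `v`. -/
def findState (v : V) : List (V × K × K) → Option (K × K)
  | [] => none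
  | (u, q) :: st => if u = v then some q else findState v st

/-- The association list `st` stores the numbers `s v` and `c v` for every vertex. -/
def Represents (c s : V → K) (st : List (V × K × K)) : Prop :=
  ∀ v, findState v st = some (s v, c v)

/-- A new entry in front shadows the older one, so pinning shares the old list instead of rewriting
it. -/
theorem Represents.pin [Field K] {c s : V → K} {st : List (V × K × K)} (h : Represents c s st)
    (u : V) : Represents c (pin c s u) ((u, 1 / (c u + s u), c u) :: st) := by
  intro v
  unfold findState _root_.pin
  rcases eq_or_ne u v with rfl | huv
  · simp
  · simp [huv, Function.update_of_ne huv.symm, h v]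

end Encoding

/-! ### Correctness and cost of the elementary subroutines. -/

section Bodies

variable {V K : Type} [DecidableEq V] [Field K] [LinearOrder K] {w μ : K → ℕ} {P W : ℕ}
  {key : V → K}

theorem runs_lookup (hμ : LengthBound w μ) (hk : Function.Injective key)
    (hkW : ∀ v, μ (key v) ≤ W) {v : V} {st : List (V × K × K)} {s c : K}
    (h : findState v st = some (s, c)) :
    Runs w (program P) [.pair (.num (key v)) (encState key st)] lookupBody
      (.pair (.num s) (.num c)) (st.length * (8 * W + 40)) := by
  have hw : ∀ v, w (key v) ≤ 2 * W := fun v => (hμ.w_le _).trans (by linarith [hkW v])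
  induction st with
  | nil => simp [findState] at h
  | cons e st ih =>
    obtain ⟨u, s', c'⟩ := e
    have hu := hw u
    have hv := hw v
    rw [List.length_cons, add_mul, one_mul]
    show Runs w (program P) [.pair (.num (key v))
      (.pair (.pair (.num (key u)) (.pair (.num s') (.num c'))) (encState key st))] lookupBody _ _
    unfold findState at h
    split_ifs at h with huv
    · obtain ⟨rfl, rfl⟩ : s' = s ∧ c' = c := by simpa using h
      exact (Runs.letIn (.fst (.snd (.var rfl))) (.ifEq_pos (.fst (.var rfl)) (.fst (.var rfl))
        (by rw [huv]) (.snd (.var rfl)))).mono (by omega)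
    · exact (Runs.letIn (.fst (.snd (.var rfl))) (.ifEq_neg (.fst (.var rfl)) (.fst (.var rfl))
        (hk.ne huv) (.call (.pair (.fst (.var rfl)) (.snd (.snd (.var rfl)))) rfl (ih h)))).mono
        (by omega)

theorem runs_pick (hμ : LengthBound w μ) (hk : Function.Injective key)
    (hkW : ∀ v, μ (key v) ≤ W) (v : V) (es : List (V × V × K)) :
    Runs w (program P) [.pair (.num (key v)) (encEdges key es)] pickBody
      (encPick key (pickEdge v es)) ((es.length + 1) * (16 * W + 60)) := by
  have hw : ∀ v, w (key v) ≤ 2 * W := fun v => (hμ.w_le _).trans (by linarith [hkW v])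
  induction es with
  | nil => exact (Runs.ifNil_pos (.snd (.var rfl)) .nil).mono (by simp)
  | cons e es ih =>
    obtain ⟨x, y, l⟩ := e
    have hx := hw x
    have hy := hw y
    have hv := hw v
    rw [List.length_cons, add_mul _ 1, one_mul]
    generalize (es.length + 1) * (16 * W + 60) = T at *
    show Runs w (program P) [.pair (.num (key v)) (.pair (.pair (.num (key x))
      (.pair (.num (key y)) (.num l))) (encEdges key es))] pickBody _ _
    rw [pickEdge_cons]
    split_ifs with h1 h2
    · exact (Runs.ifNil_neg (.snd (.var rfl)) (.letIn (.fst (.snd (.var rfl)))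
        (.ifEq_pos (.fst (.var rfl)) (.fst (.var rfl)) (by rw [h1])
          (.pair (.snd (.var rfl)) (.snd (.snd (.var rfl))))))).mono (by omega)
    · exact (Runs.ifNil_neg (.snd (.var rfl)) (.letIn (.fst (.snd (.var rfl)))
        (.ifEq_neg (.fst (.var rfl)) (.fst (.var rfl)) (hk.ne h1)
          (.ifEq_pos (.fst (.snd (.var rfl))) (.fst (.var rfl)) (by rw [h2])
          (.pair (.pair (.fst (.var rfl)) (.snd (.snd (.var rfl)))) (.snd (.snd (.var rfl)))))))).mono
          (by omega)
    · cases hp : pickEdge v es with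
      | none =>
        rw [hp] at ih
        exact (Runs.ifNil_neg (.snd (.var rfl)) (.letIn (.fst (.snd (.var rfl)))
          (.ifEq_neg (.fst (.var rfl)) (.fst (.var rfl)) (hk.ne h1)
            (.ifEq_neg (.fst (.snd (.var rfl))) (.fst (.var rfl)) (hk.ne h2)
              (.letIn (.call (.pair (.fst (.var rfl)) (.snd (.snd (.var rfl)))) rfl ih)
                (.ifNil_pos (.var rfl) .nil)))))).mono (by omega)
      | some r =>
        obtain ⟨⟨u, l'⟩, rest⟩ := r
        rw [hp] at ih
        exact (Runs.ifNil_neg (.snd (.var rfl)) (.letIn (.fst (.snd (.var rfl)))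
          (.ifEq_neg (.fst (.var rfl)) (.fst (.var rfl)) (hk.ne h1)
            (.ifEq_neg (.fst (.snd (.var rfl))) (.fst (.var rfl)) (hk.ne h2)
              (.letIn (.call (.pair (.fst (.var rfl)) (.snd (.snd (.var rfl)))) rfl ih)
                (.ifNil_neg (.var rfl) (.pair (.fst (.var rfl))
                  (.pair (.var rfl) (.snd (.var rfl)))))))))).mono (by omega)

theorem runs_pin (hμ : LengthBound w μ) (hk : Function.Injective key)
    (hkW : ∀ v, μ (key v) ≤ W) (h1 : μ 1 ≤ W) {c s : V → K} {st : List (V × K × K)}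
    (hst : Represents c s st) (v : V) {U : ℕ} (hc : μ (c v) ≤ W) (hs : μ (s v) ≤ U)
    (h0 : c v + s v ≠ 0) :
    Runs w (program P) [.pair (.num (key v)) (encState key st)] pinBody
      (encState key ((v, 1 / (c v + s v), c v) :: st))
      (st.length * (8 * W + 40) + 8 * W + 4 * U + 40) := by
  have a1 := (hμ.w_le 1)
  have a2 := (hμ.w_le (c v))
  have a3 := (hμ.w_le (s v))
  have a4 := (hμ.w_le (c v + s v))
  have a5 := hμ.add_le (c v) (s v)
  exact (Runs.letIn (.call (.var rfl) rfl (runs_lookup hμ hk hkW (hst v)))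
    (.pair (.pair (.fst (.var rfl)) (.pair (.div (.const 1 Rat.cast_one)
      (.add (.snd (.var rfl)) (.fst (.var rfl))) h0) (.snd (.var rfl))))
      (.snd (.var rfl)))).mono (by omega)

theorem runs_finishRatio (hμ : LengthBound w μ) (h1 : μ 1 ≤ W) (hθ : μ (100 / 117 : K) ≤ W)
    (hθK : ((100 / 117 : ℚ) : K) = 100 / 117)
    {d b : Bool} {x c : K} {U : ℕ} (hx : μ x ≤ U) (hc : μ c ≤ W) (hc0 : c ≠ 0)
    {ls e₂ e₃ e₄ e₅ e₇ e₈ s : Val K} :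
    Runs w (program P) [encBool d, .num x, e₂, e₃, e₄, e₅, .pair s (.num c), e₇,
        .pair (.pair (encBool b) ls) e₈] finishRatio
      (encResult (if d then (true, if b then min x (100 / 117) else 1 / c) else (false, x)))
      (2 * U + 4 * W + 40) := by
  have a1 := (hμ.w_le 1)
  have a2 := (hμ.w_le c)
  have a3 := (hμ.w_le x)
  have a4 := (hμ.w_le (100 / 117))
  cases d with
  | false => exact (Runs.ifNil_pos (.var rfl) (.pair .nil (.var rfl))).mono (by omega)
  | true =>
    cases b with
    | false =>
      exact (Runs.ifNil_neg (u := .nil) (u' := .nil) (.var rfl) (.pair (.var rfl)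
        (.ifNil_pos (.fst (.fst (.var rfl))) (.div (.const 1 Rat.cast_one) (.snd (.var rfl))
          hc0)))).mono (by omega)
    | true =>
      by_cases h : 100 / 117 < x
      · simp only [if_true, min_eq_right h.le]
        exact (Runs.ifNil_neg (u := .nil) (u' := .nil) (.var rfl) (.pair (.var rfl)
          (.ifNil_neg (u := .nil) (u' := .nil) (.fst (.fst (.var rfl)))
            (.ifLt_pos (.const _ hθK) (.var rfl) h (.const _ hθK))))).mono (by omega)
      · simp only [if_true, min_eq_left (not_lt.1 h)]
        exact (Runs.ifNil_neg (u := .nil) (u' := .nil) (.var rfl) (.pair (.var rfl)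
          (.ifNil_neg (u := .nil) (u' := .nil) (.fst (.fst (.var rfl)))
            (.ifLt_neg (.const _ hθK) (.var rfl) h (.var rfl))))).mono (by omega)

end Bodies

/-- The numbers of a computation: the parameters of the vertex functions are positive, and the
names of the vertices, the parameters and the constants are of size at most `W`. -/
structure Setting {V K : Type} [Field K] [LinearOrder K] (w μ : K → ℕ) (W : ℕ) (key c : V → K) :
    Prop where
  bound : LengthBound w μ
  inj : Function.Injective key
  key_le : ∀ v, μ (key v) ≤ W
  one_le : μ 1 ≤ W
  theta_le : μ (100 / 117) ≤ W
  theta_cast : ((100 / 117 : ℚ) : K) = 100 / 117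
  param_le : ∀ v, μ (c v) ≤ W
  param_pos : ∀ v, 0 < c v

/-! ### Number lengths and running time of the truncated recursion. -/

section Ratio

variable {V K : Type} [Field K] [LinearOrder K] {w μ : K → ℕ} {P W : ℕ} {key c : V → K}

/-- The step mentions `a` twice and `b₀`, `b₁` once each, hence the factor `4`. -/
theorem ratioStep_measure (hS : Setting w μ W key c) {l a b₀ b₁ : K} (hl : μ l ≤ W) (v : V)
    {q : ℕ} (ha : μ a ≤ q) (hb₀ : μ b₀ ≤ q) (hb₁ : μ b₁ ≤ q) :
    μ (ratioStep l (c v) a b₀ b₁) ≤ 4 * q + 4 * (2 * W + 2) := by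
  unfold ratioStep
  have h1 := hS.bound.div_le (1 + a / l * b₀) (c v + (a / l + b₁))
  have h2 := hS.bound.add_le 1 (a / l * b₀)
  have h3 := hS.bound.mul_le (a / l) b₀
  have h4 := hS.bound.div_le a l
  have h5 := hS.bound.add_le (c v) (a / l + b₁)
  have h6 := hS.bound.add_le (a / l) b₁
  have := hS.one_le
  have := hS.param_le v
  omega

variable [DecidableEq V]

theorem pin_measure (hS : Setting w μ W key c) {s : V → K} {U : ℕ} (hs : ∀ v, μ (s v) ≤ U)
    (u v : V) : μ (pin c s u v) ≤ U + (2 * W + 2) := by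
  unfold pin
  rcases eq_or_ne v u with rfl | h
  · simp only [Function.update_self]
    have h1 := hS.bound.div_le 1 (c v + s v)
    have h2 := hS.bound.add_le (c v) (s v)
    have := hS.one_le
    have := hS.param_le v
    have := hs v
    omega
  · rw [Function.update_of_ne h]
    exact (hs v).trans (Nat.le_add_right _ _)

/-- Lengths grow by a constant factor per level, so they are exponential only in the depth. -/
theorem approxRatio_measure (hS : Setting w μ W key c) (ls : List Bool) {s : V → K} {U X : ℕ}
    (hs : ∀ v, μ (s v) ≤ U) {es : List (V × V × K)} (hes : ∀ e ∈ es, μ e.2.2 ≤ W)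
    (hX : U + 2 * (2 * W + 2) ≤ X) (v : V) :
    μ (approxRatio c ls s es v).2 ≤ 16 ^ ls.length * X := by
  have hdef : ∀ v, μ (1 / c v) ≤ 2 * W + 2 := fun v => by
    have h1 := hS.bound.div_le 1 (c v)
    have := hS.one_le
    have := hS.param_le v
    omega
  induction ls generalizing s es U X v with
  | nil =>
    have h1 := hs v
    have h2 := hdef v
    cases h : pickEdge v es <;> simp [approxRatio, h] at * <;> omega
  | cons b ls ih =>
    have hpow : X ≤ 16 ^ ls.length * X := Nat.le_mul_of_pos_left _ (by positivity)
    have hpow2 : 16 ^ (b :: ls).length * X = 16 * (16 ^ ls.length * X) := by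
      rw [List.length_cons, pow_succ]; ring
    rw [hpow2]
    cases h : pickEdge v es with
    | none =>
      rw [approxRatio_none c _ s h]
      have h1 := hs v
      simp only
      omega
    | some r =>
      obtain ⟨⟨u, l⟩, rest⟩ := r
      obtain ⟨h1, h2⟩ := mem_of_pickEdge h
      have hl : μ l ≤ W := by rcases h1 with h1 | h1 <;> exact hes _ h1
      have hr : ∀ e ∈ rest, μ e.2.2 ≤ W := fun e he => hes e (h2 e he)
      -- A pin lengthens the stored quotients by at most `2 W + 2`; doubling `X` absorbs this. With
      -- the factor `4` of the step this is `8`, and `16` leaves room for the remaining terms.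
      have hX' : U + (2 * W + 2) + 2 * (2 * W + 2) ≤ 2 * X := by omega
      have i1 := ih (pin_measure hS hs v) hr hX' u
      have i2 := ih (fun v => (hs v).trans (Nat.le_add_right _ (2 * W + 2))) hr hX' v
      have i3 := ih (pin_measure hS hs u) hr hX' v
      have i4 := ratioStep_measure hS hl v i1 i2 i3
      have e1 : 16 ^ ls.length * (2 * X) = 2 * (16 ^ ls.length * X) := by ring
      rw [e1] at i4
      have i5 := hdef v
      have i6 := hS.theta_le
      rw [approxRatio_some c b ls s h]
      split_ifs
      · simp only
        rcases min_choice (ratioStep l (c v) (approxRatio c ls (pin c s v) rest u).2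
          (approxRatio c ls s rest v).2 (approxRatio c ls (pin c s u) rest v).2) (100 / 117)
          with h | h <;> rw [h] <;> omega
      · simp only
        omega
      · simp only
        omega

variable [IsStrictOrderedRing K]

theorem pin_nonneg' (hS : Setting w μ W key c) {s : V → K} (hs : ∀ v, 0 ≤ s v) (u v : V) :
    0 ≤ pin c s u v := by
  unfold pin
  rcases eq_or_ne v u with rfl | h
  · simp only [Function.update_self]
    have := hS.param_pos v; have := hs v
    positivity
  · simpa [Function.update_of_ne h] using hs v

theorem approxRatio_nonneg (hS : Setting w μ W key c) (ls : List Bool) {s : V → K}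
    (hs : ∀ v, 0 ≤ s v) {es : List (V × V × K)} (hes : ∀ e ∈ es, 0 < e.2.2) (v : V) :
    0 ≤ (approxRatio c ls s es v).2 := by
  induction ls generalizing s es v with
  | nil =>
    have h1 := hs v
    have h2 := hS.param_pos v
    cases h : pickEdge v es
    · simpa [approxRatio, h] using h1
    · simpa [approxRatio, h] using h2.le
  | cons b ls ih =>
    cases h : pickEdge v es with
    | none => rw [approxRatio_none c _ s h]; exact hs v
    | some r =>
      obtain ⟨⟨u, l⟩, rest⟩ := r
      obtain ⟨h1, h2⟩ := mem_of_pickEdge h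
      have hl : 0 < l := by rcases h1 with h1 | h1 <;> exact hes _ h1
      have hr : ∀ e ∈ rest, 0 < e.2.2 := fun e he => hes e (h2 e he)
      have i1 := ih (pin_nonneg' hS hs v) hr u
      have i2 := ih hs hr v
      have i3 := ih (pin_nonneg' hS hs u) hr v
      have hc := hS.param_pos v
      have i4 : 0 ≤ ratioStep l (c v) (approxRatio c ls (pin c s v) rest u).2
          (approxRatio c ls s rest v).2 (approxRatio c ls (pin c s u) rest v).2 := by
        unfold ratioStep
        positivity
      rw [approxRatio_some c b ls s h]
      split_ifs
      · exact le_min i4 (by positivity)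
      · positivity
      · exact i4

/-- The work of one level, with the three recursive calls abstracted into hypotheses of common cost
`T`. The divisions are defined because `l` and `c` are positive and all ratios are nonnegative. -/
theorem runs_recurRatio (hS : Setting w μ W key c) {b : Bool} {ls : List Bool} {s : V → K}
    {U q T : ℕ} {st : List (V × K × K)} (hst : Represents c s st)
    (hs : ∀ v, 0 ≤ s v ∧ μ (s v) ≤ U) {es rest : List (V × V × K)}
    (hes : ∀ e ∈ rest, 0 < e.2.2) {v u : V} {l : K} (hl : μ l ≤ W) (hl0 : 0 < l)
    (h : pickEdge v es = some ((u, l), rest))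
    (ha : μ (approxRatio c ls (pin c s v) rest u).2 ≤ q)
    (hb₀ : μ (approxRatio c ls s rest v).2 ≤ q)
    (hb₁ : μ (approxRatio c ls (pin c s u) rest v).2 ≤ q)
    (ra : Runs w (program P) [.pair (encLevels ls) (.pair
      (encState key ((v, 1 / (c v + s v), c v) :: st)) (.pair (encEdges key rest) (.num (key u))))]
      ratioBody (encResult (approxRatio c ls (pin c s v) rest u)) T)
    (rb₀ : Runs w (program P) [.pair (encLevels ls) (.pair
      (encState key st) (.pair (encEdges key rest) (.num (key v))))]
      ratioBody (encResult (approxRatio c ls s rest v)) T)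
    (rb₁ : Runs w (program P) [.pair (encLevels ls) (.pair
      (encState key ((u, 1 / (c u + s u), c u) :: st)) (.pair (encEdges key rest) (.num (key v))))]
      ratioBody (encResult (approxRatio c ls (pin c s u) rest v)) T) :
    Runs w (program P) [.pair (.num (s v)) (.num (c v)),
        .pair (.pair (.num (key u)) (.num l)) (encEdges key rest),
        .pair (encLevels (b :: ls)) (.pair (encState key st)
          (.pair (encEdges key es) (.num (key v))))] recurRatio
      (encResult (approxRatio c (b :: ls) s es v))
      (3 * T + 2 * (st.length * (8 * W + 40)) + 60 * q + 100 * W + 8 * U + 400) := by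
  rw [approxRatio_some c b ls s h]
  have hμ := hS.bound
  have pa := approxRatio_nonneg hS ls (pin_nonneg' hS (fun v => (hs v).1) v) hes u
  have pb₁ := approxRatio_nonneg hS ls (pin_nonneg' hS (fun v => (hs v).1) u) hes v
  have hx := ratioStep_measure hS hl v ha hb₀ hb₁
  generalize approxRatio c ls (pin c s v) rest u = A at *
  generalize approxRatio c ls s rest v = B₀ at *
  generalize approxRatio c ls (pin c s u) rest v = B₁ at *
  obtain ⟨fa, a⟩ := A
  obtain ⟨fb, b₀⟩ := B₀
  obtain ⟨fb', b₁⟩ := B₁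
  simp only at *
  have hc := hS.param_pos v
  have hpv : c v + s v ≠ 0 := (add_pos_of_pos_of_nonneg hc (hs v).1).ne'
  have hpu : c u + s u ≠ 0 := (add_pos_of_pos_of_nonneg (hS.param_pos u) (hs u).1).ne'
  have hden : c v + (a / l + b₁) ≠ 0 := by positivity
  have pin1 := runs_pin (P := P) hμ hS.inj hS.key_le hS.one_le hst v (hS.param_le v) (hs v).2 hpv
  have pin2 := runs_pin (P := P) hμ hS.inj hS.key_le hS.one_le hst u (hS.param_le u) (hs u).2 hpu
  have flag : Runs w (program P) [.num (ratioStep l (c v) a b₀ b₁), .num (a / l),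
      encResult (fb', b₁), encResult (fb, b₀), encResult (fa, a),
      .pair (.num (s v)) (.num (c v)), .pair (.pair (.num (key u)) (.num l)) (encEdges key rest),
        .pair (encLevels (b :: ls)) (.pair (encState key st)
          (.pair (encEdges key es) (.num (key v))))]
      (.ifNil (.fst (.var 4)) (.fst (.var 3)) (.fst (.var 4))) (encBool (fa || fb)) 5 := by
    cases fa with
    | false => exact Runs.ifNil_pos (.fst (.var rfl)) (.fst (.var rfl))
    | true => exact Runs.ifNil_neg (u := .nil) (u' := .nil) (.fst (.var rfl)) (.fst (.var rfl))
  have fin := runs_finishRatio (P := P) hμ hS.one_le hS.theta_le hS.theta_cast (d := fa || fb)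
    (b := b) hx (hS.param_le v) hc.ne' (ls := encLevels ls) (e₂ := .num (a / l))
    (e₃ := encResult (fb', b₁)) (e₄ := encResult (fb, b₀)) (e₅ := encResult (fa, a))
    (e₇ := .pair (.pair (.num (key u)) (.num l)) (encEdges key rest))
    (e₈ := .pair (encState key st) (.pair (encEdges key es) (.num (key v)))) (s := .num (s v))
  have w1 := hμ.w_le a
  have w2 := hμ.w_le l
  have w3 := hμ.w_le (a / l)
  have w4 := hμ.w_le b₀
  have w5 := hμ.w_le b₁
  have w6 := hμ.w_le (c v)
  have w7 := hμ.w_le (a / l * b₀)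
  have w8 := hμ.w_le (a / l + b₁)
  have w9 := hμ.w_le 1
  have w10 := hμ.w_le (1 + a / l * b₀)
  have w11 := hμ.w_le (c v + (a / l + b₁))
  have m2 := hμ.add_le 1 (a / l * b₀)
  have m3 := hμ.mul_le (a / l) b₀
  have m4 := hμ.div_le a l
  have m5 := hμ.add_le (c v) (a / l + b₁)
  have m6 := hμ.add_le (a / l) b₁
  have n1 := hS.one_le
  have n2 := hS.param_le v
  refine (Runs.letIn (.call (.pair (.snd (.fst (.var rfl))) (.pair (.call (.pair
    (.snd (.snd (.snd (.var rfl)))) (.fst (.snd (.var rfl)))) rfl pin1)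
    (.pair (.snd (.var rfl)) (.fst (.fst (.var rfl)))))) rfl ra)
    (.letIn (.call (.pair (.snd (.fst (.var rfl))) (.pair (.fst (.snd (.var rfl)))
      (.pair (.snd (.var rfl)) (.snd (.snd (.snd (.var rfl))))))) rfl rb₀)
    (.letIn (.call (.pair (.snd (.fst (.var rfl))) (.pair (.call (.pair
      (.fst (.fst (.var rfl))) (.fst (.snd (.var rfl)))) rfl pin2)
      (.pair (.snd (.var rfl)) (.snd (.snd (.snd (.var rfl))))))) rfl rb₁)
    (.letIn (.div (.snd (.var rfl)) (.snd (.fst (.var rfl))) hl0.ne')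
    (.letIn (.div (.add (.const 1 Rat.cast_one) (.mul (.var rfl) (.snd (.var rfl))))
      (.add (.snd (.var rfl)) (.add (.var rfl) (.snd (.var rfl)))) hden)
    (.letIn flag fin)))))).mono ?_
  generalize st.length * (8 * W + 40) = Y at *
  omega

/-- Three calls, each with `X` doubled, multiply the cost by `6`; the factor `64` per level also
pays for lookups and arithmetic, whose operands grow at most like `16 ^ n`. -/
theorem runs_ratio (hS : Setting w μ W key c) (ls : List Bool) {s : V → K} {U X : ℕ}
    {st : List (V × K × K)} (hst : Represents c s st) (hs : ∀ v, 0 ≤ s v ∧ μ (s v) ≤ U)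
    {es : List (V × V × K)} (hes : ∀ e ∈ es, 0 < e.2.2 ∧ μ e.2.2 ≤ W)
    (hX : st.length + es.length + U + 2 * (2 * W + 2) ≤ X) (v : V) :
    Runs w (program P) [.pair (encLevels ls) (.pair (encState key st)
      (.pair (encEdges key es) (.num (key v))))] ratioBody (encResult (approxRatio c ls s es v))
      (1000 * 64 ^ ls.length * ((W + 1) * X)) := by
  induction ls generalizing s U X st es v with
  | nil =>
    have hpick := runs_pick (P := P) hS.bound hS.inj hS.key_le v es
    have hlook := runs_lookup (P := P) hS.bound hS.inj hS.key_le (hst v)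
    have b1 : (es.length + 1) * (16 * W + 60) ≤ X * (60 * (W + 1)) :=
      Nat.mul_le_mul (by omega) (by omega)
    have b2 : st.length * (8 * W + 40) ≤ X * (40 * (W + 1)) :=
      Nat.mul_le_mul (by omega) (by omega)
    have b3 : 4 * (W + 1) ≤ (W + 1) * X := by nlinarith
    have e1 : X * (60 * (W + 1)) = 60 * ((W + 1) * X) := by ring
    have e2 : X * (40 * (W + 1)) = 40 * ((W + 1) * X) := by ring
    rw [e1] at b1
    rw [e2] at b2
    rw [List.length_nil, pow_zero, mul_one]
    have n1 := hS.one_le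
    have n2 := hS.param_le v
    have w1 := hS.bound.w_le 1
    have w2 := hS.bound.w_le (c v)
    cases h : pickEdge v es with
    | none =>
      rw [h] at hpick
      rw [approxRatio_none c _ s h]
      exact (Runs.letIn (.call (.pair (.snd (.snd (.snd (.var rfl)))) (.fst (.snd (.snd (.var rfl)))))
        rfl hpick) (.letIn (.call (.pair (.snd (.snd (.snd (.var rfl)))) (.fst (.snd (.var rfl)))) rfl
        hlook) (.ifNil_pos (.var rfl) (.pair .nil (.fst (.var rfl)))))).mono (by omega)
    | some r =>
      obtain ⟨⟨u, l⟩, rest⟩ := r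
      rw [h] at hpick
      have e : approxRatio c [] s es v = (true, 1 / c v) := by simp [approxRatio, h]
      rw [e]
      exact (Runs.letIn (.call (.pair (.snd (.snd (.snd (.var rfl)))) (.fst (.snd (.snd (.var rfl)))))
        rfl hpick) (.letIn (.call (.pair (.snd (.snd (.snd (.var rfl)))) (.fst (.snd (.var rfl)))) rfl
        hlook) (.ifNil_neg (.var rfl) (.ifNil_pos (.fst (.var rfl)) (.pair (.pair .nil .nil)
          (.div (.const 1 Rat.cast_one) (.snd (.var rfl)) (hS.param_pos v).ne')))))).mono (by omega)
  | cons b ls ih =>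
    have hpick := runs_pick (P := P) hS.bound hS.inj hS.key_le v es
    have hlook := runs_lookup (P := P) hS.bound hS.inj hS.key_le (hst v)
    have b1 : (es.length + 1) * (16 * W + 60) ≤ X * (60 * (W + 1)) :=
      Nat.mul_le_mul (by omega) (by omega)
    have b2 : st.length * (8 * W + 40) ≤ X * (40 * (W + 1)) :=
      Nat.mul_le_mul (by omega) (by omega)
    have b3 : 4 * (W + 1) ≤ (W + 1) * X := by nlinarith
    have b4 : X ≤ (W + 1) * X := Nat.le_mul_of_pos_left _ (by omega)
    have e1 : X * (60 * (W + 1)) = 60 * ((W + 1) * X) := by ring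
    have e2 : X * (40 * (W + 1)) = 40 * ((W + 1) * X) := by ring
    rw [e1] at b1
    rw [e2] at b2
    have e3 : 1000 * 64 ^ (b :: ls).length * ((W + 1) * X) =
        64000 * (64 ^ ls.length * ((W + 1) * X)) := by
      rw [List.length_cons, pow_succ]; ring
    have b5 : (W + 1) * X ≤ 64 ^ ls.length * ((W + 1) * X) :=
      Nat.le_mul_of_pos_left _ (by positivity)
    rw [e3]
    cases h : pickEdge v es with
    | none =>
      rw [h] at hpick
      rw [approxRatio_none c _ s h]
      exact (Runs.letIn (.call (.pair (.snd (.snd (.snd (.var rfl)))) (.fst (.snd (.snd (.var rfl)))))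
        rfl hpick) (.letIn (.call (.pair (.snd (.snd (.snd (.var rfl)))) (.fst (.snd (.var rfl)))) rfl
        hlook) (.ifNil_pos (.var rfl) (.pair .nil (.fst (.var rfl)))))).mono (by omega)
    | some r =>
      obtain ⟨⟨u, l⟩, rest⟩ := r
      rw [h] at hpick
      obtain ⟨h1, h2⟩ := mem_of_pickEdge h
      have hlen := length_of_pickEdge h
      have hl : 0 < l ∧ μ l ≤ W := by rcases h1 with h1 | h1 <;> exact hes _ h1
      have hr : ∀ e ∈ rest, 0 < e.2.2 ∧ μ e.2.2 ≤ W := fun e he => hes e (h2 e he)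
      have hX' : (st.length + 1) + rest.length + (U + (2 * W + 2)) + 2 * (2 * W + 2) ≤ 2 * X := by
        omega
      have hpin : ∀ u v, 0 ≤ pin c s u v ∧ μ (pin c s u v) ≤ U + (2 * W + 2) := fun u v =>
        ⟨pin_nonneg' hS (fun v => (hs v).1) u v, pin_measure hS (fun v => (hs v).2) u v⟩
      have hs' : ∀ v, 0 ≤ s v ∧ μ (s v) ≤ U + (2 * W + 2) := fun v =>
        ⟨(hs v).1, (hs v).2.trans (Nat.le_add_right _ _)⟩
      have hU : U + (2 * W + 2) + 2 * (2 * W + 2) ≤ 2 * X := by omega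
      have hr2 : ∀ e ∈ rest, μ e.2.2 ≤ W := fun e he => (hr e he).2
      have main := runs_recurRatio (b := b) hS hst hs (fun e he => (hr e he).1) hl.2 hl.1 h
        (approxRatio_measure hS ls (fun w => (hpin v w).2) hr2 hU u)
        (approxRatio_measure hS ls (fun w => (hs' w).2) hr2 hU v)
        (approxRatio_measure hS ls (fun w => (hpin u w).2) hr2 hU v)
        (ih (hst.pin v) (hpin v) hr hX' u)
        (ih hst hs' hr (by omega) v)
        (ih (hst.pin u) (hpin u) hr hX' v)
      refine (Runs.letIn (.call (.pair (.snd (.snd (.snd (.var rfl)))) (.fst (.snd (.snd (.var rfl)))))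
        rfl hpick) (.letIn (.call (.pair (.snd (.snd (.snd (.var rfl)))) (.fst (.snd (.var rfl)))) rfl
        hlook) (.ifNil_neg (.var rfl) (.ifNil_neg (.fst (.var rfl)) main)))).mono ?_
      have q1 : 16 ^ ls.length * (2 * X) ≤ 2 * (64 ^ ls.length * ((W + 1) * X)) := by
        have : 16 ^ ls.length ≤ 64 ^ ls.length := Nat.pow_le_pow_left (by norm_num) _
        calc 16 ^ ls.length * (2 * X) ≤ 64 ^ ls.length * (2 * ((W + 1) * X)) :=
              Nat.mul_le_mul this (by omega)
          _ = _ := by ring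
      have q2 : 1000 * 64 ^ ls.length * ((W + 1) * (2 * X)) =
          2000 * (64 ^ ls.length * ((W + 1) * X)) := by ring
      rw [q2]
      omega

end Ratio

/-! ### The product over the edges. -/

section Product

variable {V K : Type} [DecidableEq V] [Field K] [LinearOrder K] {w μ : K → ℕ} {P W : ℕ}
  {key c : V → K}

/-- Along the product the pins accumulate: two per edge, each lengthening the quotients by at most
`2 W + 2`. Growth is linear in the number of edges here, not exponential. -/
theorem approxProd_measure (hS : Setting w μ W key c) (ls : List Bool) {s : V → K} {U X : ℕ}
    (hs : ∀ v, μ (s v) ≤ U) {es : List (V × V × K)} (hes : ∀ e ∈ es, μ e.2.2 ≤ W)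
    (hX : es.length * (2 * (2 * W + 2)) + U + 2 * (2 * W + 2) ≤ X) :
    μ (approxProd c ls s es) ≤ es.length * (2 * (16 ^ ls.length * X) + W + 3) + W := by
  induction es generalizing s U with
  | nil => simpa [approxProd] using hS.one_le
  | cons e es ih =>
    obtain ⟨x, y, l⟩ := e
    rw [List.length_cons, add_mul, one_mul] at hX
    have hl : μ l ≤ W := hes (x, y, l) (by simp)
    have hr : ∀ e ∈ es, μ e.2.2 ≤ W := fun e he => hes e (List.mem_cons_of_mem _ he)
    have h1 := ih (pin_measure hS (pin_measure hS hs x) y) hr (by omega)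
    have h2 := approxRatio_measure hS ls hs hr (X := X) (by omega) x
    have h3 := approxRatio_measure hS ls (pin_measure hS hs x) hr (X := X) (by omega) y
    rw [approxProd, List.length_cons, Nat.add_one_mul es.length]
    have m1 := hS.bound.mul_le (l + (approxRatio c ls s es x).2 *
      (approxRatio c ls (pin c s x) es y).2) (approxProd c ls (pin c (pin c s x) y) es)
    have m2 := hS.bound.add_le l ((approxRatio c ls s es x).2 *
      (approxRatio c ls (pin c s x) es y).2)
    have m3 := hS.bound.mul_le (approxRatio c ls s es x).2 (approxRatio c ls (pin c s x) es y).2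
    omega

theorem runs_prod [IsStrictOrderedRing K] (hS : Setting w μ W key c) (ls : List Bool)
    {s : V → K} {U X M : ℕ} {st : List (V × K × K)} (hst : Represents c s st)
    (hs : ∀ v, 0 ≤ s v ∧ μ (s v) ≤ U) {es : List (V × V × K)}
    (hes : ∀ e ∈ es, 0 < e.2.2 ∧ μ e.2.2 ≤ W)
    (hX : st.length + es.length * (2 * (2 * W + 2) + 3) + U + 2 * (2 * W + 2) ≤ X)
    (hM : es.length * (2 * (16 ^ ls.length * X) + W + 3) + W ≤ M) :
    Runs w (program P) [.pair (encLevels ls) (.pair (encState key st) (encEdges key es))]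
      prodBody (.num (approxProd c ls s es))
      (es.length * (4000 * (64 ^ ls.length * ((W + 1) * X)) + 2 * M) + 10) := by
  induction es generalizing s U st with
  | nil => exact (Runs.ifNil_pos (.snd (.snd (.var rfl))) (.const 1 Rat.cast_one)).mono (by simp)
  | cons e es ih =>
    obtain ⟨x, y, l⟩ := e
    rw [List.length_cons, add_mul, one_mul] at hX hM
    have hl : 0 < l ∧ μ l ≤ W := hes (x, y, l) (by simp)
    have hr : ∀ e ∈ es, 0 < e.2.2 ∧ μ e.2.2 ≤ W := fun e he => hes e (List.mem_cons_of_mem _ he)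
    have hr2 : ∀ e ∈ es, μ e.2.2 ≤ W := fun e he => (hr e he).2
    have hpin : ∀ {s : V → K} {U : ℕ}, (∀ v, 0 ≤ s v ∧ μ (s v) ≤ U) →
        ∀ u v, 0 ≤ pin c s u v ∧ μ (pin c s u v) ≤ U + (2 * W + 2) := fun hs u v =>
      ⟨pin_nonneg' hS (fun v => (hs v).1) u v, pin_measure hS (fun v => (hs v).2) u v⟩
    have hsx := hpin hs x
    have hsy := hpin hsx y
    have hlen : es.length ≤ es.length * (2 * (2 * W + 2) + 3) :=
      Nat.le_mul_of_pos_right _ (by omega)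
    have hlen' : es.length * (2 * (2 * W + 2)) ≤ es.length * (2 * (2 * W + 2) + 3) :=
      Nat.mul_le_mul_left _ (by omega)
    have h1 := ih ((hst.pin x).pin y) hsy hr (by simp only [List.length_cons]; omega) (by omega)
    have h2 := approxRatio_measure hS ls (fun v => (hs v).2) hr2 (X := X) (by omega) x
    have h3 := approxRatio_measure hS ls (fun v => (hsx v).2) hr2 (X := X) (by omega) y
    have h4 := approxProd_measure hS ls (fun v => (hsy v).2) hr2 (X := X) (by omega)
    have r1 := runs_ratio (P := P) hS ls hst hs hr (X := X) (by omega) x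
    have r2 := runs_ratio (P := P) hS ls (hst.pin x) hsx hr (X := X)
      (by simp only [List.length_cons]; omega) y
    have p1 := runs_pin (P := P) hS.bound hS.inj hS.key_le hS.one_le hst x (hS.param_le x) (hs x).2
      (add_pos_of_pos_of_nonneg (hS.param_pos x) (hs x).1).ne'
    have p2 := runs_pin (P := P) hS.bound hS.inj hS.key_le hS.one_le (hst.pin x) y (hS.param_le y)
      (hsx y).2 (add_pos_of_pos_of_nonneg (hS.param_pos y) (hsx y).1).ne'
    rw [approxProd]
    generalize hA : approxRatio c ls s es x = A at *
    generalize hB : approxRatio c ls (pin c s x) es y = B at *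
    generalize hC : approxProd c ls (pin c (pin c s x) y) es = C at *
    obtain ⟨fa, a⟩ := A
    obtain ⟨fb, b⟩ := B
    simp only at *
    have m1 := hS.bound.add_le l (a * b)
    have m2 := hS.bound.mul_le a b
    have w1 := hS.bound.w_le l
    have w2 := hS.bound.w_le a
    have w3 := hS.bound.w_le b
    have w4 := hS.bound.w_le (a * b)
    have w5 := hS.bound.w_le (l + a * b)
    have w6 := hS.bound.w_le C
    refine (Runs.ifNil_neg (.snd (.snd (.var rfl))) (.letIn (.fst (.snd (.snd (.var rfl))))
      (.letIn (.call (.pair (.fst (.var rfl)) (.fst (.snd (.var rfl)))) rfl p1)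
      (.mul (.add (.snd (.snd (.var rfl))) (.mul
        (.snd (.call (.pair (.fst (.var rfl)) (.pair (.fst (.snd (.var rfl)))
          (.pair (.snd (.snd (.snd (.var rfl)))) (.fst (.var rfl))))) rfl r1))
        (.snd (.call (.pair (.fst (.var rfl)) (.pair (.var rfl)
          (.pair (.snd (.snd (.snd (.var rfl)))) (.fst (.snd (.var rfl)))))) rfl r2))))
        (.call (.pair (.fst (.var rfl)) (.pair (.call (.pair (.fst (.snd (.var rfl))) (.var rfl))
          rfl p2) (.snd (.snd (.snd (.var rfl)))))) rfl h1))))).mono ?_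
    have e1 : 1000 * 64 ^ ls.length * ((W + 1) * X) = 1000 * (64 ^ ls.length * ((W + 1) * X)) := by
      ring
    have b0 : (W + 1) * X ≤ 64 ^ ls.length * ((W + 1) * X) :=
      Nat.le_mul_of_pos_left _ (by positivity)
    have b1 : st.length * (8 * W + 40) ≤ X * (40 * (W + 1)) :=
      Nat.mul_le_mul (by omega) (by omega)
    have b2 : (st.length + 1) * (8 * W + 40) ≤ X * (40 * (W + 1)) :=
      Nat.mul_le_mul (by omega) (by omega)
    have b3 : 4 * (W + 1) ≤ (W + 1) * X := by nlinarith
    have b4 : X ≤ (W + 1) * X := Nat.le_mul_of_pos_left _ (by omega)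
    have e2 : X * (40 * (W + 1)) = 40 * ((W + 1) * X) := by ring
    have b5 : 16 ^ ls.length * X ≤ 64 ^ ls.length * ((W + 1) * X) :=
      Nat.mul_le_mul (Nat.pow_le_pow_left (by norm_num) _) b4
    rw [e2] at b1 b2
    simp only [List.length_cons]
    rw [e1, Nat.add_one_mul es.length]
    generalize 64 ^ ls.length * ((W + 1) * X) = G at *
    generalize es.length * (4000 * G + 2 * M) = H at *
    omega

end Product

/-! ### Preprocessing: last values, vertex parameters, the list of levels. -/

section Lists

theorem getLastD_measure {K : Type} {μ : K → ℕ} {W : ℕ} {a : K} {l : List K} (ha : μ a ≤ W)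
    (h : ∀ x ∈ l, μ x ≤ W) :
    μ (l.getLastD a) ≤ W := by
  rw [List.getLastD_eq_getLast?]
  cases h' : l.getLast? with
  | none => simpa
  | some b => simpa using h b (List.mem_of_getLast? h')

theorem vertexParams_measure {K : Type} [Field K] {w μ : K → ℕ} {W : ℕ}
    (hμ : LengthBound w μ) (h1 : μ 1 ≤ W) (h2 : μ 2 ≤ W) {l : List K}
    (hW : ∀ x ∈ l, μ x ≤ W) :
    μ (vertexParams l).1 ≤ 2 * W + 1 ∧ μ (vertexParams l).2 ≤ 3 * W + 2 := by
  match l with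
  | [] => simp only [vertexParams]; omega
  | [a] => simp only [vertexParams]; omega
  | [a, b] =>
    have ma := hW a (by simp)
    have mb := hW b (by simp)
    have := hμ.div_le a b
    simp only [vertexParams]
    omega
  | a :: b :: d :: l =>
    have ma := hW a (by simp)
    have mb := hW b (by simp)
    have md := hW d (by simp)
    have := hμ.div_le a b
    have := hμ.div_le (d - a) b
    have := hμ.sub_le d a
    simp only [vertexParams]
    omega

variable {V K : Type} [Field K] [LinearOrder K] {w μ : K → ℕ} {P W M : ℕ}

def encList (l : List K) : Val K := Val.ofList (l.map .num)

def encLists (L : List (List K)) : Val K := Val.ofList (L.map encList)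

theorem runs_last (a : K) (l : List K) :
    Runs w (program P) [encList (a :: l)] lastBody (.num (l.getLastD a)) (10 * (l.length + 1)) := by
  induction l generalizing a with
  | nil => exact (Runs.ifNil_pos (.snd (.var rfl)) (.fst (.var rfl))).mono (by simp)
  | cons b l ih =>
    rw [List.getLastD_cons]
    exact Runs.mono (.ifNil_neg (.snd (.var rfl)) (.call (.snd (.var rfl)) rfl (ih b)))
      (by rw [List.length_cons]; omega)

theorem runs_topProd (hμ : LengthBound w μ) (h1 : μ 1 ≤ W) {B : ℕ} {L : List (List K)}
    (hL : ∀ l ∈ L, l ≠ [] ∧ l.length ≤ B ∧ ∀ x ∈ l, μ x ≤ W) (hM : L.length * (W + 1) + W ≤ M) :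
    μ (L.map fun l => l.getLastD 0).prod ≤ L.length * (W + 1) + W ∧
    Runs w (program P) [encLists L] topProdBody (.num (L.map fun l => l.getLastD 0).prod)
      ((L.length + 1) * (10 * B + 2 * W + 2 * M + 20)) := by
  induction L with
  | nil =>
    refine ⟨by simpa using h1, ?_⟩
    exact (Runs.ifNil_pos (.var rfl) (.const 1 Rat.cast_one)).mono (by simp)
  | cons l L ih =>
    rw [List.length_cons, add_mul, one_mul] at hM
    obtain ⟨i1, i2⟩ := ih (fun l hl => hL l (List.mem_cons_of_mem _ hl)) (by omega)
    obtain ⟨hl, hB, hW⟩ := hL l (by simp)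
    obtain ⟨a, l, rfl⟩ := List.exists_cons_of_ne_nil hl
    have e1 : (a :: l).getLastD 0 = l.getLastD a := List.getLastD_cons ..
    have hm : μ (l.getLastD a) ≤ W :=
      getLastD_measure (hW a (by simp)) fun x hx => hW x (List.mem_cons_of_mem _ hx)
    rw [List.map_cons, List.prod_cons, e1, List.length_cons, Nat.add_one_mul L.length,
      Nat.add_one_mul (L.length + 1)]
    generalize (L.map fun l => l.getLastD 0).prod = p at *
    have m1 := hμ.mul_le (l.getLastD a) p
    have w1 := hμ.w_le (l.getLastD a)
    have w2 := hμ.w_le p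
    refine ⟨by omega, ?_⟩
    refine (Runs.ifNil_neg (.var rfl) (.mul (.call (.fst (.var rfl)) rfl (runs_last a l))
      (.call (.snd (.var rfl)) rfl i2))).mono ?_
    rw [List.length_cons] at hB
    omega

theorem runs_params (hμ : LengthBound w μ) {l : List K} (hl : l ≠ []) (hW : ∀ x ∈ l, μ x ≤ W)
    (h0 : ∀ a b l', l = a :: b :: l' → b ≠ 0) :
    Runs w (program P) [encList l] paramsBody
      (.pair (.num (vertexParams l).1) (.num (vertexParams l).2)) (20 * W + 50) := by
  have hw : ∀ x ∈ l, w x ≤ 2 * W := fun x hx => (hμ.w_le x).trans (by linarith [hW x hx])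
  match l with
  | [] => exact absurd rfl hl
  | [a] =>
    exact (Runs.ifNil_pos (.snd (.var rfl)) (.pair (.const 1 Rat.cast_one)
      (.const 2 (Rat.cast_ofNat _)))).mono (by omega)
  | [a, b] =>
    have wa := hw a (by simp)
    have wb := hw b (by simp)
    exact (Runs.ifNil_neg (.snd (.var rfl)) (.pair (.div (.fst (.var rfl)) (.fst (.snd (.var rfl)))
      (h0 a b [] rfl)) (.ifNil_pos (.snd (.snd (.var rfl))) (.const 2 (Rat.cast_ofNat _))))).mono
      (by omega)
  | a :: b :: d :: l =>
    have wa := hw a (by simp)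
    have wb := hw b (by simp)
    have wd := hw d (by simp)
    have ma := hW a (by simp)
    have md := hW d (by simp)
    have m1 := hμ.sub_le d a
    have w1 := hμ.w_le (d - a)
    exact (Runs.ifNil_neg (.snd (.var rfl)) (.pair (.div (.fst (.var rfl)) (.fst (.snd (.var rfl)))
      (h0 a b _ rfl)) (.ifNil_neg (.snd (.snd (.var rfl)))
        (.div (.sub (.fst (.snd (.snd (.var rfl)))) (.fst (.var rfl))) (.fst (.snd (.var rfl)))
          (h0 a b _ rfl))))).mono
      (by omega)

/-- The vertices of the list have consecutive names, starting with `i`. -/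
def Consecutive (key : V → K) : K → List (V × List K) → Prop
  | _, [] => True
  | i, (v, _) :: L => key v = i ∧ Consecutive key (i + 1) L

theorem runs_init (hμ : LengthBound w μ) {key : V → K} (hkey : ∀ v, μ (key v) ≤ W)
    (h1 : μ 1 ≤ W) {i : K} {L : List (V × List K)} (hc : Consecutive key i L)
    (hi : μ i + L.length * (W + 1) ≤ M)
    (hL : ∀ e ∈ L, e.2 ≠ [] ∧ (∀ x ∈ e.2, μ x ≤ W) ∧ ∀ a b l', e.2 = a :: b :: l' → b ≠ 0) :
    Runs w (program P) [.pair (.num i) (encLists (L.map Prod.snd))] initBody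
      (encState key (L.map fun e => (e.1, (vertexParams e.2).1, (vertexParams e.2).2)))
      ((L.length + 1) * (22 * W + 2 * M + 80)) := by
  induction L generalizing i with
  | nil => exact (Runs.ifNil_pos (.snd (.var rfl)) .nil).mono (by simp)
  | cons e L ih =>
    obtain ⟨v, l⟩ := e
    obtain ⟨rfl, hc⟩ := hc
    rw [List.length_cons, add_mul, one_mul] at hi
    have m1 := hμ.add_le (key v) 1
    have m2 := hkey v
    have w1 := hμ.w_le (key v)
    have w2 := hμ.w_le 1
    have r1 := ih hc (by omega) fun e he => hL e (List.mem_cons_of_mem _ he)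
    obtain ⟨hl, hW, h0⟩ := hL (v, l) (by simp)
    have r2 := runs_params (P := P) hμ hl hW h0
    refine (Runs.ifNil_neg (.snd (.var rfl)) (.pair (.pair (.fst (.var rfl))
      (.call (.fst (.snd (.var rfl))) rfl r2)) (.call (.pair (.add (.fst (.var rfl))
        (.const 1 Rat.cast_one)) (.snd (.snd (.var rfl)))) rfl r1))).mono ?_
    rw [List.length_cons, Nat.add_one_mul (L.length + 1)]
    omega

theorem runs_lowLevels (env : List (Val K)) (n : ℕ) :
    Runs w (program P) env (lowLevels n) (encLevels (List.replicate n false)) (2 * n + 1) := by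
  induction n with
  | zero => exact Runs.nil
  | succ n ih => exact (Runs.pair .nil ih).mono (by omega)

/-- The depth is found without logarithms: the target is multiplied by the rate until it drops below
`1`, and each multiplication emits one level. -/
theorem runs_levels (hμ : LengthBound w μ) (h1 : μ 1 ≤ W) {κ : K}
    (hκ : ((1 - 1 / (20 * P) : ℚ) : K) = κ) (hκW : μ κ ≤ W) {t : K} (h : ℕ)
    (ht : μ t + h * (W + 1) ≤ M) (hlt : κ ^ h * t < 1) (hge : ∀ i < h, 1 ≤ κ ^ i * t) :
    Runs w (program P) [.num t] (levelsBody (2 * P) (1 - 1 / (20 * P)))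
      (encLevels (levelList P h)) ((h + 1) * (4 * W + 4 * M + 20) + 4 * P) := by
  induction h generalizing t with
  | zero =>
    have w1 := hμ.w_le t
    have w2 := hμ.w_le 1
    rw [pow_zero, one_mul] at hlt
    have e : levelList P 0 = List.replicate (2 * P) false := by simp [levelList]
    rw [e]
    exact (Runs.ifLt_pos (.var rfl) (.const 1 Rat.cast_one) hlt (runs_lowLevels _ _)).mono
      (by omega)
  | succ h ih =>
    have w1 := hμ.w_le t
    have w2 := hμ.w_le 1
    have w3 := hμ.w_le κ
    have m1 := hμ.mul_le κ t
    rw [add_mul, one_mul] at ht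
    have r := ih (t := κ * t) (by omega) (by rw [← mul_assoc, ← pow_succ]; exact hlt)
      (fun i hi => by rw [← mul_assoc, ← pow_succ]; exact hge (i + 1) (by omega))
    have h0 := hge 0 (by omega)
    rw [pow_zero, one_mul] at h0
    refine (Runs.ifLt_neg (.var rfl) (.const 1 Rat.cast_one) (not_lt.2 h0)
      (.pair (.pair .nil .nil) (.call (.mul (.const _ hκ) (.var rfl)) rfl r))).mono ?_
    rw [Nat.add_one_mul (h + 1)]
    omega

/-- The number of edges is available only as the length of a list, so the multiplication by `m + 1`
is done by repeated addition. -/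
theorem runs_scale (hμ : LengthBound w μ) (t : K) (l : List (Val K))
    (hM : (l.length + 1) * (μ t + 1) ≤ M) :
    μ (((l.length : K) + 1) * t) ≤ (l.length + 1) * (μ t + 1) ∧
    Runs w (program P) [.pair (.num t) (Val.ofList l)] scaleBody
      (.num (((l.length : K) + 1) * t)) ((l.length + 1) * (4 * M + 20)) := by
  induction l with
  | nil =>
    have e : ((([] : List (Val K)).length : K) + 1) * t = t := by simp
    rw [e]
    refine ⟨by simp, ?_⟩
    exact (Runs.ifNil_pos (.snd (.var rfl)) (.fst (.var rfl))).mono (by simp)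
  | cons a l ih =>
    rw [List.length_cons, Nat.add_one_mul (l.length + 1)] at hM
    obtain ⟨i1, i2⟩ := ih (by omega)
    have e : (((a :: l).length : K) + 1) * t = t + ((l.length : K) + 1) * t := by
      rw [List.length_cons]; push_cast; ring
    rw [e, List.length_cons, Nat.add_one_mul (l.length + 1), Nat.add_one_mul (l.length + 1)]
    have m1 := hμ.add_le t (((l.length : K) + 1) * t)
    have w1 := hμ.w_le t
    have w2 := hμ.w_le (((l.length : K) + 1) * t)
    refine ⟨by omega, ?_⟩
    exact Runs.mono (.ifNil_neg (.snd (.var rfl)) (.add (.fst (.var rfl)) (.call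
      (.pair (.fst (.var rfl)) (.snd (.snd (.var rfl)))) rfl i2))) (by omega)

end Lists

/-! ### The main function on an encoded instance. -/

section Main


/-- The names of the vertices in the input. -/
def vertexKey {K : Type} [Field K] (n : ℕ) (v : Fin n) : K := ((v : ℕ) : K)

theorem encode_eq {K : Type} [Field K] (Ω : HolantInstance K) (ε : K) :
    Ω.encode ε = .pair (.num ε) (.pair (encLists (List.ofFn fun v => List.ofFn (Ω.sig v)))
      (encEdges (vertexKey Ω.G.n) Ω.edgeList)) := by
  unfold HolantInstance.encode encLists encEdges HolantInstance.edgeList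
  rw [List.map_ofFn, List.map_ofFn]
  congr 3
  congr 1
  funext v
  simp only [Function.comp_apply, encList, List.map_ofFn]
  rfl

theorem getLastD_ofFn {K : Type*} {d : ℕ} (f : Fin (d + 1) → K) (a : K) :
    (List.ofFn f).getLastD a = f (Fin.last d) := by
  rw [List.ofFn_succ', List.concat_eq_append, List.getLastD_concat]

theorem prod_getLastD {K : Type} [Field K] (Ω : HolantInstance K) :
    ((List.ofFn fun v => List.ofFn (Ω.sig v)).map fun l => l.getLastD 0).prod = Ω.topProd := by
  rw [List.map_ofFn, List.prod_ofFn, HolantInstance.topProd]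
  exact Finset.prod_congr rfl fun v _ => getLastD_ofFn _ _

theorem consecutive_ofFn {K V : Type} [Field K] (key : V → K) {n : ℕ} (f : Fin n → V)
    (g : Fin n → List K)
    (i : K) (h : ∀ j : Fin n, key (f j) = i + ((j : ℕ) : K)) :
    Consecutive key i (List.ofFn fun j => (f j, g j)) := by
  induction n generalizing i with
  | zero => simp [Consecutive]
  | succ n ih =>
    rw [List.ofFn_succ]
    refine ⟨by simpa using h 0, ih _ _ _ fun j => ?_⟩
    rw [h]
    push_cast [Fin.val_succ]
    ring

theorem represents_ofFn {K : Type} {n : ℕ} (s c : Fin n → K) :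
    Represents c s (List.ofFn fun v => (v, s v, c v)) := by
  have key : ∀ (l : List (Fin n)) (v : Fin n), v ∈ l →
      findState v (l.map fun v => (v, s v, c v)) = some (s v, c v) := by
    intro l v hv
    induction l with
    | nil => simp at hv
    | cons u l ih =>
      rw [List.map_cons, findState]
      split_ifs with h
      · rw [h]
      · exact ih (by rcases List.mem_cons.1 hv with h' | h'
                     · exact absurd h'.symm h
                     · exact h')
  intro v
  have h := key (List.finRange n) v (List.mem_finRange v)
  rwa [← List.ofFn_eq_map] at h

variable {K : Type} [Field K] {w μ : K → ℕ} {P : ℕ}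

/-- All the numbers in the input are of size at most `Y`, and so are the numbers of vertices and
edges, the degrees and the lengths of the constants of the program. -/
structure InputBound (μ : K → ℕ) (P : ℕ) (Ω : HolantInstance K) (ε : K) (Y : ℕ) : Prop where
  zero_le : μ 0 ≤ Y
  one_le : μ 1 ≤ Y
  two_le : μ 2 ≤ Y
  theta_le : μ (100 / 117) ≤ Y
  rate_le : μ ((1 - 1 / (20 * P) : ℚ) : K) ≤ Y
  factor_le : μ (((4 * defaultError P : ℕ) : ℚ) : K) ≤ Y
  eps_le : μ ε ≤ Y
  sig_le : ∀ v i, μ (Ω.sig v i) ≤ Y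
  lam_le : ∀ e, μ (Ω.lam e) ≤ Y
  key_le : ∀ v, μ (vertexKey Ω.G.n v : K) ≤ Y
  n_le : Ω.G.n ≤ Y
  m_le : Ω.G.m ≤ Y
  deg_le : ∀ v, Ω.G.deg v + 1 ≤ Y

variable [LinearOrder K]

theorem runs_main_zero (hμ : LengthBound w μ) {Ω : HolantInstance K} {ε : K} {Y : ℕ}
    (hY : InputBound μ P Ω ε Y) (hY1 : 1 ≤ Y) :
    μ Ω.topProd ≤ 3 * Y ^ 2 ∧
    Runs w (program P) [encLists (List.ofFn fun v => List.ofFn (Ω.sig v))] topProdBody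
      (.num Ω.topProd) (100 * Y ^ 3) := by
  have hL : ∀ l ∈ List.ofFn fun v => List.ofFn (Ω.sig v),
      l ≠ [] ∧ l.length ≤ Y ∧ ∀ x ∈ l, μ x ≤ Y := by
    intro l hl
    simp only [List.mem_ofFn] at hl
    obtain ⟨v, rfl⟩ := hl
    refine ⟨by simp, by simpa using hY.deg_le v, ?_⟩
    intro x hx
    simp only [List.mem_ofFn] at hx
    obtain ⟨i, rfl⟩ := hx
    exact hY.sig_le v i
  have h1 : Ω.G.n * (Y + 1) + Y ≤ 3 * Y ^ 2 := by
    nlinarith [Nat.mul_le_mul_right (Y + 1) hY.n_le]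
  have h := runs_topProd (P := P) hμ hY.one_le hL (M := 3 * Y ^ 2) (by simpa using h1)
  rw [prod_getLastD, List.length_ofFn] at h
  refine ⟨h.1.trans h1, h.2.mono ?_⟩
  calc (Ω.G.n + 1) * (10 * Y + 2 * Y + 2 * (3 * Y ^ 2) + 20)
      ≤ (2 * Y) * (38 * Y ^ 2) := Nat.mul_le_mul (by linarith [hY.n_le]) (by nlinarith)
    _ = 76 * Y ^ 3 := by ring
    _ ≤ 100 * Y ^ 3 := Nat.mul_le_mul_right _ (by norm_num)

/-- The test comes before the vertex parameters are computed, so no division by a vanishing `f₁` is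
attempted. -/
theorem runs_main_of_topProd_le (hμ : LengthBound w μ) {Ω : HolantInstance K} {ε : K} {Y : ℕ}
    (hY : InputBound μ P Ω ε Y) (hY1 : 1 ≤ Y) (h0 : ¬ 0 < Ω.topProd) :
    Runs w (program P) [Ω.encode ε] (.call 0 (.var 0)) (.num 0) (200 * Y ^ 3) := by
  obtain ⟨h1, h2⟩ := runs_main_zero hμ hY hY1
  rw [encode_eq]
  have w1 := hμ.w_le 0
  have w2 := hμ.w_le Ω.topProd
  have := hY.zero_le
  have y2 : Y ^ 2 ≤ Y ^ 3 := Nat.pow_le_pow_right hY1 (by norm_num)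
  have y1 : Y ≤ Y ^ 3 := Nat.le_self_pow (by norm_num) Y
  refine Runs.mono (.call (.var rfl) rfl (b := mainBody (4 * defaultError P))
    (.letIn (.call (.fst (.snd (.var rfl))) rfl h2)
      (.ifLt_neg (.const 0 Rat.cast_zero) (.var rfl) h0 (.const 0 Rat.cast_zero)))) ?_
  omega

/-- `Y` dominates the input and also `64 ^ (h + 2 P)`, which turns all exponential bounds into
powers of `Y`. -/
theorem runs_main_of_topProd_pos [IsStrictOrderedRing K] (hμ : LengthBound w μ)
    {Ω : HolantInstance K} {ε : K} {Y h : ℕ} (hY : InputBound μ P Ω ε Y) (hY1 : 1 ≤ Y)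
    (h0 : 0 < Ω.topProd) (hε : ε ≠ 0) (hlam : ∀ e, 0 < Ω.lam e) (hc : ∀ v, 0 < Ω.param v)
    (hq : ∀ v, 0 ≤ Ω.quot v)
    (hf : ∀ v a b l, List.ofFn (Ω.sig v) = a :: b :: l → b ≠ 0)
    (hlt : ((1 - 1 / (20 * P) : ℚ) : K) ^ h *
      (((Ω.G.m : K) + 1) * ((((4 * defaultError P : ℕ) : ℚ) : K) * (1 + 1 / ε))) < 1)
    (hge : ∀ i < h, 1 ≤ ((1 - 1 / (20 * P) : ℚ) : K) ^ i *
      (((Ω.G.m : K) + 1) * ((((4 * defaultError P : ℕ) : ℚ) : K) * (1 + 1 / ε))))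
    (hpow : 64 ^ (h + 2 * P) ≤ Y) (hhY : h + 1 ≤ Y) (hPY : P ≤ Y) :
    Runs w (program P) [Ω.encode ε] (.call 0 (.var 0)) (.num (Ω.approxZ P h))
      (2000000 * Y ^ 5) := by
  obtain ⟨h1, h2⟩ := runs_main_zero hμ hY hY1
  have hsig : ∀ v, ∀ x ∈ List.ofFn (Ω.sig v), μ x ≤ Y := by
    intro v x hx
    simp only [List.mem_ofFn] at hx
    obtain ⟨i, rfl⟩ := hx
    exact hY.sig_le v i
  have hS : Setting w μ (5 * Y) (vertexKey Ω.G.n) Ω.param := by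
    refine ⟨hμ, ?_, fun v => (hY.key_le v).trans (by omega), hY.one_le.trans (by omega),
      hY.theta_le.trans (by omega), by norm_num, fun v => ?_, hc⟩
    · intro u v huv
      exact Fin.ext (Nat.cast_injective huv)
    · have := (vertexParams_measure hμ hY.one_le hY.two_le (hsig v)).2
      exact this.trans (by omega)
  have hs : ∀ v, 0 ≤ Ω.quot v ∧ μ (Ω.quot v) ≤ 5 * Y := fun v =>
    ⟨hq v, (vertexParams_measure hμ hY.one_le hY.two_le (hsig v)).1.trans (by omega)⟩
  have hes : ∀ e ∈ Ω.edgeList, 0 < e.2.2 ∧ μ e.2.2 ≤ 5 * Y := by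
    intro e he
    simp only [HolantInstance.edgeList, List.mem_ofFn] at he
    obtain ⟨i, rfl⟩ := he
    exact ⟨hlam i, (hY.lam_le i).trans (by omega)⟩
  have hm := hY.m_le
  have hn := hY.n_le
  have y12 : Y ≤ Y ^ 2 := Nat.le_self_pow (by norm_num) Y
  have y23 : Y ^ 2 ≤ Y ^ 3 := Nat.pow_le_pow_right hY1 (by norm_num)
  have y34 : Y ^ 3 ≤ Y ^ 4 := Nat.pow_le_pow_right hY1 (by norm_num)
  have y45 : Y ^ 4 ≤ Y ^ 5 := Nat.pow_le_pow_right hY1 (by norm_num)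
  have hinit : Runs w (program P)
      [.pair (.num 0) (encLists (List.ofFn fun v => List.ofFn (Ω.sig v)))] initBody
      (encState (vertexKey Ω.G.n) (List.ofFn fun v => (v, Ω.quot v, Ω.param v)))
      (400 * Y ^ 3) := by
    have b1 : Y + Ω.G.n * (Y + 1) ≤ 3 * Y ^ 2 := by
      nlinarith [Nat.mul_le_mul_right (Y + 1) hn]
    have := runs_init (P := P) (W := Y) (M := 3 * Y ^ 2) hμ (key := vertexKey Ω.G.n)
      hY.key_le hY.one_le (i := 0)
      (L := List.ofFn fun v => (v, List.ofFn (Ω.sig v)))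
      (consecutive_ofFn _ _ _ 0 fun j => by simp [vertexKey])
      (by rw [List.length_ofFn]; have := hY.zero_le; omega)
      (by
        intro e he
        simp only [List.mem_ofFn] at he
        obtain ⟨v, rfl⟩ := he
        exact ⟨by simp, hsig v, hf v⟩)
    rw [List.map_ofFn, List.map_ofFn, List.length_ofFn] at this
    refine this.mono ?_
    calc (Ω.G.n + 1) * (22 * Y + 2 * (3 * Y ^ 2) + 80)
        ≤ (2 * Y) * (108 * Y ^ 2) := Nat.mul_le_mul (by omega) (by omega)
      _ = 216 * Y ^ 3 := by ring
      _ ≤ 400 * Y ^ 3 := Nat.mul_le_mul_right _ (by norm_num)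
  have hk := hY.factor_le
  set k : K := (((4 * defaultError P : ℕ) : ℚ) : K) with hkdef
  set κ : K := ((1 - 1 / (20 * P) : ℚ) : K) with hκdef
  have mt : μ (k * (1 + 1 / ε)) ≤ 7 * Y := by
    have := hμ.mul_le k (1 + 1 / ε)
    have := hμ.add_le 1 (1 / ε)
    have := hμ.div_le 1 ε
    have := hY.one_le
    have := hY.eps_le
    omega
  have hscale := runs_scale (P := P) (M := 16 * Y ^ 2) hμ (k * (1 + 1 / ε))
    (Ω.edgeList.map (encEdge (vertexKey Ω.G.n)))
    (by
      simp only [List.length_map, HolantInstance.edgeList, List.length_ofFn]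
      calc (Ω.G.m + 1) * (μ (k * (1 + 1 / ε)) + 1) ≤ (2 * Y) * (8 * Y) :=
            Nat.mul_le_mul (by omega) (by omega)
        _ = 16 * Y ^ 2 := by ring)
  simp only [List.length_map, HolantInstance.edgeList, List.length_ofFn] at hscale
  have mt2 : μ (((Ω.G.m : K) + 1) * (k * (1 + 1 / ε))) ≤ 16 * Y ^ 2 := by
    refine hscale.1.trans ?_
    calc (Ω.G.m + 1) * (μ (k * (1 + 1 / ε)) + 1) ≤ (2 * Y) * (8 * Y) :=
          Nat.mul_le_mul (by omega) (by omega)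
      _ = 16 * Y ^ 2 := by ring
  have hlevels := runs_levels (W := Y) (P := P) (M := 18 * Y ^ 2) hμ hY.one_le rfl hY.rate_le h
    (by
      have : h * (Y + 1) ≤ Y * (2 * Y) := Nat.mul_le_mul (by omega) (by omega)
      have e : Y * (2 * Y) = 2 * Y ^ 2 := by ring
      omega) hlt hge
  have b16 : 16 ^ (h + 2 * P) ≤ Y := (Nat.pow_le_pow_left (by norm_num) _).trans hpow
  have hlen : (levelList P h).length = h + 2 * P := length_levelList P h
  have hX : (List.ofFn fun v => (v, Ω.quot v, Ω.param v)).length + Ω.edgeList.length *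
      (2 * (2 * (5 * Y) + 2) + 3) + 5 * Y + 2 * (2 * (5 * Y) + 2) ≤ 60 * Y ^ 2 := by
    rw [List.length_ofFn, HolantInstance.edgeList, List.length_ofFn]
    have : Ω.G.m * (2 * (2 * (5 * Y) + 2) + 3) ≤ Y * (27 * Y) := Nat.mul_le_mul hm (by omega)
    have e : Y * (27 * Y) = 27 * Y ^ 2 := by ring
    omega
  have hX' : Ω.edgeList.length * (2 * (2 * (5 * Y) + 2)) + 5 * Y + 2 * (2 * (5 * Y) + 2) ≤
      60 * Y ^ 2 := by
    refine le_trans ?_ hX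
    have : Ω.edgeList.length * (2 * (2 * (5 * Y) + 2)) ≤ Ω.edgeList.length *
      (2 * (2 * (5 * Y) + 2) + 3) := Nat.mul_le_mul_left _ (by omega)
    omega
  have hM : Ω.edgeList.length * (2 * (16 ^ (levelList P h).length * (60 * Y ^ 2)) + 5 * Y + 3) +
      5 * Y ≤ 140 * Y ^ 4 := by
    rw [hlen, HolantInstance.edgeList, List.length_ofFn]
    have b2 : 16 ^ (h + 2 * P) * (60 * Y ^ 2) ≤ Y * (60 * Y ^ 2) := Nat.mul_le_mul_right _ b16
    have e2 : Y * (60 * Y ^ 2) = 60 * Y ^ 3 := by ring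
    have : Ω.G.m * (2 * (16 ^ (h + 2 * P) * (60 * Y ^ 2)) + 5 * Y + 3) ≤ Y * (128 * Y ^ 3) :=
      Nat.mul_le_mul hm (by omega)
    have e : Y * (128 * Y ^ 3) = 128 * Y ^ 4 := by ring
    omega
  have hprod := runs_prod (P := P) hS (levelList P h) (represents_ofFn Ω.quot Ω.param) hs hes hX hM
  have mprod := (approxProd_measure hS (levelList P h) (fun v => (hs v).2)
    (fun e he => (hes e he).2) hX').trans hM
  rw [encode_eq]
  have w1 := hμ.w_le 0
  have w2 := hμ.w_le Ω.topProd
  have w3 := hμ.w_le k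
  have w4 := hμ.w_le 1
  have w5 := hμ.w_le (1 / ε)
  have w6 := hμ.w_le ε
  have w7 := hμ.w_le (1 + 1 / ε)
  have w8 := hμ.w_le (approxProd Ω.param (levelList P h) Ω.quot Ω.edgeList)
  have m1 := hμ.add_le 1 (1 / ε)
  have m2 := hμ.div_le 1 ε
  have n1 := hY.one_le
  have n2 := hY.eps_le
  have n3 := hY.zero_le
  refine Runs.mono (.call (.var rfl) rfl (b := mainBody (4 * defaultError P))
    (.letIn (.call (.fst (.snd (.var rfl))) rfl h2)
      (.ifLt_pos (.const 0 Rat.cast_zero) (.var rfl) h0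
        (.mul (.var rfl) (.call (.pair (.call (.call (.pair
          (.mul (.const (x := k) _ rfl) (.add (.const 1 Rat.cast_one) (.div (.const 1 Rat.cast_one)
            (.fst (.var rfl)) hε))) (.snd (.snd (.var rfl)))) rfl hscale.2) rfl hlevels)
          (.pair (.call (.pair (.const 0 Rat.cast_zero) (.fst (.snd (.var rfl)))) rfl hinit)
            (.snd (.snd (.var rfl))))) rfl hprod))))) ?_
  have c1 : (Ω.G.m + 1) * (4 * (16 * Y ^ 2) + 20) ≤ (2 * Y) * (84 * Y ^ 2) :=
    Nat.mul_le_mul (by omega) (by omega)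
  have c1' : (2 * Y) * (84 * Y ^ 2) = 168 * Y ^ 3 := by ring
  have c2 : (h + 1) * (4 * Y + 4 * (18 * Y ^ 2) + 20) ≤ Y * (96 * Y ^ 2) :=
    Nat.mul_le_mul hhY (by omega)
  have c2' : Y * (96 * Y ^ 2) = 96 * Y ^ 3 := by ring
  have c3 : 64 ^ (levelList P h).length * ((5 * Y + 1) * (60 * Y ^ 2)) ≤
      Y * ((6 * Y) * (60 * Y ^ 2)) := by
    rw [hlen]
    exact Nat.mul_le_mul hpow (Nat.mul_le_mul_right _ (by omega))
  have c3' : Y * ((6 * Y) * (60 * Y ^ 2)) = 360 * Y ^ 4 := by ring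
  have c4 : Ω.edgeList.length * (4000 * (64 ^ (levelList P h).length *
      ((5 * Y + 1) * (60 * Y ^ 2))) + 2 * (140 * Y ^ 4)) ≤ Y * (1440280 * Y ^ 4) := by
    refine Nat.mul_le_mul ?_ (by omega)
    rw [HolantInstance.edgeList, List.length_ofFn]
    exact hm
  have c4' : Y * (1440280 * Y ^ 4) = 1440280 * Y ^ 5 := by ring
  rw [c1'] at c1
  rw [c2'] at c2
  rw [c4'] at c4
  have c5 : 1 ≤ Y ^ 5 := Nat.one_le_pow _ _ hY1
  generalize Ω.edgeList.length * (4000 * (64 ^ (levelList P h).length *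
      ((5 * Y + 1) * (60 * Y ^ 2))) + 2 * (140 * Y ^ 4)) = T1 at *
  generalize (h + 1) * (4 * Y + 4 * (18 * Y ^ 2) + 20) = T2 at *
  generalize (Ω.G.m + 1) * (4 * (16 * Y ^ 2) + 20) = T3 at *
  omega

end Main

/-! ## Lengths of rational numbers -/

/-- The larger of the numbers of binary digits of the numerator and the denominator. -/
def ratMeasure (q : ℚ) : ℕ := max q.num.natAbs.size q.den.size

theorem num_lt_two_pow_ratMeasure (q : ℚ) : |q.num| < 2 ^ ratMeasure q := by
  have : q.num.natAbs < 2 ^ ratMeasure q := Nat.size_le.1 (le_max_left _ _)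
  rw [Int.abs_eq_natAbs]
  exact_mod_cast this

theorem den_lt_two_pow_ratMeasure (q : ℚ) : (q.den : ℤ) < 2 ^ ratMeasure q := by
  have : q.den < 2 ^ ratMeasure q := Nat.size_le.1 (le_max_right _ _)
  exact_mod_cast this

/-- Reduction to lowest terms only shortens, so any fraction representing the number bounds its
length. -/
theorem ratMeasure_div_le {n d : ℤ} {k : ℕ} (hd : d ≠ 0) (hn : |n| < 2 ^ k) (hdk : |d| < 2 ^ k) :
    ratMeasure ((n : ℚ) / d) ≤ k := by
  have hn' : n.natAbs < 2 ^ k := by rw [Int.abs_eq_natAbs] at hn; exact_mod_cast hn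
  have hd' : d.natAbs < 2 ^ k := by rw [Int.abs_eq_natAbs] at hdk; exact_mod_cast hdk
  rw [← Rat.divInt_eq_div]
  refine max_le (Nat.size_le.2 ?_) (Nat.size_le.2 ?_)
  · rcases eq_or_ne n 0 with rfl | h
    · simp
    · exact (Nat.le_of_dvd (Int.natAbs_pos.2 h)
        (Int.natAbs_dvd_natAbs.2 (Rat.num_dvd n hd))).trans_lt hn'
  · refine (Nat.le_of_dvd (Int.natAbs_pos.2 hd) ?_).trans_lt hd'
    exact Int.natCast_dvd.1 (Rat.den_dvd n d)

theorem abs_mul_lt_two_pow {a b : ℤ} {j k : ℕ} (ha : |a| < 2 ^ j) (hb : |b| < 2 ^ k) :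
    |a * b| < 2 ^ (j + k) := by
  rw [abs_mul, pow_add]
  exact mul_lt_mul'' ha hb (abs_nonneg _) (abs_nonneg _)

theorem ratMeasure_add_le (x y : ℚ) : ratMeasure (x + y) ≤ ratMeasure x + ratMeasure y + 1 := by
  have hx : (x.den : ℤ) ≠ 0 := by exact_mod_cast x.den_ne_zero
  have hy : (y.den : ℤ) ≠ 0 := by exact_mod_cast y.den_ne_zero
  have e : x + y = ((x.num * y.den + y.num * x.den : ℤ) : ℚ) / ((x.den * y.den : ℤ) : ℚ) := by
    conv_lhs => rw [← Rat.num_div_den x, ← Rat.num_div_den y]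
    have hx' : (x.den : ℚ) ≠ 0 := by exact_mod_cast hx
    have hy' : (y.den : ℚ) ≠ 0 := by exact_mod_cast hy
    push_cast
    field_simp
  have d1 : |(x.den : ℤ)| < 2 ^ ratMeasure x := by simpa using den_lt_two_pow_ratMeasure x
  have d2 : |(y.den : ℤ)| < 2 ^ ratMeasure y := by simpa using den_lt_two_pow_ratMeasure y
  have h1 := abs_mul_lt_two_pow (num_lt_two_pow_ratMeasure x) d2
  have h2 := abs_mul_lt_two_pow (num_lt_two_pow_ratMeasure y) d1
  have h3 := abs_mul_lt_two_pow d1 d2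
  rw [add_comm (ratMeasure y)] at h2
  rw [e]
  refine ratMeasure_div_le (mul_ne_zero hx hy) ?_ ?_
  · rw [pow_succ]
    linarith [abs_add_le (x.num * y.den) (y.num * x.den)]
  · rw [pow_succ]
    linarith [abs_nonneg ((x.den : ℤ) * y.den)]

theorem ratMeasure_mul_le (x y : ℚ) : ratMeasure (x * y) ≤ ratMeasure x + ratMeasure y + 1 := by
  have hx : (x.den : ℤ) ≠ 0 := by exact_mod_cast x.den_ne_zero
  have hy : (y.den : ℤ) ≠ 0 := by exact_mod_cast y.den_ne_zero
  have e : x * y = ((x.num * y.num : ℤ) : ℚ) / ((x.den * y.den : ℤ) : ℚ) := by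
    conv_lhs => rw [← Rat.num_div_den x, ← Rat.num_div_den y]
    push_cast
    rw [div_mul_div_comm]
  have d1 : |(x.den : ℤ)| < 2 ^ ratMeasure x := by simpa using den_lt_two_pow_ratMeasure x
  have d2 : |(y.den : ℤ)| < 2 ^ ratMeasure y := by simpa using den_lt_two_pow_ratMeasure y
  have h1 := abs_mul_lt_two_pow (num_lt_two_pow_ratMeasure x) (num_lt_two_pow_ratMeasure y)
  rw [e]
  exact (ratMeasure_div_le (mul_ne_zero hx hy) h1 (abs_mul_lt_two_pow d1 d2)).trans
    (Nat.le_succ _)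

theorem ratMeasure_neg (x : ℚ) : ratMeasure (-x) = ratMeasure x := by
  simp [ratMeasure]

theorem ratMeasure_inv (x : ℚ) (hx : x ≠ 0) : ratMeasure x⁻¹ ≤ ratMeasure x := by
  have e : x⁻¹ = ((x.den : ℤ) : ℚ) / (x.num : ℚ) := by
    conv_lhs => rw [← Rat.num_div_den x, inv_div]
    simp
  conv_lhs => rw [e]
  exact ratMeasure_div_le (Rat.num_ne_zero.2 hx)
    (by simpa using den_lt_two_pow_ratMeasure x) (num_lt_two_pow_ratMeasure x)

theorem lengthBound_ratLength : LengthBound ratLength ratMeasure where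
  w_le x := by
    have h1 : x.num.natAbs.size ≤ ratMeasure x := le_max_left _ _
    have h2 : x.den.size ≤ ratMeasure x := le_max_right _ _
    unfold ratLength
    omega
  le_w x := max_le (Nat.le_add_right _ _) (Nat.le_add_left _ _)
  add_le := ratMeasure_add_le
  sub_le x y := by
    have := ratMeasure_add_le x (-y)
    rwa [← sub_eq_add_neg, ratMeasure_neg] at this
  mul_le := ratMeasure_mul_le
  div_le x y := by
    rcases eq_or_ne y 0 with rfl | hy
    · have : ratMeasure 0 = 1 := by simp [ratMeasure]
      rw [div_zero, this]
      omega
    · have h1 := ratMeasure_mul_le x y⁻¹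
      have h2 := ratMeasure_inv y hy
      rw [← div_eq_mul_inv] at h1
      omega

theorem lengthBound_unit {K : Type} [Field K] :
    LengthBound (fun _ : K => 0) (fun _ : K => 0) := by
  constructor <;> simp

/-! ## The size of the input -/

section Size

variable {K : Type}

theorem length_lt_size_ofList (w : K → ℕ) (l : List (Val K)) :
    l.length < (Val.ofList l).size w := by
  induction l with
  | nil => simp [Val.ofList, Val.size]
  | cons a l ih => simp only [Val.ofList, Val.size, List.length_cons]; omega

theorem size_lt_size_ofList (w : K → ℕ) {a : Val K} {l : List (Val K)} (h : a ∈ l) :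
    a.size w < (Val.ofList l).size w := by
  induction l with
  | nil => simp at h
  | cons b l ih =>
    simp only [Val.ofList, Val.size]
    rcases List.mem_cons.1 h with rfl | h
    · omega
    · have := ih h
      omega

variable [Field K]

theorem LengthBound.natCast_le {w μ : K → ℕ} (hμ : LengthBound w μ) (i : ℕ) :
    μ (i : K) ≤ μ 0 + i * (μ 1 + 1) := by
  induction i with
  | zero => simp
  | succ i ih =>
    have := hμ.add_le (i : K) 1
    rw [Nat.cast_succ, Nat.add_one_mul i]
    omega

/-- A bound on the lengths of the constants of the program. -/
def constBound (μ : K → ℕ) (P : ℕ) : ℕ :=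
  μ 0 + μ 1 + μ 2 + μ (100 / 117) + μ ((1 - 1 / (20 * P) : ℚ) : K) +
    μ (((4 * defaultError P : ℕ) : ℚ) : K) + P + 1

theorem edges_lt_size_encode (w : K → ℕ) (Ω : HolantInstance K) (ε : K) :
    Ω.G.m < (Ω.encode ε).size w := by
  have h := length_lt_size_ofList w (List.ofFn fun e => (.pair (.num ((Ω.G.src e : ℕ) : K))
    (.pair (.num ((Ω.G.tgt e : ℕ) : K)) (.num (Ω.lam e))) : Val K))
  rw [List.length_ofFn] at h
  simp only [HolantInstance.encode, Val.size]
  omega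

/-- Every number of the input is a leaf of the encoding, and the counts are lengths of its lists.
The names of vertices are bounded through their value, as sums of at most `n` ones, which is uniform
in the two cost models. -/
theorem inputBound_of_le {w μ : K → ℕ} (hμ : LengthBound w μ) {P : ℕ} {Ω : HolantInstance K}
    {ε : K} {Y : ℕ} (hY : constBound μ P * ((Ω.encode ε).size w + 1) ≤ Y) :
    InputBound μ P Ω ε Y := by
  set N := (Ω.encode ε).size w with hN
  have hm : Ω.G.m < N := edges_lt_size_encode w Ω ε
  set fs : List (Val K) :=
    List.ofFn fun v => Val.ofList (List.ofFn fun i => .num (Ω.sig v i)) with hfs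
  set es : List (Val K) := List.ofFn fun e => .pair (.num ((Ω.G.src e : ℕ) : K))
    (.pair (.num ((Ω.G.tgt e : ℕ) : K)) (.num (Ω.lam e))) with hes
  have hsize : N = w ε + 1 + ((Val.ofList fs).size w + (Val.ofList es).size w + 1) + 1 := rfl
  have hn : Ω.G.n < N := by
    have := length_lt_size_ofList w fs
    rw [hfs, List.length_ofFn, ← hfs] at this
    omega
  have hv : ∀ v, (Val.ofList (List.ofFn fun i => .num (Ω.sig v i))).size w < N := by
    intro v
    have := size_lt_size_ofList w (l := fs) (List.mem_ofFn.2 ⟨v, rfl⟩)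
    omega
  have h1 : constBound μ P ≤ Y := le_trans (Nat.le_mul_of_pos_right _ (Nat.succ_pos _)) hY
  have h2 : N ≤ Y := by
    refine le_trans ?_ hY
    have : 1 * (N + 1) ≤ constBound μ P * (N + 1) :=
      Nat.mul_le_mul_right _ (by unfold constBound; omega)
    omega
  have h3 : ∀ i, i ≤ N → μ (i : K) ≤ Y := by
    intro i hi
    refine (hμ.natCast_le i).trans (le_trans ?_ hY)
    have a1 : μ 0 ≤ constBound μ P := by unfold constBound; omega
    have a2 : i * (μ 1 + 1) ≤ N * constBound μ P :=
      Nat.mul_le_mul hi (by unfold constBound; omega)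
    have a3 : constBound μ P * (N + 1) = N * constBound μ P + constBound μ P := by ring
    omega
  unfold constBound at h1
  refine ⟨by omega, by omega, by omega, by omega, by omega, by omega, ?_, fun v i => ?_,
    fun e => ?_, fun v => h3 _ (v.2.le.trans hn.le), by omega, by omega, fun v => ?_⟩
  · have := hμ.le_w ε
    omega
  · have := size_lt_size_ofList w (l := List.ofFn fun i => .num (Ω.sig v i))
      (List.mem_ofFn.2 ⟨i, rfl⟩)
    have := hv v
    have := hμ.le_w (Ω.sig v i)
    simp only [Val.size] at *
    omega
  · have := size_lt_size_ofList w (l := es) (List.mem_ofFn.2 ⟨e, rfl⟩)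
    have := hμ.le_w (Ω.lam e)
    simp only [Val.size] at *
    omega
  · have := length_lt_size_ofList w (List.ofFn fun i => (.num (Ω.sig v i) : Val K))
    rw [List.length_ofFn] at this
    have := hv v
    omega

end Size

/-! ## The number of levels -/

/-- The least `h` with `κ ^ h T < 1` is logarithmic in `T`; through `64 κ ^ j ≤ 1` this is stated as
a polynomial bound for `64 ^ h`, the form needed for the running time. -/
theorem exists_level {κ T : ℝ} (h1 : 1 / 2 ≤ κ) (h2 : κ < 1) (hT : 1 ≤ T) {j : ℕ}
    (hj : 64 * κ ^ j ≤ 1) :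
    ∃ h : ℕ, κ ^ h * T < 1 ∧ (∀ i < h, 1 ≤ κ ^ i * T) ∧ (64 : ℝ) ^ h ≤ (2 * T) ^ j := by
  have hκ : 0 < κ := by linarith
  have hex : ∃ h : ℕ, κ ^ h * T < 1 := by
    obtain ⟨h, hh⟩ := exists_pow_lt_of_lt_one (show 0 < 1 / T by positivity) h2
    exact ⟨h, by rwa [lt_div_iff₀ (by linarith)] at hh⟩
  classical
  refine ⟨Nat.find hex, Nat.find_spec hex, fun i hi => not_lt.1 (Nat.find_min hex hi), ?_⟩
  -- By minimality the previous level is still at least `1`, and `κ ≥ 1/2` costs a factor of at most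
  -- `2`.
  have hlow : 1 ≤ κ ^ Nat.find hex * (2 * T) := by
    rcases Nat.eq_zero_or_pos (Nat.find hex) with h0 | h0
    · rw [h0, pow_zero]
      linarith
    · have := not_lt.1 (Nat.find_min hex (Nat.sub_lt h0 one_pos))
      obtain ⟨i, hi⟩ := Nat.exists_eq_add_of_lt h0
      rw [zero_add] at hi
      rw [hi, Nat.add_sub_cancel] at this
      rw [hi, pow_succ]
      nlinarith [show 0 < κ ^ i * T by positivity]
  generalize Nat.find hex = h at hlow
  calc (64 : ℝ) ^ h = 64 ^ h * 1 := by ring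
    _ ≤ 64 ^ h * (κ ^ h * (2 * T)) ^ j :=
        mul_le_mul_of_nonneg_left (one_le_pow₀ hlow) (by positivity)
    _ = (64 * κ ^ j) ^ h * (2 * T) ^ j := by
        rw [mul_pow (κ ^ h), mul_pow 64, ← pow_mul, ← pow_mul, mul_comm h j, mul_assoc]
    _ ≤ 1 * (2 * T) ^ j :=
        mul_le_mul_of_nonneg_right (pow_le_one₀ (by positivity) hj) (by positivity)
    _ = (2 * T) ^ j := one_mul _

/-- Multiplying the hypothesis by `ε` turns `1 + 1/ε` into `1 + ε`; the factor `4` is the `2` for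
two ratios per edge times the `2` in the target. -/
theorem level_error_le {κ ε E m : ℝ} (hε : 0 < ε) (hm : 0 ≤ m) (hE : 0 ≤ E) (hκ : 0 ≤ κ)
    (h : κ * ((m + 1) * (4 * E * (1 + 1 / ε))) < 1) :
    m * (2 * (κ * E)) ≤ ε / (2 * (1 + ε)) := by
  rw [le_div_iff₀ (by linarith)]
  have e : κ * ((m + 1) * (4 * E * (1 + 1 / ε))) * ε = 4 * κ * E * (m + 1) * (1 + ε) := by
    field_simp
    ring
  have h1 : 4 * κ * E * (m + 1) * (1 + ε) ≤ ε := by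
    rw [← e]
    nlinarith
  have h2 : 0 ≤ 4 * κ * E * (1 + ε) := by positivity
  nlinarith

/-! ## The approximation scheme -/

section Scheme

variable {K : Type} [Field K] [LinearOrder K] [IsStrictOrderedRing K]

theorem runs_main_of_level {w μ : K → ℕ} (hμ : LengthBound w μ) {φ : K →+* ℝ} (hφ : StrictMono φ)
    {p : ℝ} (hp : 0 < p) {P : ℕ} (hP : 1 ≤ P) (hPp : 1 / p ≤ P) {Ω : HolantInstance K}
    (hΩ : (Ω.map φ).IsInputOf (fibonacciFamilyFrom 1.17 p) (Set.Ici 1)) (h0 : 0 < Ω.topProd)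
    {ε : K} (hε : 0 < ε) {h Y : ℕ}
    (hY : constBound μ P * ((Ω.encode ε).size w + 1) * 64 ^ (h + 2 * P) ≤ Y)
    (hlt : decayRate P ^ h * (((Ω.G.m : ℝ) + 1) * (4 * defaultError P * (1 + 1 / φ ε))) < 1)
    (hge : ∀ i < h,
      1 ≤ decayRate P ^ i * (((Ω.G.m : ℝ) + 1) * (4 * defaultError P * (1 + 1 / φ ε)))) :
    Runs w (program P) [Ω.encode ε] (.call 0 (.var 0)) (.num (Ω.approxZ P h))
      (2000000 * Y ^ 5) := by
  have hc1 : P + 1 ≤ constBound μ P := by unfold constBound; omega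
  have hN1 : 1 ≤ (Ω.encode ε).size w + 1 := by omega
  have hA : P + 1 ≤ constBound μ P * ((Ω.encode ε).size w + 1) :=
    hc1.trans (Nat.le_mul_of_pos_right _ hN1)
  have hB : 1 ≤ 64 ^ (h + 2 * P) := Nat.one_le_pow _ _ (by norm_num)
  have hAY := (Nat.le_mul_of_pos_right (constBound μ P * ((Ω.encode ε).size w + 1)) hB).trans hY
  have hBY := (Nat.le_mul_of_pos_left (64 ^ (h + 2 * P)) (by omega)).trans hY
  have htop : (Ω.map φ).topProd ≠ 0 := by
    rw [HolantInstance.topProd_map]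
    exact ((map_zero φ).symm.trans_lt (hφ h0)).ne'
  have hv : ∀ v, (Ω.map φ).sig v (Fin.last _) ≠ 0 := fun v =>
    Finset.prod_ne_zero_iff.1 htop v (Finset.mem_univ v)
  have H := fun v => vertexParams_spec hp hP hPp (hΩ.1 v) (hv v)
  have hpos : ∀ {x : K}, 0 < φ x → 0 < x := fun {x} hx => hφ.lt_iff_lt.1 (by rwa [map_zero])
  have hT : ∀ i, φ (((1 - 1 / (20 * P) : ℚ) : K) ^ i *
      (((Ω.G.m : K) + 1) * ((((4 * defaultError P : ℕ) : ℚ) : K) * (1 + 1 / ε)))) =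
      decayRate P ^ i * (((Ω.G.m : ℝ) + 1) * (4 * defaultError P * (1 + 1 / φ ε))) := by
    intro i
    simp only [map_mul, map_pow, map_add, map_div₀, map_one, map_natCast, map_ratCast, decayRate]
    push_cast
    rfl
  refine runs_main_of_topProd_pos hμ (inputBound_of_le hμ hAY) (by omega) h0 hε.ne'
    (fun e => hpos ?_) (fun v => hpos ?_) (fun v => ?_) (fun v a b l hl => ?_) ?_ (fun i hi => ?_)
    hBY ?_ (by omega)
  · exact lt_of_lt_of_le one_pos (hΩ.2 e)
  · rw [show φ (Ω.param v) = (Ω.map φ).param v from (congrFun (Ω.param_map φ) v).symm]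
    exact lt_of_lt_of_le (by norm_num) (H v).1
  · refine hφ.le_iff_le.1 ?_
    rw [map_zero, show φ (Ω.quot v) = (Ω.map φ).quot v from (congrFun (Ω.quot_map φ) v).symm]
    refine le_of_le_of_eq ?_ (H v).2.2.1
    exact div_nonneg (H v).2.1.1 (H v).2.1.2.le
  · have e : List.ofFn ((Ω.map φ).sig v) = φ a :: φ b :: l.map φ := by
      have := congrArg (List.map φ) hl
      rw [List.map_ofFn] at this
      exact this
    have hb := (H v).2.1.2
    rw [e] at hb
    exact (hpos hb).ne'
  · rw [← hφ.lt_iff_lt, hT, map_one]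
    exact hlt
  · rw [← hφ.le_iff_le, hT, map_one]
    exact hge i hi
  · have : h + 1 ≤ 64 ^ h := Nat.lt_pow_self (by norm_num)
    exact (this.trans (Nat.pow_le_pow_right (by norm_num) (Nat.le_add_right _ _))).trans hBY

theorem isFPTAS_program [Algebra K ℝ] (hφ : StrictMono (algebraMap K ℝ)) {w μ : K → ℕ}
    (hμ : LengthBound w μ) {p : ℝ} (hp : 0 < p) {P : ℕ} (hP : 1 ≤ P) (hPp : 1 / p ≤ P) :
    IsFPTAS K w (program P) (fibonacciFamilyFrom 1.17 p) (Set.Ici 1) := by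
  have hP1 : (1 : ℝ) ≤ P := by exact_mod_cast hP
  obtain ⟨hκ1, hκ2⟩ := decayRate_bounds hP1
  -- The degree `j` depends only on the rate, hence only on `P`.
  obtain ⟨j, hj⟩ := exists_pow_lt_of_lt_one (show (0 : ℝ) < 1 / 64 by norm_num) hκ2
  set k : ℝ := 4 * defaultError P with hk
  have hk1 : 1 ≤ k := by
    have : 1 ≤ defaultError P := by unfold defaultError; nlinarith
    have : (1 : ℝ) ≤ defaultError P := by exact_mod_cast this
    linarith
  -- Collects the constants of `N + 1 ≤ 2 S` and `64 ^ h ≤ (2 T) ^ j ≤ (8 k S ^ 2) ^ j`; the powers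
  -- of `S` add up to `2 j + 1`.
  set A : ℝ := constBound μ P * 2 * 64 ^ (2 * P) * (8 * k) ^ j with hA
  have hA0 : 0 ≤ A := by positivity
  refine ⟨2000000 * A ^ 5, (2 * j + 1) * 5, fun Ω hΩ ε hε => ?_⟩
  set φ := algebraMap K ℝ with hφdef
  have hε' : 0 < φ ε := (map_zero φ).symm.trans_lt (hφ hε)
  set N := (Ω.encode ε).size w with hN
  have hmN : Ω.G.m + 1 ≤ N := edges_lt_size_encode w Ω ε
  have hmN' : (Ω.G.m : ℝ) + 1 ≤ N := by exact_mod_cast hmN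
  have hm0 : (0 : ℝ) ≤ Ω.G.m := Nat.cast_nonneg _
  set S : ℝ := N + 1 / φ ε with hS
  have hiε : 0 < 1 / φ ε := by positivity
  have hS1 : 1 ≤ S := by linarith
  set T : ℝ := ((Ω.G.m : ℝ) + 1) * (k * (1 + 1 / φ ε)) with hT
  have hT1 : 1 ≤ T := one_le_mul_of_one_le_of_one_le (by linarith)
    (one_le_mul_of_one_le_of_one_le hk1 (by linarith))
  have hTS : 2 * T ≤ 8 * k * S ^ 2 := by
    have : ((Ω.G.m : ℝ) + 1) * (1 + 1 / φ ε) ≤ S * S :=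
      mul_le_mul (by linarith) (by linarith) (by linarith) (by linarith)
    rw [hT]
    nlinarith [sq_nonneg S]
  obtain ⟨h, hlt, hge, hpow⟩ := exists_level (by linarith) hκ2 hT1 (j := j) (by linarith)
  set Y := constBound μ P * (N + 1) * 64 ^ (h + 2 * P) with hY
  have hYS : (Y : ℝ) ≤ A * S ^ (2 * j + 1) := by
    rw [hY]
    push_cast
    have h1 : (64 : ℝ) ^ h ≤ (8 * k * S ^ 2) ^ j :=
      hpow.trans (pow_le_pow_left₀ (by linarith) hTS j)
    calc (constBound μ P : ℝ) * (N + 1) * 64 ^ (h + 2 * P)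
        = constBound μ P * (N + 1) * 64 ^ (2 * P) * 64 ^ h := by rw [pow_add]; ring
      _ ≤ constBound μ P * (2 * S) * 64 ^ (2 * P) * (8 * k * S ^ 2) ^ j := by
          gcongr
          linarith
      _ = A * S ^ (2 * j + 1) := by
          rw [hA, mul_pow (8 * k), ← pow_mul, pow_succ]
          ring
  have htime : ∀ t : ℕ, t ≤ 2000000 * Y ^ 5 →
      (t : ℝ) ≤ 2000000 * A ^ 5 * S ^ ((2 * j + 1) * 5) := by
    intro t ht
    calc (t : ℝ) ≤ ((2000000 * Y ^ 5 : ℕ) : ℝ) := by exact_mod_cast ht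
      _ = 2000000 * (Y : ℝ) ^ 5 := by push_cast; ring
      _ ≤ 2000000 * (A * S ^ (2 * j + 1)) ^ 5 := by gcongr
      _ = 2000000 * A ^ 5 * S ^ ((2 * j + 1) * 5) := by rw [mul_pow, ← pow_mul]; ring
  have hZ0 := HolantInstance.Z_nonneg hΩ
  by_cases h0 : 0 < Ω.topProd
  · obtain ⟨t, ht, hrun⟩ := runs_main_of_level hμ hφ hp hP hPp hΩ h0 hε le_rfl hlt hge
    refine ⟨_, t, hrun, ?_, htime t ht⟩
    have htop : (Ω.map φ).topProd ≠ 0 := by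
      rw [HolantInstance.topProd_map]
      exact ((map_zero φ).symm.trans_lt (hφ h0)).ne'
    have hclose := HolantInstance.logClose_approxZ hp hP hPp hΩ htop h
    rw [HolantInstance.approxZ_map φ hφ] at hclose
    refine relApprox_of_logClose hε' ?_ hZ0 hclose
    exact level_error_le hε' hm0 (Nat.cast_nonneg _) (pow_nonneg (by linarith) _) hlt
  · have hYA : constBound μ P * (N + 1) ≤ Y :=
      Nat.le_mul_of_pos_right _ (Nat.pow_pos (by norm_num))
    have hY1 : 1 ≤ Y := le_trans (Nat.mul_pos (by unfold constBound; omega) (by omega)) hYA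
    obtain ⟨t, ht, hrun⟩ := runs_main_of_topProd_le hμ (inputBound_of_le hμ hYA) hY1 h0
    have hYY : Y ^ 3 ≤ Y ^ 5 := Nat.pow_le_pow_right hY1 (by norm_num)
    refine ⟨0, t, hrun, ?_, htime t (by omega)⟩
    -- Vertex functions are nonnegative, so a product that is not positive is zero, and the answer
    -- `0` is exact.
    have htop : (Ω.map φ).topProd = 0 := by
      refine le_antisymm ?_ (Finset.prod_nonneg fun v _ => ?_)
      · rw [HolantInstance.topProd_map, ← map_zero φ]
        exact hφ.monotone (not_lt.1 h0)
      · have := hΩ.1 v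
        simp only [fibonacciFamilyFrom, Set.mem_iUnion] at this
        obtain ⟨c, -, h, -⟩ := this
        exact h _
    have hZ := HolantInstance.Z_eq_zero_of_topProd hp hΩ htop
    exact ⟨fun _ => map_zero φ, fun h => absurd hZ h⟩

end Scheme

end HolantProgram

theorem theorem2 (p : ℝ) (hp : 0 < p) :
    HasFPTAS (fibonacciFamilyFrom 1.17 p) (Set.Ici 1) := by
  have hP : 1 / p ≤ ((max 1 ⌈1 / p⌉₊ : ℕ) : ℝ) :=
    (Nat.le_ceil _).trans (by exact_mod_cast le_max_right _ _)
  refine ⟨HolantProgram.program (max 1 ⌈1 / p⌉₊), ?_, ?_⟩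
  · exact HolantProgram.isFPTAS_program strictMono_id HolantProgram.lengthBound_unit hp
      (le_max_left _ _) hP
  · exact HolantProgram.isFPTAS_program (K := ℚ) (Rat.cast_strictMono (K := ℝ))
      HolantProgram.lengthBound_ratLength hp (le_max_left _ _) hP
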